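/- **Setting.** Let $\mu(x)=e^x/(1+e^x)$, let $\phi_1,\phi_2,\dots:[0,1]\to\mathbb R$ be functions with $\sup_j\|\phi_j\|_\infty<\infty$, and for a coefficient sequence $\theta$ put $f_\theta=\sum_j\theta_j\phi_j$, $q_\theta=\mu(f_\theta)$. For each $n$ let $x_1,\dots,x_n\in[0,1]$ be fixed design points (which may depend on $n$), and let $P_\theta^{(n)}$ be the law of independent $Y_1,\dots,Y_n\in\{0,1\}$ with $P(Y_i=1)=q_\theta(x_i)$. Let $\Phi_k=(\phi_j(x_i))_{i\le n,\,j\le k}$ and assume that, for some $C_0>0$ and integers $K_n$, $C_0^{-1}I_k\le \Phi_k^T\Phi_k/n\le C_0I_k$ for all $k\le K_n$ and $n\ge 1$. Let $S^\beta(L_0)=\{\theta:\sum_{i\ge1}\theta_i^2i^{2\beta}\le L_0\}$, $L_0>0$; fix $\beta_0>1/2$ and assume $K_n\gg n^{1/(2(\beta_0-1/2))}$. Let $$h_n^2(q_1,q_2)=\frac1n\sum_{i=1}^n\Big\{\big(\sqrt{q_1(x_i)}-\sqrt{q_2(x_i)}\big)^2+\big(\sqrt{1-q_1(x_i)}-\sqrt{1-q_2(x_i)}\big)^2\Big\}.$$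 **Prior and posterior.** Given $k\ge1$, $\theta\in\Theta(k)=\mathbb R^k$ has i.i.d. coordinates with a density $g$ satisfying $G_1e^{-G_2|x|^q}\le g(x)\le G_3e^{-G_4|x|^q}$ for constants $G_1,\dots,G_4>0$, $q\ge1$. In the hierarchical approach $k\in\{1,2,\dots\}$ has a geometric distribution, or a Poisson distribution conditioned on $k\ge1$. In the empirical Bayes approach $k$ is replaced in the conditional posterior given $k$ by any maximizer $\hat k_n$ of the marginal likelihood over $\{1,\dots,\bar K_n\}$, where, for some $H<1/2$ and all large $n$, $\lfloor n^{1/(1+2\beta_0)}\rfloor\le\bar K_n\le n^H$ and $\bar K_n\le K_n$. Let $\pi(\cdot\mid\mathbf Y)$ be the resulting (hierarchical or empirical Bayes) posterior, let $\alpha\in(0,1)$, and for a centering point $\hat q_n$ put $$r_\alpha=\inf\{r:\pi(\theta:h_n(q_\theta,\hat q_n)\le r\mid\mathbf Y)\ge1-\alpha\},\qquad \hat C_n(L,\alpha)=\{q_\theta:\|\theta\|_1<\infty,\ h_n(q_\theta,\hat q_n)\le L\,r_\alpha\}.$$ **Polished tails.** For a true $\theta_0$ let $b(k)=\inf_{\theta\in\mathbb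 R^k}h_n^2(q_{\theta_0},q_\theta)$, $k_n=\inf\{k\ge1:b(k)\le k\log n/n\}$ and $\varepsilon_n^2(k)=b(k)+k\log n/n$. For fixed integers $R_0>1$, $k_0\ge1$ and $\tau\in(0,1)$ let $\Theta_{0,n}$ be the set of $\theta_0$ with $b(kR_0)\le\tau b(k)$ for all $k_0\le k\le k_n$. **Proposition.** Let $\hat q_n$ be the posterior mean $E(q_\theta\mid\mathbf Y)$ of the posterior in use. Then for every $\varepsilon>0$ there exist $L,C>0$ such that $$\liminf_n\inf_{\theta_0\in\Theta_{0,n}\cap S^{\beta_0}(L_0)}P_{\theta_0}^{(n)}\big(q_{\theta_0}\in\hat C_n(L\sqrt{\log n},\alpha)\big)\ge1-\varepsilon,\tag{1}$$ $$\liminf_n\inf_{\beta\ge\beta_0}\inf_{\theta_0\in S^\beta(L_0)}P_{\theta_0}^{(n)}\Big(\operatorname{diam}(\hat C_n(1,\alpha),h_n)\le C\Big(\frac n{\log n}\Big)^{-\frac\beta{1+2\beta}}\Big)\ge1-\varepsilon.\tag{2}$$ The same holds for any $[0,1]$-valued centering point $\hat q_n=\hat q_n(\mathbf Y)$ with the following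 property on a class $T_n$: for every $\eta>0$ there is $M_\eta>0$ with $\inf_{\theta_0\in T_n}P_{\theta_0}^{(n)}(h_n(q_{\theta_0},\hat q_n)\le M_\eta\varepsilon_n(k_n))\ge1-\eta$ for all large $n$. The property on $T_n=\Theta_{0,n}\cap S^{\beta_0}(L_0)$ gives (1), and the property on $T_n=S^{\beta_0}(L_0)$ gives (2). -/

import Mathlib

open MeasureTheory Filter Topology
open scoped ENNReal

noncomputable section

namespace LogisticSieve

/-! Indices: the basis function `φ j` and the coefficient `θ j` (with `j = 0, 1, 2, …`) are the
`(j+1)`-st basis function and the `(j+1)`-st coefficient. -/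

/-- `q_θ = μ(f_θ)` for a coefficient sequence `θ`, with `f_θ = ∑_j θ_j φ_j` and `μ` the logistic
link. -/
def seriesProb (φ : ℕ → unitInterval → ℝ) (θ : ℕ → ℝ) (t : unitInterval) : ℝ :=
  Real.sigmoid (∑' j, θ j * φ j t)

/-- The sieve parameter space: the disjoint union of the models `Θ(k) = ℝ^k`. -/
abbrev SieveParam : Type := Σ k : ℕ, (Fin k → ℝ)

/-- `q_θ = μ(∑_{j ≤ k} θ_j φ_j)` for `θ ∈ Θ(k)`. -/
def sieveProb (φ : ℕ → unitInterval → ℝ) (s : SieveParam) (t : unitInterval) : ℝ :=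
  Real.sigmoid (∑ j : Fin s.1, s.2 j * φ j t)

/-- The Sobolev-type ball `S^β(L₀) = {θ : ∑_{i ≥ 1} θ_i² i^{2β} ≤ L₀}`. -/
def sobolevBall (β L₀ : ℝ) : Set (ℕ → ℝ) :=
  {θ | Summable (fun i : ℕ => θ i ^ 2 * ((i : ℝ) + 1) ^ (2 * β)) ∧
    ∑' i : ℕ, θ i ^ 2 * ((i : ℝ) + 1) ^ (2 * β) ≤ L₀}

/-- The design condition `C₀⁻¹ I_k ≤ Φ_kᵀ Φ_k / n ≤ C₀ I_k` for all `k ≤ K`, as an inequality of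
quadratic forms. -/
def DesignCondition (φ : ℕ → unitInterval → ℝ) {n : ℕ} (x : Fin n → unitInterval)
    (C₀ : ℝ) (K : ℕ) : Prop :=
  ∀ k ≤ K, ∀ v : Fin k → ℝ,
    C₀⁻¹ * ∑ j, v j ^ 2 ≤ (1 / (n : ℝ)) * ∑ i, (∑ j : Fin k, v j * φ j (x i)) ^ 2 ∧
    (1 / (n : ℝ)) * ∑ i, (∑ j : Fin k, v j * φ j (x i)) ^ 2 ≤ C₀ * ∑ j, v j ^ 2

/-- The empirical Hellinger semi-metric `h_n` between binary regression functions. -/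
def hellinger {n : ℕ} (x : Fin n → unitInterval) (q₁ q₂ : unitInterval → ℝ) : ℝ :=
  √((1 / (n : ℝ)) * ∑ i, ((√(q₁ (x i)) - √(q₂ (x i))) ^ 2
    + (√(1 - q₁ (x i)) - √(1 - q₂ (x i))) ^ 2))

/-- The `h_n`-diameter of a set of binary regression functions. -/
def hellingerDiam {n : ℕ} (x : Fin n → unitInterval) (S : Set (unitInterval → ℝ)) : ℝ≥0∞ :=
  ⨆ q₁ ∈ S, ⨆ q₂ ∈ S, ENNReal.ofReal (hellinger x q₁ q₂)

/-- The law of `Y = (Y_1, …, Y_n)` with independent `Y_i`, `P(Y_i = 1) = q(x_i)`. -/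
def law {n : ℕ} (x : Fin n → unitInterval) (q : unitInterval → ℝ) : Measure (Fin n → Bool) :=
  Measure.pi fun i => ENNReal.ofReal (q (x i)) • Measure.dirac true
    + ENNReal.ofReal (1 - q (x i)) • Measure.dirac false

/-- The likelihood of `q` at the data `y`. -/
def likelihood {n : ℕ} (x : Fin n → unitInterval) (q : unitInterval → ℝ) (y : Fin n → Bool) : ℝ :=
  ∏ i, if y i then q (x i) else 1 - q (x i)

/-- The squared bias `b(k) = inf {h_n²(θ₀, θ) : θ ∈ ℝ^k}`. -/
def bias (φ : ℕ → unitInterval → ℝ) {n : ℕ} (x : Fin n → unitInterval) (θ₀ : ℕ → ℝ) (k : ℕ) : ℝ :=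
  ⨅ θ : Fin k → ℝ, hellinger x (seriesProb φ θ₀) (sieveProb φ ⟨k, θ⟩) ^ 2

/-- `k_n = inf {k ≥ 1 : b(k) ≤ k log n / n}`. -/
def oracleDim (φ : ℕ → unitInterval → ℝ) {n : ℕ} (x : Fin n → unitInterval) (θ₀ : ℕ → ℝ) : ℕ :=
  sInf {k : ℕ | 1 ≤ k ∧ bias φ x θ₀ k ≤ k * Real.log n / n}

/-- `ε_n(k_n)`, where `ε_n²(k) = b(k) + k log n / n`. -/
def oracleRate (φ : ℕ → unitInterval → ℝ) {n : ℕ} (x : Fin n → unitInterval) (θ₀ : ℕ → ℝ) : ℝ :=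
  √(bias φ x θ₀ (oracleDim φ x θ₀) + oracleDim φ x θ₀ * Real.log n / n)

/-- The general polished tail class `Θ_{0,n}(R₀, k₀, τ)` for the semi-metric `h_n`. -/
def polishedTail (φ : ℕ → unitInterval → ℝ) {n : ℕ} (x : Fin n → unitInterval)
    (R₀ k₀ : ℕ) (τ : ℝ) : Set (ℕ → ℝ) :=
  {θ₀ | ∀ k, k₀ ≤ k → k ≤ oracleDim φ x θ₀ → bias φ x θ₀ (k * R₀) ≤ τ * bias φ x θ₀ k}

/-- Two-sided exponential-power bounds on a probability density `g`. -/
def IsSieveDensity (g : ℝ → ℝ) : Prop :=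
  Measurable g ∧ ∫⁻ t, ENNReal.ofReal (g t) = 1 ∧
  ∃ G₁ G₂ G₃ G₄ q : ℝ, 0 < G₁ ∧ 0 < G₂ ∧ 0 < G₃ ∧ 0 < G₄ ∧ 1 ≤ q ∧
    ∀ t, G₁ * Real.exp (-G₂ * |t| ^ q) ≤ g t ∧ g t ≤ G₃ * Real.exp (-G₄ * |t| ^ q)

/-- The probability mass function on `{1, 2, …}` of a geometric variable, or of a Poisson variable
conditioned to be positive. -/
def IsGeometricOrPoisson (w : ℕ → ℝ) : Prop :=
  (∃ p : ℝ, 0 < p ∧ p < 1 ∧ ∀ k, w k = if k = 0 then 0 else p * (1 - p) ^ (k - 1)) ∨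
  (∃ lam : ℝ, 0 < lam ∧ ∀ k, w k = if k = 0 then 0 else
    (Real.exp (-lam) * lam ^ k / (k.factorial : ℝ)) / (1 - Real.exp (-lam)))

/-- The conditional prior `π_{|k}`: `θ_1, …, θ_k` independent with density `g`. -/
def condPrior (g : ℝ → ℝ) (k : ℕ) : Measure SieveParam :=
  (Measure.pi fun _ : Fin k => volume.withDensity fun t => ENNReal.ofReal (g t)).map (Sigma.mk k)

/-- The hierarchical prior: `k ∼ w` and `θ | k ∼ π_{|k}`. -/
def hierPrior (g : ℝ → ℝ) (w : ℕ → ℝ) : Measure SieveParam :=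
  Measure.sum fun k => ENNReal.ofReal (w k) • condPrior g k

/-- The marginal likelihood of the data `y` under a prior. -/
def evidence (φ : ℕ → unitInterval → ℝ) {n : ℕ} (x : Fin n → unitInterval)
    (prior : Measure SieveParam) (y : Fin n → Bool) : ℝ≥0∞ :=
  ∫⁻ s, ENNReal.ofReal (likelihood x (sieveProb φ s) y) ∂prior

/-- The posterior distribution for a prior and the data `y`, by Bayes' formula. -/
def posterior (φ : ℕ → unitInterval → ℝ) {n : ℕ} (x : Fin n → unitInterval)
    (prior : Measure SieveParam) (y : Fin n → Bool) : Measure SieveParam :=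
  (evidence φ x prior y)⁻¹ • prior.withDensity fun s => ENNReal.ofReal (likelihood x (sieveProb φ s) y)

/-- `k̂` is a maximum marginal likelihood estimator over `{1, …, Kbar}`. -/
def IsMMLE (φ : ℕ → unitInterval → ℝ) {n : ℕ} (x : Fin n → unitInterval) (g : ℝ → ℝ)
    (Kbar : ℕ) (khat : (Fin n → Bool) → ℕ) : Prop :=
  ∀ y, khat y ∈ Set.Icc 1 Kbar ∧
    ∀ k ∈ Set.Icc 1 Kbar, evidence φ x (condPrior g k) y ≤ evidence φ x (condPrior g (khat y)) y

/-- The mean `E(q_θ)` of the regression function under a (posterior) distribution of `θ`. -/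
def meanProb (φ : ℕ → unitInterval → ℝ) (P : Measure SieveParam) (t : unitInterval) : ℝ :=
  ∫ s, sieveProb φ s t ∂P

/-- `r_α = inf {r : P(θ : h_n(q_θ, q̂) ≤ r) ≥ 1 - α}`. -/
def radius (φ : ℕ → unitInterval → ℝ) {n : ℕ} (x : Fin n → unitInterval) (α : ℝ)
    (P : Measure SieveParam) (qhat : unitInterval → ℝ) : ℝ :=
  sInf {r : ℝ | ENNReal.ofReal (1 - α) ≤ P {s | hellinger x (sieveProb φ s) qhat ≤ r}}

/-- The credible ball inflated by the factor `L`: all `q_θ`, `θ` an absolutely summable coefficient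
sequence, with `h_n(q_θ, q̂) ≤ L r_α`. -/
def credibleBall (φ : ℕ → unitInterval → ℝ) {n : ℕ} (x : Fin n → unitInterval) (α : ℝ)
    (P : Measure SieveParam) (qhat : unitInterval → ℝ) (L : ℝ) : Set (unitInterval → ℝ) :=
  {q | ∃ θ : ℕ → ℝ, Summable (fun j => |θ j|) ∧ q = seriesProb φ θ ∧
    hellinger x q qhat ≤ L * radius φ x α P qhat}

/-- The centering point `q̂_n` is within a multiple of `ε_n(k_n)` of the truth, with probability
arbitrarily close to one, uniformly over `θ₀ ∈ T n`. -/
def IsRateCentering (φ : ℕ → unitInterval → ℝ) (x : (n : ℕ) → Fin n → unitInterval)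
    (T : ℕ → Set (ℕ → ℝ)) (qhat : (n : ℕ) → (Fin n → Bool) → unitInterval → ℝ) : Prop :=
  ∀ η : ℝ, 0 < η → ∃ M : ℝ, 0 < M ∧ ∀ᶠ n in atTop, ∀ θ₀ ∈ T n,
    ENNReal.ofReal (1 - η) ≤ law (x n) (seriesProb φ θ₀)
      {y | hellinger (x n) (seriesProb φ θ₀) (qhat n y) ≤ M * oracleRate φ (x n) θ₀}

/-- The balls inflated by `L √(log n)` have coverage arbitrarily close to one, uniformly over
`θ₀ ∈ T n`. -/
def HasCoverage (φ : ℕ → unitInterval → ℝ) (x : (n : ℕ) → Fin n → unitInterval) (α : ℝ)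
    (T : ℕ → Set (ℕ → ℝ)) (P : (n : ℕ) → (Fin n → Bool) → Measure SieveParam)
    (qhat : (n : ℕ) → (Fin n → Bool) → unitInterval → ℝ) : Prop :=
  ∀ ε : ℝ, 0 < ε → ∃ L : ℝ, 0 < L ∧
    ENNReal.ofReal (1 - ε) ≤ liminf (fun n : ℕ => ⨅ θ₀ ∈ T n, law (x n) (seriesProb φ θ₀)
      {y | seriesProb φ θ₀ ∈
        credibleBall φ (x n) α (P n y) (qhat n y) (L * √(Real.log n))}) atTop

/-- The diameter of the (uninflated) credible balls is `O((n / log n)^{-β/(1+2β)})` with probability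
arbitrarily close to one, uniformly over `β ≥ β₀` and `θ₀ ∈ S^β(L₀)`. -/
def HasAdaptiveSize (φ : ℕ → unitInterval → ℝ) (x : (n : ℕ) → Fin n → unitInterval) (α β₀ L₀ : ℝ)
    (P : (n : ℕ) → (Fin n → Bool) → Measure SieveParam)
    (qhat : (n : ℕ) → (Fin n → Bool) → unitInterval → ℝ) : Prop :=
  ∀ ε : ℝ, 0 < ε → ∃ C : ℝ, 0 < C ∧
    ENNReal.ofReal (1 - ε) ≤ liminf (fun n : ℕ => ⨅ β ∈ Set.Ici β₀, ⨅ θ₀ ∈ sobolevBall β L₀,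
      law (x n) (seriesProb φ θ₀)
        {y | hellingerDiam (x n) (credibleBall φ (x n) α (P n y) (qhat n y) 1) ≤
          ENNReal.ofReal (C * ((n : ℝ) / Real.log n) ^ (-(β / (1 + 2 * β))))}) atTop

end LogisticSieve

end

open LogisticSieve

namespace LogisticSieve

section

/-! ### The logistic function -/

/-! Both posteriors are instances of one object: the posterior for a mixture of the models Θ(k) with
weights that may depend on the data. The empirical Bayes weights are a point mass at `khat`
(`condPrior_eq_hierPrior`). `SieveWeights` lists what is needed of the weights, and all bounds are
uniform over S^{β₀}(L₀).

Concentration. With probability tending to one the data are `GoodData`. Then in models of dimension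
k ≤ N the likelihood ratio to the truth is at most exp(1 - n h²/8) as soon as h² ≥ 96 k log n / n
(Hellinger affinities and a fine grid). The part of Θ(k) closer than that has so little prior mass
that its integrated ratio is at most n^{-k/16}. The oracle model has integrated ratio at least
exp(-C k_n log n), and very large coefficients and dimensions above N are negligible. So outside a
set of posterior mass 1/n, the dimension is at most J k_n and h² < 96 J k_n log n / n
(`SieveWeights.exists_posterior_badSet_le`). This bounds the radius by a multiple of ε_n(k_n) around
any centering point attaining that rate. The posterior mean is such a point because h_n² is convex
(`SieveWeights.isRateCentering_meanProb`). Truncating θ₀ bounds ε_n(k_n) over S^β(L₀), which gives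
(2).

Coverage needs a lower bound of the radius. Under polished tails, models of dimension far below k_n
have bias above the concentration rate, so the posterior sits on dimensions of order k_n. In Θ(k),
h_n and the Euclidean distance are comparable locally (`exists_l2_le_hellinger`), so an h_n-ball of
radius δ√(k_n/n) lies in a Euclidean ball of radius a small multiple of √(k/n). Such a ball carries
a small fraction of the evidence of Θ(k), for every data vector (`partialEvidence_small_ball_le`):
averaging the likelihood over θ + u and θ - u with |u| ≤ √(k/n) loses only a factor e^{-ck}, since
the first-order terms cancel, whereas shrinking the ball gains the kth power of a small number.
Hence r_α ≥ δ√(k_n/n). The center is within M ε_n(k_n) of the truth, and ε_n(k_n) ≤ √(2 k_n log n /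
n); the gap is the factor √(log n) in (1). -/

lemma one_sub_sigmoid (a : ℝ) : 1 - Real.sigmoid a = Real.sigmoid (-a) :=
  (Real.sigmoid_neg a).symm

/-- The logarithm of the logistic function is 1-Lipschitz. This multiplicative form controls
likelihoods and, after a square root, Hellinger distances. -/
lemma sigmoid_le_exp_mul (a b : ℝ) : Real.sigmoid a ≤ Real.exp |a - b| * Real.sigmoid b := by
  rw [Real.sigmoid_def, Real.sigmoid_def, ← div_eq_mul_inv, inv_eq_one_div,
    div_le_div_iff₀ (by positivity) (by positivity)]
  have h1 : Real.exp (-b) ≤ Real.exp |a - b| * Real.exp (-a) := by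
    rw [← Real.exp_add, Real.exp_le_exp]
    linarith [le_abs_self (a - b)]
  have h2 : 1 ≤ Real.exp |a - b| := Real.one_le_exp (abs_nonneg _)
  nlinarith

lemma sqrt_sigmoid_sub_le (a b : ℝ) : √(Real.sigmoid a) - √(Real.sigmoid b) ≤ |a - b| := by
  rcases le_total 1 |a - b| with h | h
  · have h1 : √(Real.sigmoid a) ≤ 1 := Real.sqrt_le_one.mpr (Real.sigmoid_le_one a)
    linarith [Real.sqrt_nonneg (Real.sigmoid b)]
  · set d := |a - b| with hd
    have hd0 : 0 ≤ d := abs_nonneg _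
    have h1 : √(Real.sigmoid a) ≤ Real.exp (d / 2) * √(Real.sigmoid b) := by
      have := Real.sqrt_le_sqrt (sigmoid_le_exp_mul a b)
      rwa [Real.sqrt_mul (Real.exp_pos _).le, ← Real.exp_half] at this
    have h2 : Real.exp (d / 2) ≤ 1 + d := by
      have := Real.exp_bound_div_one_sub_of_interval (x := d / 2) (by positivity) (by linarith)
      refine this.trans ?_
      rw [div_le_iff₀ (by linarith)]
      nlinarith
    have h3 : √(Real.sigmoid b) ≤ 1 := Real.sqrt_le_one.mpr (Real.sigmoid_le_one b)
    nlinarith [Real.sqrt_nonneg (Real.sigmoid b)]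

lemma abs_sqrt_sigmoid_sub_le (a b : ℝ) :
    |√(Real.sigmoid a) - √(Real.sigmoid b)| ≤ |a - b| := by
  rw [abs_le]
  constructor
  · have := sqrt_sigmoid_sub_le b a
    rw [abs_sub_comm] at this
    linarith
  · exact sqrt_sigmoid_sub_le a b

/-- The derivative σ(1 - σ) is at least σ(-(A+1))² on [-(A+1), A+1]. The point a is unrestricted, so
it is first moved to distance at most 1 from b; monotonicity of σ then gives the truncated bound. -/
lemma exists_sigmoid_sub_lower (A : ℝ) : ∃ c : ℝ, 0 < c ∧ c ≤ 1 ∧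
    ∀ a b : ℝ, |b| ≤ A → c * min 1 |a - b| ≤ |Real.sigmoid a - Real.sigmoid b| := by
  refine ⟨Real.sigmoid (-(A + 1)) * Real.sigmoid (-(A + 1)), ?_, ?_, ?_⟩
  · have := Real.sigmoid_pos (-(A + 1)); positivity
  · exact mul_le_one₀ (Real.sigmoid_le_one _) (Real.sigmoid_nonneg _) (Real.sigmoid_le_one _)
  set c := Real.sigmoid (-(A + 1)) * Real.sigmoid (-(A + 1)) with hc
  -- monotone growth on `[-(A+1), A+1]`
  have key : ∀ u v : ℝ, -(A + 1) ≤ u → v ≤ A + 1 → u ≤ v →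
      c * (v - u) ≤ Real.sigmoid v - Real.sigmoid u := by
    intro u v hu hv huv
    refine Convex.mul_sub_le_image_sub_of_le_deriv (convex_Icc (-(A + 1)) (A + 1))
      continuous_sigmoid.continuousOn differentiable_sigmoid.differentiableOn ?_ u
      ⟨hu, huv.trans hv⟩ v ⟨hu.trans huv, hv⟩ huv
    intro t ht
    rw [interior_Icc] at ht
    rw [Real.deriv_sigmoid]
    simp only
    rw [one_sub_sigmoid]
    exact mul_le_mul (Real.sigmoid_le (by linarith [ht.1])) (Real.sigmoid_le (by linarith [ht.2]))
      (Real.sigmoid_nonneg _) (Real.sigmoid_nonneg _)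
  intro a b hb
  rw [abs_le] at hb
  rcases le_total b a with h | h
  · set v := min a (b + 1)
    have hv : v - b = min 1 |a - b| := by
      rw [abs_of_nonneg (by linarith), min_comm, ← min_sub_sub_right]; simp
    have h1 := key b v (by linarith) ((min_le_right _ _).trans (by linarith)) (le_min h (by linarith))
    have h2 : Real.sigmoid v ≤ Real.sigmoid a := Real.sigmoid_le (min_le_left _ _)
    rw [← hv]
    exact (h1.trans (by linarith)).trans (le_abs_self _)
  · set u := max a (b - 1)
    have hu : b - u = min 1 |a - b| := by
      rw [abs_of_nonpos (by linarith), neg_sub]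
      rcases le_total a (b - 1) with h' | h'
      · rw [show u = b - 1 from max_eq_right h', min_eq_left (by linarith)]; ring
      · rw [show u = a from max_eq_left h', min_eq_right (by linarith)]
    have h1 := key u b ((by linarith : _ ≤ b - 1).trans (le_max_right _ _)) (by linarith)
      (max_le h (by linarith))
    have h2 : Real.sigmoid a ≤ Real.sigmoid u := Real.sigmoid_le (le_max_left _ _)
    rw [← hu, abs_sub_comm]
    exact (h1.trans (by linarith)).trans (le_abs_self _)

/-- A second-difference bound for log σ: the linear terms at a + d and a - d cancel. With E =
e^{-a}, the product of the denominators is 1 + 2E cosh d + E² ≤ (1 + E)² cosh d, and cosh d ≤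
e^{d²/2}. -/
lemma sq_sigmoid_mul_exp_le (a d : ℝ) :
    Real.sigmoid a ^ 2 * Real.exp (-(d ^ 2 / 2)) ≤ Real.sigmoid (a + d) * Real.sigmoid (a - d) := by
  have hc := Real.cosh_le_exp_half_sq d
  have hc1 := Real.one_le_cosh d
  have hE : Real.exp (-(a + d)) = Real.exp (-a) * Real.exp (-d) := by rw [← Real.exp_add]; ring_nf
  have hE' : Real.exp (-(a - d)) = Real.exp (-a) * Real.exp d := by rw [← Real.exp_add]; ring_nf
  have hdd : Real.exp (-d) * Real.exp d = 1 := by rw [← Real.exp_add]; simp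
  have hch : Real.exp d + Real.exp (-d) = 2 * Real.cosh d := by rw [Real.cosh_eq]; ring
  have hpos := Real.exp_pos (-a)
  rw [Real.sigmoid_def, Real.sigmoid_def, Real.sigmoid_def, Real.exp_neg (d ^ 2 / 2), hE, hE', ← mul_inv,
    inv_pow, ← mul_inv]
  refine inv_anti₀ (by positivity) ?_
  set E := Real.exp (-a)
  have h1 : (1 + E * Real.exp (-d)) * (1 + E * Real.exp d) = 1 + 2 * E * Real.cosh d + E ^ 2 := by
    calc _ = 1 + E * (Real.exp d + Real.exp (-d)) + E ^ 2 * (Real.exp (-d) * Real.exp d) := by ring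
      _ = _ := by rw [hdd, hch]; ring
  rw [h1]
  calc 1 + 2 * E * Real.cosh d + E ^ 2 ≤ (1 + E) ^ 2 * Real.cosh d := by nlinarith [sq_nonneg E]
    _ ≤ _ := by gcongr

/-! ### The empirical Hellinger semi-metric -/

/-- The vector of square roots of the cell probabilities. -/
noncomputable def rootVec {n : ℕ} (x : Fin n → unitInterval) (q : unitInterval → ℝ) :
    EuclideanSpace ℝ (Fin n × Bool) :=
  WithLp.toLp 2 fun p => if p.2 then √(q (x p.1)) else √(1 - q (x p.1))

variable {n : ℕ} {x : Fin n → unitInterval}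

lemma hellinger_eq_dist (q₁ q₂ : unitInterval → ℝ) :
    hellinger x q₁ q₂ = √(1 / (n : ℝ)) * dist (rootVec x q₁) (rootVec x q₂) := by
  rw [hellinger, Real.sqrt_mul (by positivity), EuclideanSpace.dist_eq, Fintype.sum_prod_type]
  congr 2
  refine Finset.sum_congr rfl fun i _ => ?_
  simp [rootVec, Real.dist_eq, sq_abs]

lemma hellinger_nonneg (q₁ q₂ : unitInterval → ℝ) : 0 ≤ hellinger x q₁ q₂ := Real.sqrt_nonneg _

lemma hellinger_comm (q₁ q₂ : unitInterval → ℝ) : hellinger x q₁ q₂ = hellinger x q₂ q₁ := by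
  rw [hellinger_eq_dist, hellinger_eq_dist, dist_comm]

lemma hellinger_triangle (q₁ q₂ q₃ : unitInterval → ℝ) :
    hellinger x q₁ q₃ ≤ hellinger x q₁ q₂ + hellinger x q₂ q₃ := by
  simp only [hellinger_eq_dist, ← mul_add]
  exact mul_le_mul_of_nonneg_left (dist_triangle _ _ _) (Real.sqrt_nonneg _)

lemma hellinger_sq (q₁ q₂ : unitInterval → ℝ) : hellinger x q₁ q₂ ^ 2 =
    (1 / (n : ℝ)) * ∑ i, ((√(q₁ (x i)) - √(q₂ (x i))) ^ 2
    + (√(1 - q₁ (x i)) - √(1 - q₂ (x i))) ^ 2) :=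
  Real.sq_sqrt (by positivity)

/-- The affinity of two Bernoulli laws. -/
noncomputable def affinity (a b : ℝ) : ℝ := √(a * b) + √((1 - a) * (1 - b))

lemma cell_eq_affinity {a b : ℝ} (ha : a ∈ Set.Icc (0 : ℝ) 1) (hb : b ∈ Set.Icc (0 : ℝ) 1) :
    (√a - √b) ^ 2 + (√(1 - a) - √(1 - b)) ^ 2 = 2 - 2 * affinity a b := by
  have ha1 : 0 ≤ 1 - a := by linarith [ha.2]
  have hb1 : 0 ≤ 1 - b := by linarith [hb.2]
  rw [affinity, Real.sqrt_mul ha.1, Real.sqrt_mul ha1]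
  linear_combination Real.sq_sqrt ha.1 + Real.sq_sqrt hb.1 + Real.sq_sqrt ha1 + Real.sq_sqrt hb1

lemma hellinger_sq_eq_affinity {q₁ q₂ : unitInterval → ℝ} (h₁ : ∀ t, q₁ t ∈ Set.Icc (0 : ℝ) 1)
    (h₂ : ∀ t, q₂ t ∈ Set.Icc (0 : ℝ) 1) : hellinger x q₁ q₂ ^ 2 =
    (1 / (n : ℝ)) * ∑ i, (2 - 2 * affinity (q₁ (x i)) (q₂ (x i))) := by
  rw [hellinger_sq]
  congr 1
  exact Finset.sum_congr rfl fun i _ => cell_eq_affinity (h₁ _) (h₂ _)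

lemma affinity_nonneg (a b : ℝ) : 0 ≤ affinity a b := by unfold affinity; positivity

lemma hellinger_sq_le_two {q₁ q₂ : unitInterval → ℝ} (h₁ : ∀ t, q₁ t ∈ Set.Icc (0 : ℝ) 1)
    (h₂ : ∀ t, q₂ t ∈ Set.Icc (0 : ℝ) 1) : hellinger x q₁ q₂ ^ 2 ≤ 2 := by
  rw [hellinger_sq_eq_affinity h₁ h₂]
  rcases Nat.eq_zero_or_pos n with h0 | h0
  · subst h0; simp
  have hn : (0 : ℝ) < n := by exact_mod_cast h0
  rw [one_div, inv_mul_le_iff₀ hn]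
  calc ∑ i, (2 - 2 * affinity (q₁ (x i)) (q₂ (x i))) ≤ ∑ _i : Fin n, (2 : ℝ) :=
        Finset.sum_le_sum fun i _ => by linarith [affinity_nonneg (q₁ (x i)) (q₂ (x i))]
    _ = _ := by simp

lemma sieveProb_mem_Icc (φ : ℕ → unitInterval → ℝ) (s : SieveParam) (t : unitInterval) :
    sieveProb φ s t ∈ Set.Icc (0 : ℝ) 1 := ⟨Real.sigmoid_nonneg _, Real.sigmoid_le_one _⟩

lemma seriesProb_mem_Icc (φ : ℕ → unitInterval → ℝ) (s : ℕ → ℝ) (t : unitInterval) :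
    seriesProb φ s t ∈ Set.Icc (0 : ℝ) 1 := ⟨Real.sigmoid_nonneg _, Real.sigmoid_le_one _⟩

lemma hellinger_sigmoid_sq_le (f₁ f₂ : unitInterval → ℝ) :
    hellinger x (fun t => Real.sigmoid (f₁ t)) (fun t => Real.sigmoid (f₂ t)) ^ 2 ≤
      2 * ((1 / (n : ℝ)) * ∑ i, (f₁ (x i) - f₂ (x i)) ^ 2) := by
  rw [hellinger_sq, mul_left_comm]
  refine mul_le_mul_of_nonneg_left ?_ (by positivity)
  rw [Finset.mul_sum]
  refine Finset.sum_le_sum fun i _ => ?_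
  have h1 := sq_le_sq' (abs_le.mp (abs_sqrt_sigmoid_sub_le (f₁ (x i)) (f₂ (x i)))).1
    (abs_le.mp (abs_sqrt_sigmoid_sub_le (f₁ (x i)) (f₂ (x i)))).2
  have h2 := abs_sqrt_sigmoid_sub_le (-f₁ (x i)) (-f₂ (x i))
  rw [show -f₁ (x i) - -f₂ (x i) = -(f₁ (x i) - f₂ (x i)) by ring, abs_neg] at h2
  have h3 := sq_le_sq' (abs_le.mp h2).1 (abs_le.mp h2).2
  rw [sq_abs] at h1 h3
  rw [one_sub_sigmoid, one_sub_sigmoid]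
  linarith

lemma hellinger_sigmoid_le {f₁ f₂ : unitInterval → ℝ} {ε : ℝ} (hε : 0 ≤ ε)
    (h : ∀ t, |f₁ t - f₂ t| ≤ ε) :
    hellinger x (fun t => Real.sigmoid (f₁ t)) (fun t => Real.sigmoid (f₂ t)) ≤ 2 * ε := by
  rw [← sq_le_sq₀ (hellinger_nonneg _ _) (by positivity)]
  refine (hellinger_sigmoid_sq_le f₁ f₂).trans ?_
  have h1 : ∑ i, (f₁ (x i) - f₂ (x i)) ^ 2 ≤ n * ε ^ 2 := by
    calc _ ≤ ∑ _i : Fin n, ε ^ 2 := Finset.sum_le_sum fun i _ => by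
          rw [← sq_abs]; exact pow_le_pow_left₀ (abs_nonneg _) (h _) 2
      _ = _ := by simp
  have h2 : (1 / (n : ℝ)) * ∑ i, (f₁ (x i) - f₂ (x i)) ^ 2 ≤ ε ^ 2 := by
    rcases Nat.eq_zero_or_pos n with h0 | h0
    · subst h0; simp; positivity
    have hn : (0 : ℝ) < n := by exact_mod_cast h0
    rw [one_div, inv_mul_le_iff₀ hn]
    exact h1
  nlinarith [sq_nonneg ε]

/-- Lower bound of the Hellinger distance in terms of the truncated distance of the regression
functions. -/
lemma min_sq_le_cell {A c : ℝ}
    (hc : 0 < c) (hcA : ∀ a b : ℝ, |b| ≤ A → c * min 1 |a - b| ≤ |Real.sigmoid a - Real.sigmoid b|)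
    (a b : ℝ) (hb : |b| ≤ A) : c ^ 2 / 4 * min 1 |a - b| ^ 2 ≤
      (√(Real.sigmoid a) - √(Real.sigmoid b)) ^ 2 +
      (√(1 - Real.sigmoid a) - √(1 - Real.sigmoid b)) ^ 2 := by
  have h1 := hcA a b hb
  have hm : 0 ≤ min 1 |a - b| := by positivity
  have h2 : (c * min 1 |a - b|) ^ 2 ≤ (Real.sigmoid a - Real.sigmoid b) ^ 2 := by
    rw [← sq_abs (Real.sigmoid a - _)]
    exact pow_le_pow_left₀ (by positivity) h1 2
  have ha := Real.sq_sqrt (Real.sigmoid_nonneg a)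
  have hb' := Real.sq_sqrt (Real.sigmoid_nonneg b)
  have ha1 : √(Real.sigmoid a) ≤ 1 := Real.sqrt_le_one.mpr (Real.sigmoid_le_one a)
  have hb1 : √(Real.sigmoid b) ≤ 1 := Real.sqrt_le_one.mpr (Real.sigmoid_le_one b)
  have h3 : (Real.sigmoid a - Real.sigmoid b) ^ 2 ≤ 4 * (√(Real.sigmoid a) - √(Real.sigmoid b)) ^ 2 := by
    have : Real.sigmoid a - Real.sigmoid b = (√(Real.sigmoid a) - √(Real.sigmoid b)) *
      (√(Real.sigmoid a) + √(Real.sigmoid b)) := by linear_combination hb' - ha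
    rw [this, mul_pow, mul_comm]
    refine mul_le_mul_of_nonneg_right ?_ (sq_nonneg _)
    nlinarith [Real.sqrt_nonneg (Real.sigmoid a), Real.sqrt_nonneg (Real.sigmoid b)]
  nlinarith [sq_nonneg (√(1 - Real.sigmoid a) - √(1 - Real.sigmoid b))]

end


section

/-! ### The law of the data and the likelihood -/

variable {n : ℕ} {x : Fin n → unitInterval}

lemma likelihood_nonneg {q : unitInterval → ℝ} (hq : ∀ t, q t ∈ Set.Icc (0 : ℝ) 1)
    (y : Fin n → Bool) : 0 ≤ likelihood x q y := by
  refine Finset.prod_nonneg fun i _ => ?_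
  split_ifs
  · exact (hq _).1
  · linarith [(hq (x i)).2]

lemma likelihood_le_one {q : unitInterval → ℝ} (hq : ∀ t, q t ∈ Set.Icc (0 : ℝ) 1)
    (y : Fin n → Bool) : likelihood x q y ≤ 1 := by
  refine Finset.prod_le_one (fun i _ => ?_) fun i _ => ?_
  · split_ifs
    · exact (hq _).1
    · linarith [(hq (x i)).2]
  · split_ifs
    · exact (hq _).2
    · linarith [(hq (x i)).1]

lemma likelihood_sigmoid (f : unitInterval → ℝ) (y : Fin n → Bool) :
    likelihood x (fun t => Real.sigmoid (f t)) y =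
      ∏ i, Real.sigmoid (if y i then f (x i) else - f (x i)) := by
  refine Finset.prod_congr rfl fun i _ => ?_
  split_ifs
  · rfl
  · exact one_sub_sigmoid _

lemma likelihood_sigmoid_pos (f : unitInterval → ℝ) (y : Fin n → Bool) :
    0 < likelihood x (fun t => Real.sigmoid (f t)) y := by
  rw [likelihood_sigmoid]
  exact Finset.prod_pos fun i _ => Real.sigmoid_pos _

lemma likelihood_sigmoid_le {f₁ f₂ : unitInterval → ℝ} {ε : ℝ}
    (h : ∀ t, |f₁ t - f₂ t| ≤ ε) (y : Fin n → Bool) :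
    likelihood x (fun t => Real.sigmoid (f₁ t)) y ≤
      Real.exp (n * ε) * likelihood x (fun t => Real.sigmoid (f₂ t)) y := by
  rw [likelihood_sigmoid, likelihood_sigmoid]
  calc ∏ i, Real.sigmoid (if y i then f₁ (x i) else - f₁ (x i))
      ≤ ∏ i, (Real.exp ε * Real.sigmoid (if y i then f₂ (x i) else - f₂ (x i))) := by
        refine Finset.prod_le_prod (fun i _ => Real.sigmoid_nonneg _) fun i _ => ?_
        refine (sigmoid_le_exp_mul _ (if y i then f₂ (x i) else - f₂ (x i))).trans ?_
        refine mul_le_mul_of_nonneg_right (Real.exp_le_exp.mpr ?_) (Real.sigmoid_nonneg _)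
        split_ifs
        · exact h _
        · rw [show -f₁ (x i) - -f₂ (x i) = -(f₁ (x i) - f₂ (x i)) by ring, abs_neg]
          exact h _
    _ = _ := by
        rw [Finset.prod_mul_distrib, Finset.prod_const, ← Real.exp_nat_mul]
        simp

lemma likelihood_sq_mul_exp_le (f u : unitInterval → ℝ) (y : Fin n → Bool) :
    likelihood x (fun t => Real.sigmoid (f t)) y ^ 2 * Real.exp (-((∑ i, u (x i) ^ 2) / 2)) ≤
      likelihood x (fun t => Real.sigmoid (f t + u t)) y *
      likelihood x (fun t => Real.sigmoid (f t - u t)) y := by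
  rw [likelihood_sigmoid, likelihood_sigmoid, likelihood_sigmoid, ← Finset.prod_pow,
    Finset.sum_div, ← Finset.sum_neg_distrib, Real.exp_sum, ← Finset.prod_mul_distrib,
    ← Finset.prod_mul_distrib]
  refine Finset.prod_le_prod (fun i _ => ?_) fun i _ => ?_
  · have := Real.exp_pos (-(u (x i) ^ 2 / 2)); positivity
  · split_ifs
    · exact sq_sigmoid_mul_exp_le _ _
    · have := sq_sigmoid_mul_exp_le (- f (x i)) (- u (x i))
      rw [neg_sq] at this
      rwa [show -f (x i) + -u (x i) = -(f (x i) + u (x i)) by ring,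
        show -f (x i) - -u (x i) = -(f (x i) - u (x i)) by ring] at this

/-- The arithmetic mean of the likelihoods at f + u and f - u dominates their geometric mean. No
first-order term appears, so the bound holds for every y without any control of the score. -/
lemma likelihood_le_average (f u : unitInterval → ℝ) (y : Fin n → Bool) {T : ℝ}
    (hT : ∑ i, u (x i) ^ 2 ≤ T) :
    2 * (Real.exp (-(T / 4)) * likelihood x (fun t => Real.sigmoid (f t)) y) ≤
      likelihood x (fun t => Real.sigmoid (f t + u t)) y +
      likelihood x (fun t => Real.sigmoid (f t - u t)) y := by
  have h := likelihood_sq_mul_exp_le (x := x) f u y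
  have h1 := likelihood_sigmoid_pos (x := x) f y
  have h2 := likelihood_sigmoid_pos (x := x) (fun t => f t + u t) y
  have h3 := likelihood_sigmoid_pos (x := x) (fun t => f t - u t) y
  set a := likelihood x (fun t => Real.sigmoid (f t)) y
  set b := likelihood x (fun t => Real.sigmoid (f t + u t)) y
  set c := likelihood x (fun t => Real.sigmoid (f t - u t)) y
  have he : Real.exp (-(T / 4)) ^ 2 ≤ Real.exp (-((∑ i, u (x i) ^ 2) / 2)) := by
    rw [← Real.exp_nat_mul, Real.exp_le_exp]
    push_cast
    linarith
  have h4 : (Real.exp (-(T / 4)) * a) ^ 2 ≤ b * c := by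
    rw [mul_pow, mul_comm]
    exact (mul_le_mul_of_nonneg_left he (sq_nonneg a)).trans h
  rw [← sq_le_sq₀ (by positivity) (by positivity)]
  nlinarith [sq_nonneg (b - c)]

lemma sum_prod_bool {R : Type*} [CommSemiring R] (F : Fin n → Bool → R) :
    ∑ y : Fin n → Bool, ∏ i, F i (y i) = ∏ i, (F i true + F i false) := by
  rw [← Fintype.prod_sum]
  exact Finset.prod_congr rfl fun i _ => Fintype.sum_bool _

lemma sum_likelihood (q : unitInterval → ℝ) : ∑ y, likelihood x q y = 1 := by
  have := sum_prod_bool (fun i b => if b then q (x i) else 1 - q (x i))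
  simp only [likelihood]
  rw [this]
  simp

lemma law_singleton {q : unitInterval → ℝ} (hq : ∀ t, q t ∈ Set.Icc (0 : ℝ) 1)
    (y : Fin n → Bool) : law x q {y} = ENNReal.ofReal (likelihood x q y) := by
  have : ∀ i, IsFiniteMeasure (ENNReal.ofReal (q (x i)) • Measure.dirac true +
      ENNReal.ofReal (1 - q (x i)) • Measure.dirac false : Measure Bool) := fun i =>
    ⟨by simp [ENNReal.add_lt_top]⟩
  rw [law, Measure.pi_singleton, likelihood, ENNReal.ofReal_prod_of_nonneg]
  · refine Finset.prod_congr rfl fun i _ => ?_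
    cases h : y i <;> simp
  · intro i _
    split_ifs
    · exact (hq _).1
    · linarith [(hq (x i)).2]

lemma law_apply {q : unitInterval → ℝ} (hq : ∀ t, q t ∈ Set.Icc (0 : ℝ) 1)
    (S : Set (Fin n → Bool)) [DecidablePred (· ∈ S)] :
    law x q S = ∑ y with y ∈ S, ENNReal.ofReal (likelihood x q y) := by
  have h : law x q S = law x q (((Finset.univ.filter (· ∈ S)) : Finset (Fin n → Bool)) : Set _) := by
    congr 1; ext y; simp
  rw [h, ← sum_measure_singleton]
  exact Finset.sum_congr rfl fun y _ => law_singleton hq y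

lemma isProbabilityMeasure_law {q : unitInterval → ℝ} (hq : ∀ t, q t ∈ Set.Icc (0 : ℝ) 1) :
    IsProbabilityMeasure (law x q) := by
  constructor
  classical
  rw [law_apply hq]
  simp only [Set.mem_univ, Finset.filter_true]
  rw [← ENNReal.ofReal_sum_of_nonneg fun y _ => likelihood_nonneg hq y, sum_likelihood]
  simp

/-- The sample space is finite, so probabilities are sums of likelihoods. This is the common form of
the Markov and change-of-measure arguments below. -/
lemma law_le_mul_sum {q : unitInterval → ℝ} (hq : ∀ t, q t ∈ Set.Icc (0 : ℝ) 1)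
    {S : Set (Fin n → Bool)} {a : (Fin n → Bool) → ℝ≥0∞} {c : ℝ≥0∞}
    (h : ∀ y ∈ S, ENNReal.ofReal (likelihood x q y) ≤ c * a y) :
    law x q S ≤ c * ∑ y, a y := by
  classical
  rw [law_apply hq, Finset.mul_sum]
  refine (Finset.sum_le_sum fun y hy => h y (Finset.mem_filter.mp hy).2).trans ?_
  exact Finset.sum_le_sum_of_subset (Finset.filter_subset _ _)

/-- The affinity of product laws is the product of the affinities, each at most exp(-(1 -
affinity)); the exponents add up to n h²/2. -/
lemma sum_sqrt_likelihood_le {q₁ q₂ : unitInterval → ℝ} (h₁ : ∀ t, q₁ t ∈ Set.Icc (0 : ℝ) 1)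
    (h₂ : ∀ t, q₂ t ∈ Set.Icc (0 : ℝ) 1) :
    ∑ y, √(likelihood x q₁ y * likelihood x q₂ y) ≤
      Real.exp (-(n * hellinger x q₁ q₂ ^ 2 / 2)) := by
  rcases Nat.eq_zero_or_pos n with h0 | h0
  · subst h0
    simp [likelihood]
  have hn : (0 : ℝ) < n := by exact_mod_cast h0
  have e1 : ∀ y : Fin n → Bool, √(likelihood x q₁ y * likelihood x q₂ y) = ∏ i,
      (fun i b => √((if b then q₁ (x i) else 1 - q₁ (x i)) *
        (if b then q₂ (x i) else 1 - q₂ (x i)))) i (y i) := by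
    intro y
    rw [likelihood, likelihood, ← Finset.prod_mul_distrib, Real.sqrt_prod]
    intro i _
    have a1 := (h₁ (x i)).1
    have a2 := (h₂ (x i)).1
    have b1 : 0 ≤ 1 - q₁ (x i) := by linarith [(h₁ (x i)).2]
    have b2 : 0 ≤ 1 - q₂ (x i) := by linarith [(h₂ (x i)).2]
    split_ifs <;> positivity
  rw [Finset.sum_congr rfl fun y _ => e1 y,
    sum_prod_bool (fun i b => √((if b then q₁ (x i) else 1 - q₁ (x i)) *
        (if b then q₂ (x i) else 1 - q₂ (x i))))]
  have e2 : n * hellinger x q₁ q₂ ^ 2 / 2 = ∑ i, (1 - affinity (q₁ (x i)) (q₂ (x i))) := by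
    rw [hellinger_sq_eq_affinity h₁ h₂]
    field_simp
    rw [Finset.mul_sum]
  rw [e2, ← Finset.sum_neg_distrib, Real.exp_sum]
  refine Finset.prod_le_prod (fun i _ => by positivity) fun i _ => ?_
  have := Real.add_one_le_exp (-(1 - affinity (q₁ (x i)) (q₂ (x i))))
  simp only [affinity, if_true, Bool.false_eq_true, if_false] at this ⊢
  linarith

/-- The likelihood ratio of a fixed alternative is exponentially small. -/
lemma law_likelihood_ratio_le {q₀ q : unitInterval → ℝ} (h₀ : ∀ t, q₀ t ∈ Set.Icc (0 : ℝ) 1)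
    (hq : ∀ t, q t ∈ Set.Icc (0 : ℝ) 1) :
    law x q₀ {y | Real.exp (-(n * hellinger x q₀ q ^ 2 / 2)) * likelihood x q₀ y ≤
      likelihood x q y} ≤ ENNReal.ofReal (Real.exp (-(n * hellinger x q₀ q ^ 2 / 4))) := by
  set s := n * hellinger x q₀ q ^ 2
  -- Markov for the square root of the likelihood ratio: on the event, p₀ ≤ e^{s/4} √(p₀ p). The
  -- affinity bound e^{-s/2} then leaves e^{-s/4}.
  have key := law_le_mul_sum (x := x) h₀ (S := {y | Real.exp (-(s / 2)) * likelihood x q₀ y ≤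
      likelihood x q y}) (a := fun y => ENNReal.ofReal √(likelihood x q₀ y * likelihood x q y))
      (c := ENNReal.ofReal (Real.exp (s / 4))) ?_
  · refine key.trans ?_
    rw [← ENNReal.ofReal_sum_of_nonneg (fun _ _ => Real.sqrt_nonneg _), ← ENNReal.ofReal_mul
      (Real.exp_pos _).le]
    refine ENNReal.ofReal_le_ofReal ?_
    refine (mul_le_mul_of_nonneg_left (sum_sqrt_likelihood_le h₀ hq) (Real.exp_pos _).le).trans ?_
    rw [← Real.exp_add, Real.exp_le_exp]
    linarith
  · intro y hy
    have hy' : Real.exp (-(s / 2)) * likelihood x q₀ y ≤ likelihood x q y := hy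
    rw [← ENNReal.ofReal_mul (Real.exp_pos _).le]
    refine ENNReal.ofReal_le_ofReal ?_
    have hL := likelihood_nonneg (x := x) h₀ y
    have h1 : √((Real.exp (-(s / 4)) * likelihood x q₀ y) ^ 2) ≤
        √(likelihood x q₀ y * likelihood x q y) := by
      refine Real.sqrt_le_sqrt ?_
      calc _ = likelihood x q₀ y * (Real.exp (-(s / 2)) * likelihood x q₀ y) := by
            rw [mul_pow, ← Real.exp_nat_mul]
            push_cast
            rw [show 2 * -(s / 4) = -(s / 2) by ring]; ring
        _ ≤ _ := mul_le_mul_of_nonneg_left hy' hL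
    rw [Real.sqrt_sq (by positivity)] at h1
    calc likelihood x q₀ y = Real.exp (s / 4) * (Real.exp (-(s / 4)) * likelihood x q₀ y) := by
          rw [← mul_assoc, ← Real.exp_add]; simp
      _ ≤ _ := by gcongr

/-- The likelihood of a parameter with probabilities bounded away from zero and one is not much
smaller than the likelihood of the truth. -/
lemma law_lt_likelihood_ratio_le {q₀ q : unitInterval → ℝ} {c : ℝ} (hc : 0 < c)
    (h₀ : ∀ t, q₀ t ∈ Set.Icc (0 : ℝ) 1) (hq : ∀ t, q t ∈ Set.Ioo (0 : ℝ) 1)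
    (hqc : ∀ i, c ≤ q (x i) * (1 - q (x i))) (T : ℝ) :
    law x q₀ {y | likelihood x q y ≤ Real.exp (-T) * likelihood x q₀ y} ≤
      ENNReal.ofReal (Real.exp (4 / c * (n * hellinger x q₀ q ^ 2) - T)) := by
  have hq' : ∀ t, q t ∈ Set.Icc (0 : ℝ) 1 := fun t => ⟨(hq t).1.le, (hq t).2.le⟩
  have hpos : ∀ y, 0 < likelihood x q y := by
    intro y
    refine Finset.prod_pos fun i _ => ?_
    split_ifs
    · exact (hq _).1
    · linarith [(hq (x i)).2]
  -- Markov for the inverse likelihood ratio: on the event, p₀ ≤ e^{-T} p₀²/p. The sum of p₀²/p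
  -- factorizes into one plus chi-square terms, each bounded by 4/c times the Hellinger cell.
  have key := law_le_mul_sum (x := x) h₀ (S := {y | likelihood x q y ≤ Real.exp (-T) *
      likelihood x q₀ y}) (a := fun y => ENNReal.ofReal (likelihood x q₀ y ^ 2 / likelihood x q y))
      (c := ENNReal.ofReal (Real.exp (-T))) ?_
  · refine key.trans ?_
    have hnn : ∀ y, 0 ≤ likelihood x q₀ y ^ 2 / likelihood x q y := fun y =>
      div_nonneg (sq_nonneg _) (hpos y).le
    rw [← ENNReal.ofReal_sum_of_nonneg (fun y _ => hnn y), ← ENNReal.ofReal_mul (Real.exp_pos _).le]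
    refine ENNReal.ofReal_le_ofReal ?_
    rw [sub_eq_add_neg, Real.exp_add, mul_comm]
    refine mul_le_mul_of_nonneg_right ?_ (Real.exp_pos _).le
    have e1 : ∀ y : Fin n → Bool, likelihood x q₀ y ^ 2 / likelihood x q y = ∏ i,
        (fun i b => (if b then q₀ (x i) else 1 - q₀ (x i)) ^ 2 /
          (if b then q (x i) else 1 - q (x i))) i (y i) := by
      intro y
      rw [likelihood, likelihood, ← Finset.prod_pow, ← Finset.prod_div_distrib]
    rw [Finset.sum_congr rfl fun y _ => e1 y,
      sum_prod_bool (fun i b => (if b then q₀ (x i) else 1 - q₀ (x i)) ^ 2 /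
          (if b then q (x i) else 1 - q (x i)))]
    have e2 : 4 / c * (n * hellinger x q₀ q ^ 2) = ∑ i, 4 / c * ((√(q₀ (x i)) - √(q (x i))) ^ 2
        + (√(1 - q₀ (x i)) - √(1 - q (x i))) ^ 2) := by
      rw [hellinger_sq, ← Finset.mul_sum]
      rcases Nat.eq_zero_or_pos n with h0 | h0
      · subst h0; simp
      have hn : (0 : ℝ) < n := by exact_mod_cast h0
      field_simp
    rw [e2, Real.exp_sum]
    refine Finset.prod_le_prod (fun i _ => ?_) fun i _ => ?_
    · have a1 := (hq (x i)).1
      have a2 : 0 < 1 - q (x i) := by linarith [(hq (x i)).2]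
      simp only [if_true, Bool.false_eq_true, if_false]
      positivity
    · have a1 := (hq (x i)).1
      have a2 : 0 < 1 - q (x i) := by linarith [(hq (x i)).2]
      have hci := hqc i
      simp only [if_true, Bool.false_eq_true, if_false]
      set p := q (x i)
      set p₀ := q₀ (x i)
      have b1 : 0 ≤ p₀ := (h₀ (x i)).1
      have b2 : p₀ ≤ 1 := (h₀ (x i)).2
      have e3 : p₀ ^ 2 / p + (1 - p₀) ^ 2 / (1 - p) = 1 + (p₀ - p) ^ 2 / (p * (1 - p)) := by
        field_simp; ring
      have e4 : (p₀ - p) ^ 2 ≤ 4 * (√p₀ - √p) ^ 2 := by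
        have : p₀ - p = (√p₀ - √p) * (√p₀ + √p) := by
          linear_combination Real.sq_sqrt a1.le - Real.sq_sqrt b1
        rw [this, mul_pow, mul_comm]
        refine mul_le_mul_of_nonneg_right ?_ (sq_nonneg _)
        have c1 : √p₀ ≤ 1 := Real.sqrt_le_one.mpr b2
        have c2 : √p ≤ 1 := Real.sqrt_le_one.mpr (by linarith)
        nlinarith [Real.sqrt_nonneg p, Real.sqrt_nonneg p₀]
      have e5 : (p₀ - p) ^ 2 / (p * (1 - p)) ≤ 4 / c * ((√p₀ - √p) ^ 2 +
          (√(1 - p₀) - √(1 - p)) ^ 2) := by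
        rw [div_mul_eq_mul_div]
        refine div_le_div₀ (by positivity) ?_ hc hci
        nlinarith [sq_nonneg (√(1 - p₀) - √(1 - p))]
      rw [e3]
      have := Real.add_one_le_exp (4 / c * ((√p₀ - √p) ^ 2 + (√(1 - p₀) - √(1 - p)) ^ 2))
      linarith
  · intro y hy
    have hy' : likelihood x q y ≤ Real.exp (-T) * likelihood x q₀ y := hy
    rw [← ENNReal.ofReal_mul (Real.exp_pos _).le]
    refine ENNReal.ofReal_le_ofReal ?_
    rw [← mul_div_assoc, le_div_iff₀ (hpos y)]
    nlinarith [likelihood_nonneg (x := x) h₀ y]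

end


section

/-! ### The prior -/

lemma pi_measure_mono {ι : Type*} [Fintype ι] {X : ι → Type*} [∀ i, MeasurableSpace (X i)]
    {μ ν : ∀ i, Measure (X i)} (h : ∀ i, μ i ≤ ν i) : Measure.pi μ ≤ Measure.pi ν := by
  refine Measure.le_iff.2 fun S hS => ?_
  rw [Measure.pi_def, Measure.pi_def, toMeasure_apply _ _ hS, toMeasure_apply _ _ hS]
  refine OuterMeasure.le_pi.2 (fun s _ => ?_) S
  refine (OuterMeasure.pi_pi_le _ s).trans ?_
  exact Finset.prod_le_prod' fun i _ => Measure.le_iff'.1 (h i) (s i)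

lemma pi_const_smul {ι : Type*} [Fintype ι] {X : ι → Type*} [∀ i, MeasurableSpace (X i)]
    (μ : ∀ i, Measure (X i)) [∀ i, SigmaFinite (μ i)] {c : ℝ≥0∞} (hc : c ≠ ∞) :
    Measure.pi (fun i => c • μ i) = c ^ Fintype.card ι • Measure.pi μ := by
  lift c to NNReal using hc
  have : ∀ i, SigmaFinite ((c : ℝ≥0∞) • μ i) := fun i => by
    rw [← withDensity_const]
    exact SigmaFinite.withDensity_of_ne_top' fun _ => ENNReal.coe_ne_top
  refine (Measure.pi_eq fun s _ => ?_)
  simp [Measure.pi_pi, Finset.prod_mul_distrib]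

/-- The law on `ℝ` with density `g`. -/
noncomputable abbrev densityMeasure (g : ℝ → ℝ) : Measure ℝ :=
  volume.withDensity fun t => ENNReal.ofReal (g t)

/-- The law on `ℝ^k` of `k` independent variables with density `g`. -/
noncomputable def coordPrior (g : ℝ → ℝ) (k : ℕ) : Measure (Fin k → ℝ) :=
  Measure.pi fun _ : Fin k => densityMeasure g

lemma isProbabilityMeasure_densityMeasure {g : ℝ → ℝ} (hg : IsSieveDensity g) :
    IsProbabilityMeasure (densityMeasure g) := by
  constructor
  rw [withDensity_apply _ MeasurableSet.univ, Measure.restrict_univ]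
  exact hg.2.1

lemma isProbabilityMeasure_coordPrior {g : ℝ → ℝ} (hg : IsSieveDensity g) (k : ℕ) :
    IsProbabilityMeasure (coordPrior g k) := by
  have := isProbabilityMeasure_densityMeasure hg
  unfold coordPrior
  infer_instance

lemma coordPrior_le {g : ℝ → ℝ} {G : ℝ} (hG : ∀ t, g t ≤ G) (k : ℕ) :
    coordPrior g k ≤ ENNReal.ofReal G ^ k • volume := by
  have h : densityMeasure g ≤ ENNReal.ofReal G • volume := by
    rw [← withDensity_const]
    exact withDensity_mono (ae_of_all _ fun t => ENNReal.ofReal_le_ofReal (hG t))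
  refine (pi_measure_mono fun _ : Fin k => h).trans_eq ?_
  rw [pi_const_smul _ ENNReal.ofReal_ne_top, Fintype.card_fin, volume_pi]

lemma le_coordPrior {g : ℝ → ℝ} {c R : ℝ} (hc : ∀ t, |t| ≤ R → c ≤ g t) (k : ℕ) :
    ENNReal.ofReal c ^ k • volume.restrict (Set.univ.pi fun _ => Set.Icc (-R) R) ≤
      coordPrior g k := by
  have h : ENNReal.ofReal c • volume.restrict (Set.Icc (-R) R) ≤ densityMeasure g := by
    rw [← withDensity_const, ← withDensity_indicator measurableSet_Icc]
    refine withDensity_mono (ae_of_all _ fun t => ?_)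
    by_cases ht : t ∈ Set.Icc (-R) R
    · rw [Set.indicator_of_mem ht]
      exact ENNReal.ofReal_le_ofReal (hc t (abs_le.mpr ht))
    · rw [Set.indicator_of_notMem ht]
      exact zero_le
  refine le_trans (le_of_eq ?_) (pi_measure_mono fun _ : Fin k => h)
  rw [pi_const_smul _ ENNReal.ofReal_ne_top, Fintype.card_fin, volume_pi, Measure.restrict_pi_pi]

lemma IsSieveDensity.exists_upper {g : ℝ → ℝ} (hg : IsSieveDensity g) :
    ∃ G : ℝ, 1 ≤ G ∧ ∀ t, g t ≤ G := by
  obtain ⟨-, -, G₁, G₂, G₃, G₄, q, h1, h2, h3, h4, hq, h⟩ := hg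
  refine ⟨max 1 G₃, le_max_left _ _, fun t => ((h t).2.trans ?_).trans (le_max_right _ _)⟩
  have : Real.exp (-G₄ * |t| ^ q) ≤ 1 := by
    rw [Real.exp_le_one_iff]
    have := Real.rpow_nonneg (abs_nonneg t) q
    nlinarith
  nlinarith

lemma IsSieveDensity.exists_lower {g : ℝ → ℝ} (hg : IsSieveDensity g) (R : ℝ) :
    ∃ c : ℝ, 0 < c ∧ c ≤ 1 ∧ ∀ t, |t| ≤ R → c ≤ g t := by
  obtain ⟨-, -, G₁, G₂, G₃, G₄, q, h1, h2, h3, h4, hq, h⟩ := hg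
  refine ⟨min 1 (G₁ * Real.exp (-G₂ * R ^ q)), by positivity, min_le_left _ _, fun t ht => ?_⟩
  refine (min_le_right _ _).trans (le_trans ?_ (h t).1)
  have : |t| ^ q ≤ R ^ q := Real.rpow_le_rpow (abs_nonneg t) ht (by linarith)
  gcongr ?_ * Real.exp ?_
  nlinarith

/-- For |t| > n ≥ 1 and q ≥ 1 one has |t|^q ≥ |t|. Half of the exponent G₄|t| produces the factor
e^{-dn}, the other half keeps the integral finite. -/
lemma IsSieveDensity.exists_tail {g : ℝ → ℝ} (hg : IsSieveDensity g) :
    ∃ C d : ℝ, 0 < C ∧ 0 < d ∧ ∀ n : ℕ, 1 ≤ n →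
      densityMeasure g {t | (n : ℝ) < |t|} ≤ ENNReal.ofReal (C * Real.exp (-(d * n))) := by
  obtain ⟨-, -, G₁, G₂, G₃, G₄, q, h1, h2, h3, h4, hq, h⟩ := hg
  have hint : Integrable (fun t : ℝ => Real.exp (-(G₄ / 2) * |t|)) := by
    have h0 : (0 : ℝ) < G₄ / 2 := by positivity
    rw [← integrableOn_univ, ← Set.Iic_union_Ioi (a := (0 : ℝ)), integrableOn_union]
    constructor
    · refine (integrableOn_exp_mul_Iic h0 0).congr_fun (fun t ht => ?_) measurableSet_Iic
      simp only [abs_of_nonpos (Set.mem_Iic.mp ht), neg_mul_neg]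
    · refine (integrableOn_exp_mul_Ioi (neg_neg_of_pos h0) 0).congr_fun (fun t ht => ?_)
        measurableSet_Ioi
      simp only [abs_of_pos (Set.mem_Ioi.mp ht)]
  refine ⟨G₃ * (∫ t : ℝ, Real.exp (-(G₄ / 2) * |t|)) + 1, G₄ / 2, ?_, by positivity, ?_⟩
  · have : 0 ≤ ∫ t : ℝ, Real.exp (-(G₄ / 2) * |t|) :=
      integral_nonneg fun t => (Real.exp_pos _).le
    positivity
  intro n hn
  have hn' : (1 : ℝ) ≤ n := by exact_mod_cast hn
  have hm : MeasurableSet {t : ℝ | (n : ℝ) < |t|} := measurableSet_lt measurable_const measurable_abs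
  rw [withDensity_apply _ hm]
  calc ∫⁻ t in {t : ℝ | (n : ℝ) < |t|}, ENNReal.ofReal (g t)
      ≤ ∫⁻ t in {t : ℝ | (n : ℝ) < |t|}, ENNReal.ofReal
          (G₃ * Real.exp (-(G₄ / 2 * n)) * Real.exp (-(G₄ / 2) * |t|)) := by
        refine setLIntegral_mono' hm fun t ht => ENNReal.ofReal_le_ofReal ?_
        have ht' : (n : ℝ) < |t| := ht
        refine (h t).2.trans ?_
        rw [mul_assoc, ← Real.exp_add]
        have : |t| ≤ |t| ^ q := by
          calc |t| = |t| ^ (1 : ℝ) := (Real.rpow_one _).symm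
            _ ≤ _ := Real.rpow_le_rpow_of_exponent_le (by linarith) hq
        gcongr
        nlinarith
    _ ≤ ∫⁻ t, ENNReal.ofReal (G₃ * Real.exp (-(G₄ / 2 * n)) * Real.exp (-(G₄ / 2) * |t|)) :=
        setLIntegral_le_lintegral _ _
    _ = ENNReal.ofReal (∫ t, G₃ * Real.exp (-(G₄ / 2 * n)) * Real.exp (-(G₄ / 2) * |t|)) := by
        rw [ofReal_integral_eq_lintegral_ofReal (hint.const_mul _)
          (ae_of_all _ fun t => by positivity)]
    _ ≤ _ := by
        refine ENNReal.ofReal_le_ofReal ?_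
        rw [integral_const_mul]
        nlinarith [Real.exp_pos (-(G₄ / 2 * n))]

lemma coordPrior_tail_le {g : ℝ → ℝ} (hg : IsSieveDensity g) {a b : ℝ} 
    (h : densityMeasure g {t | b < |t|} ≤ ENNReal.ofReal a) (k : ℕ) :
    coordPrior g k {θ | ¬ ∀ j, |θ j| ≤ b} ≤ k * ENNReal.ofReal a := by
  have := isProbabilityMeasure_densityMeasure hg
  have hm : MeasurableSet {t : ℝ | b < |t|} := measurableSet_lt measurable_const measurable_abs
  have hS : {θ : Fin k → ℝ | ¬ ∀ j, |θ j| ≤ b} = ⋃ j, Function.eval j ⁻¹' {t | b < |t|} := by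
    ext θ; simp
  rw [hS]
  refine (measure_iUnion_le _).trans ?_
  rw [tsum_fintype]
  calc ∑ j : Fin k, coordPrior g k (Function.eval j ⁻¹' {t | b < |t|})
      ≤ ∑ _j : Fin k, ENNReal.ofReal a := Finset.sum_le_sum fun j _ => by
        rw [coordPrior, (measurePreserving_eval _ j).measure_preimage hm.nullMeasurableSet]
        exact h
    _ = _ := by simp

/-! ### Marginal likelihoods and the posterior -/

variable {n : ℕ} {x : Fin n → unitInterval} {φ : ℕ → unitInterval → ℝ}

lemma measurable_sigma {ι : Type*} {X : ι → Type*} [∀ i, MeasurableSpace (X i)] {Y : Type*}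
    [MeasurableSpace Y] {f : Sigma X → Y} (h : ∀ i, Measurable fun a => f ⟨i, a⟩) :
    Measurable f := fun _ hs =>
  MeasurableSpace.measurableSet_iInf.2 fun i => h i hs

lemma measurable_sigma_mk {ι : Type*} {X : ι → Type*} [∀ i, MeasurableSpace (X i)] (i : ι) :
    Measurable (Sigma.mk i : X i → Sigma X) := fun _ hs =>
  MeasurableSpace.measurableSet_iInf.1 hs i

lemma measurable_sieveProb (t : unitInterval) : Measurable fun s => sieveProb φ s t := by
  refine measurable_sigma fun k => ?_
  change Measurable fun a : Fin k → ℝ => Real.sigmoid (∑ j : Fin k, a j * φ j t)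
  refine continuous_sigmoid.measurable.comp ?_
  refine Finset.measurable_fun_sum _ fun j _ => ?_
  exact (measurable_pi_apply j).mul_const _

lemma measurable_likelihood (y : Fin n → Bool) :
    Measurable fun s => likelihood x (sieveProb φ s) y := by
  unfold likelihood
  refine Finset.measurable_prod _ fun i _ => ?_
  have := measurable_sieveProb (φ := φ) (x i)
  split_ifs
  · exact this
  · fun_prop

lemma measurable_hellinger (q : unitInterval → ℝ) :
    Measurable fun s => hellinger x (sieveProb φ s) q := by
  unfold hellinger
  have := fun i => measurable_sieveProb (φ := φ) (x i)
  fun_prop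

/-- The integral of the likelihood over a part `S` of the model `Θ(k)`. -/
noncomputable def partialEvidence (φ : ℕ → unitInterval → ℝ) {n : ℕ} (x : Fin n → unitInterval)
    (g : ℝ → ℝ) (k : ℕ) (y : Fin n → Bool) (S : Set (Fin k → ℝ)) : ℝ≥0∞ :=
  ∫⁻ θ in S, ENNReal.ofReal (likelihood x (sieveProb φ ⟨k, θ⟩) y) ∂coordPrior g k

lemma withDensity_hierPrior_apply (g : ℝ → ℝ) (w : ℕ → ℝ) (y : Fin n → Bool) {S : Set SieveParam}
    (hS : MeasurableSet S) :
    (hierPrior g w).withDensity (fun s => ENNReal.ofReal (likelihood x (sieveProb φ s) y)) S =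
      ∑' k, ENNReal.ofReal (w k) * partialEvidence φ x g k y ((fun θ => ⟨k, θ⟩) ⁻¹' S) := by
  rw [withDensity_apply _ hS, hierPrior, Measure.restrict_sum _ hS, lintegral_sum_measure]
  congr 1
  ext k
  rw [Measure.restrict_smul, lintegral_smul_measure, condPrior,
    setLIntegral_map hS (measurable_likelihood y).ennreal_ofReal (measurable_sigma_mk k)]
  rfl

lemma evidence_hierPrior (g : ℝ → ℝ) (w : ℕ → ℝ) (y : Fin n → Bool) :
    evidence φ x (hierPrior g w) y =
      ∑' k, ENNReal.ofReal (w k) * partialEvidence φ x g k y Set.univ := by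
  have := withDensity_hierPrior_apply (φ := φ) (x := x) g w y MeasurableSet.univ
  rwa [withDensity_apply _ MeasurableSet.univ, Measure.restrict_univ] at this

lemma evidence_condPrior (g : ℝ → ℝ) (k : ℕ) (y : Fin n → Bool) :
    evidence φ x (condPrior g k) y = partialEvidence φ x g k y Set.univ := by
  rw [evidence, condPrior, lintegral_map (measurable_likelihood y).ennreal_ofReal
    (measurable_sigma_mk k), partialEvidence, Measure.restrict_univ]
  rfl

lemma posterior_hierPrior_apply (g : ℝ → ℝ) (w : ℕ → ℝ) (y : Fin n → Bool) {S : Set SieveParam}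
    (hS : MeasurableSet S) :
    posterior φ x (hierPrior g w) y S = (evidence φ x (hierPrior g w) y)⁻¹ *
      ∑' k, ENNReal.ofReal (w k) * partialEvidence φ x g k y ((fun θ => ⟨k, θ⟩) ⁻¹' S) := by
  rw [posterior, Measure.smul_apply, withDensity_hierPrior_apply g w y hS, smul_eq_mul]

/-- This puts the empirical Bayes posterior in the hierarchical form, with point-mass weights. -/
lemma condPrior_eq_hierPrior (g : ℝ → ℝ) (k : ℕ) :
    condPrior g k = hierPrior g (fun j => if j = k then 1 else 0) := by
  ext S hS
  rw [hierPrior, Measure.sum_apply _ hS, tsum_eq_single k]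
  · simp
  · intro j hj; simp [hj]

lemma partialEvidence_mono (g : ℝ → ℝ) (k : ℕ) (y : Fin n → Bool) {S T : Set (Fin k → ℝ)}
    (h : S ⊆ T) : partialEvidence φ x g k y S ≤ partialEvidence φ x g k y T :=
  lintegral_mono_set h

lemma partialEvidence_union_le (g : ℝ → ℝ) (k : ℕ) (y : Fin n → Bool) (S T : Set (Fin k → ℝ)) :
    partialEvidence φ x g k y (S ∪ T) ≤ partialEvidence φ x g k y S + partialEvidence φ x g k y T :=
  lintegral_union_le _ _ _

lemma partialEvidence_le {g : ℝ → ℝ} (hg : IsSieveDensity g) (k : ℕ) (y : Fin n → Bool)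
    {S : Set (Fin k → ℝ)} {a : ℝ}
    (h : ∀ θ ∈ S, likelihood x (sieveProb φ ⟨k, θ⟩) y ≤ a) :
    partialEvidence φ x g k y S ≤ ENNReal.ofReal a := by
  have := isProbabilityMeasure_coordPrior hg k
  have hm : Measurable fun θ : Fin k → ℝ => likelihood x (sieveProb φ ⟨k, θ⟩) y :=
    (measurable_likelihood y).comp (measurable_sigma_mk k)
  have hT : MeasurableSet {θ : Fin k → ℝ | likelihood x (sieveProb φ ⟨k, θ⟩) y ≤ a} :=
    measurableSet_le hm measurable_const
  refine (partialEvidence_mono g k y (T := {θ | likelihood x (sieveProb φ ⟨k, θ⟩) y ≤ a})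
    fun θ hθ => h θ hθ).trans ?_
  calc _ ≤ ∫⁻ _θ in {θ : Fin k → ℝ | likelihood x (sieveProb φ ⟨k, θ⟩) y ≤ a}, ENNReal.ofReal a
        ∂coordPrior g k := setLIntegral_mono' hT fun θ hθ => ENNReal.ofReal_le_ofReal hθ
    _ ≤ ∫⁻ _θ, ENNReal.ofReal a ∂coordPrior g k := setLIntegral_le_lintegral _ _
    _ = _ := by simp

lemma partialEvidence_le_one {g : ℝ → ℝ} (hg : IsSieveDensity g) (k : ℕ) (y : Fin n → Bool)
    (S : Set (Fin k → ℝ)) : partialEvidence φ x g k y S ≤ 1 := by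
  rw [← ENNReal.ofReal_one]
  exact partialEvidence_le hg k y fun θ _ => likelihood_le_one (sieveProb_mem_Icc φ _) y

/-- Likelihoods sum to one over the data. After division by the likelihood of the truth, this says
that the expected integrated likelihood ratio over S is the prior mass of S. -/
lemma sum_partialEvidence (g : ℝ → ℝ) (k : ℕ) (S : Set (Fin k → ℝ)) :
    ∑ y, partialEvidence φ x g k y S = coordPrior g k S := by
  unfold partialEvidence
  rw [← lintegral_finsetSum]
  · rw [← setLIntegral_one]
    refine lintegral_congr fun θ => ?_
    rw [← ENNReal.ofReal_sum_of_nonneg fun y _ => likelihood_nonneg (sieveProb_mem_Icc φ _) y,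
      sum_likelihood, ENNReal.ofReal_one]
  · intro y _
    exact ((measurable_likelihood y).comp (measurable_sigma_mk k)).ennreal_ofReal

/-- Markov's inequality for the integrated likelihood ratio. -/
lemma law_partialEvidence_gt_le {q₀ : unitInterval → ℝ} (h₀ : ∀ t, q₀ t ∈ Set.Icc (0 : ℝ) 1)
    (g : ℝ → ℝ) (k : ℕ) (S : Set (Fin k → ℝ)) (T : ℝ) :
    law x q₀ {y | ¬ partialEvidence φ x g k y S ≤
      ENNReal.ofReal (Real.exp (-T) * likelihood x q₀ y)} ≤
      ENNReal.ofReal (Real.exp T) * coordPrior g k S := by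
  rw [← sum_partialEvidence (φ := φ) (x := x)]
  refine law_le_mul_sum h₀ fun y hy => ?_
  have hy' := (not_le.mp hy).le
  calc ENNReal.ofReal (likelihood x q₀ y)
      = ENNReal.ofReal (Real.exp T) * ENNReal.ofReal (Real.exp (-T) * likelihood x q₀ y) := by
        rw [← ENNReal.ofReal_mul (Real.exp_pos _).le, ← mul_assoc, ← Real.exp_add]; simp
    _ ≤ _ := by gcongr

end


section

/-! ### Comparison of the Hellinger and the coefficient distances -/

variable {n : ℕ} {x : Fin n → unitInterval} {φ : ℕ → unitInterval → ℝ}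

/-- The coefficient sequence of an element of `Θ(k)`. -/
noncomputable def pad {k : ℕ} (θ : Fin k → ℝ) (j : ℕ) : ℝ := if h : j < k then θ ⟨j, h⟩ else 0

@[simp] lemma pad_coe {k : ℕ} (θ : Fin k → ℝ) (j : Fin k) : pad θ j = θ j := by simp [pad]

lemma pad_of_le {k : ℕ} (θ : Fin k → ℝ) {j : ℕ} (h : k ≤ j) : pad θ j = 0 := by
  simp [pad, Nat.not_lt.mpr h]

/-- The regression function of an element of `Θ(k)`, on the logit scale. -/
noncomputable def sieveFun (φ : ℕ → unitInterval → ℝ) {k : ℕ} (θ : Fin k → ℝ)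
    (t : unitInterval) : ℝ := ∑ j : Fin k, θ j * φ j t

lemma sieveProb_eq {k : ℕ} (θ : Fin k → ℝ) :
    sieveProb φ ⟨k, θ⟩ = fun t => Real.sigmoid (sieveFun φ θ t) := rfl

lemma sieveFun_eq_sum_pad {k m : ℕ} (hkm : k ≤ m) (θ : Fin k → ℝ) (t : unitInterval) :
    sieveFun φ θ t = ∑ j ∈ Finset.range m, pad θ j * φ j t := by
  have h1 : sieveFun φ θ t = ∑ j ∈ Finset.range k, pad θ j * φ j t := by
    rw [← Fin.sum_univ_eq_sum_range (fun j => pad θ j * φ j t) k]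
    simp [sieveFun]
  rw [h1]
  refine Finset.sum_subset (Finset.range_subset_range.mpr hkm) fun j _ hj => ?_
  rw [pad_of_le θ (by simpa using hj), zero_mul]

lemma seriesProb_pad {k : ℕ} (θ : Fin k → ℝ) : seriesProb φ (pad θ) = sieveProb φ ⟨k, θ⟩ := by
  ext t
  rw [sieveProb_eq, seriesProb]
  simp only [sieveFun_eq_sum_pad le_rfl]
  congr 1
  refine tsum_eq_sum fun j hj => ?_
  rw [pad_of_le θ (by simpa using hj), zero_mul]

lemma summable_abs_pad {k : ℕ} (θ : Fin k → ℝ) : Summable fun j => |pad θ j| := by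
  refine summable_of_ne_finset_zero (s := Finset.range k) fun j hj => ?_
  rw [pad_of_le θ (by simpa using hj), abs_zero]

lemma tsum_abs_pad {k : ℕ} (θ : Fin k → ℝ) : ∑' j, |pad θ j| = ∑ j, |θ j| := by
  rw [tsum_eq_sum (s := Finset.range k) fun j hj => by
    rw [pad_of_le θ (by simpa using hj), abs_zero],
    ← Fin.sum_univ_eq_sum_range (fun j => |pad θ j|) k]
  simp

/-- The Euclidean norm. -/
noncomputable def l2 {k : ℕ} (v : Fin k → ℝ) : ℝ := √(∑ j, v j ^ 2)

lemma l2_nonneg {k : ℕ} (v : Fin k → ℝ) : 0 ≤ l2 v := Real.sqrt_nonneg _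

lemma l2_sq {k : ℕ} (v : Fin k → ℝ) : l2 v ^ 2 = ∑ j, v j ^ 2 := Real.sq_sqrt (by positivity)

lemma l2_eq_norm {k : ℕ} (v : Fin k → ℝ) : l2 v = ‖WithLp.toLp 2 v‖ := by
  simp [EuclideanSpace.norm_eq, l2]

lemma l2_neg {k : ℕ} (v : Fin k → ℝ) : l2 (-v) = l2 v := by simp [l2]

lemma l2_smul {k : ℕ} (c : ℝ) (v : Fin k → ℝ) : l2 (c • v) = |c| * l2 v := by
  simp only [l2_eq_norm, WithLp.toLp_smul, norm_smul, Real.norm_eq_abs]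

lemma continuous_l2 {k : ℕ} : Continuous (l2 : (Fin k → ℝ) → ℝ) := by
  unfold l2
  exact Real.continuous_sqrt.comp (continuous_finsetSum _ fun j _ => (continuous_apply j).pow 2)

lemma abs_le_l2 {k : ℕ} (v : Fin k → ℝ) (j : Fin k) : |v j| ≤ l2 v := by
  rw [← Real.sqrt_sq_eq_abs]
  exact Real.sqrt_le_sqrt (Finset.single_le_sum (f := fun j => v j ^ 2)
    (fun _ _ => sq_nonneg _) (Finset.mem_univ j))

lemma sum_abs_le_l2 {k : ℕ} (v : Fin k → ℝ) : ∑ j, |v j| ≤ √k * l2 v := by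
  rw [← sq_le_sq₀ (Finset.sum_nonneg fun _ _ => abs_nonneg _) (mul_nonneg (Real.sqrt_nonneg _)
    (l2_nonneg _)), mul_pow, Real.sq_sqrt (Nat.cast_nonneg _), l2_sq]
  have := sq_sum_le_card_mul_sum_sq (s := (Finset.univ : Finset (Fin k))) (f := fun j => |v j|)
  simpa using this

lemma abs_sieveFun_le {B : ℝ} (hφ : ∀ j t, |φ j t| ≤ B) {k : ℕ} (θ : Fin k → ℝ)
    (t : unitInterval) : |sieveFun φ θ t| ≤ B * ∑ j, |θ j| := by
  refine (Finset.abs_sum_le_sum_abs _ _).trans ?_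
  rw [Finset.mul_sum]
  refine Finset.sum_le_sum fun j _ => ?_
  rw [abs_mul, mul_comm]
  exact mul_le_mul_of_nonneg_right (hφ _ _) (abs_nonneg _)

lemma sieveFun_sub {k : ℕ} (θ θ' : Fin k → ℝ) (t : unitInterval) :
    sieveFun φ (θ - θ') t = sieveFun φ θ t - sieveFun φ θ' t := by
  simp [sieveFun, sub_mul, Finset.sum_sub_distrib]

lemma sieveFun_add {k : ℕ} (θ θ' : Fin k → ℝ) (t : unitInterval) :
    sieveFun φ (θ + θ') t = sieveFun φ θ t + sieveFun φ θ' t := by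
  simp [sieveFun, add_mul, Finset.sum_add_distrib]

lemma summable_mul_basis {B : ℝ} (hφ : ∀ j t, |φ j t| ≤ B) {θ₀ : ℕ → ℝ}
    (hs : Summable fun j => |θ₀ j|) (t : unitInterval) : Summable fun j => |θ₀ j * φ j t| := by
  refine Summable.of_nonneg_of_le (fun _ => abs_nonneg _) (fun j => ?_) (hs.mul_right B)
  rw [abs_mul]
  exact mul_le_mul_of_nonneg_left (hφ _ _) (abs_nonneg _)

lemma abs_tsum_shift_le {B : ℝ} (hφ : ∀ j t, |φ j t| ≤ B) {θ₀ : ℕ → ℝ}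
    (hs : Summable fun j => |θ₀ j|) (m : ℕ) (t : unitInterval) :
    |∑' j, θ₀ (j + m) * φ (j + m) t| ≤ B * ∑' j, |θ₀ (j + m)| := by
  have h1 := summable_mul_basis hφ hs t
  have h1' : Summable fun j => |θ₀ (j + m) * φ (j + m) t| := (summable_nat_add_iff m).mpr h1
  have h2 : Summable fun j => |θ₀ (j + m)| := (summable_nat_add_iff m).mpr hs
  have h3 : ‖∑' j, θ₀ (j + m) * φ (j + m) t‖ ≤ ∑' j, ‖θ₀ (j + m) * φ (j + m) t‖ :=
    norm_tsum_le_tsum_norm (by simpa only [Real.norm_eq_abs] using h1')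
  simp only [Real.norm_eq_abs] at h3
  rw [← tsum_mul_left]
  refine h3.trans ?_
  refine h1'.tsum_le_tsum (fun j => ?_) (h2.mul_left B)
  rw [abs_mul, mul_comm]
  exact mul_le_mul_of_nonneg_right (hφ _ _) (abs_nonneg _)

lemma tsum_eq_sum_add_tail {B : ℝ} (hφ : ∀ j t, |φ j t| ≤ B) {θ₀ : ℕ → ℝ}
    (hs : Summable fun j => |θ₀ j|) (m : ℕ) (t : unitInterval) :
    ∑' j, θ₀ j * φ j t = sieveFun φ (fun j : Fin m => θ₀ j) t +
      ∑' j, θ₀ (j + m) * φ (j + m) t := by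
  have h1 : Summable fun j => θ₀ j * φ j t := (summable_mul_basis hφ hs t).of_abs
  rw [← h1.sum_add_tsum_nat_add m, sieveFun, Fin.sum_univ_eq_sum_range (fun j => θ₀ j * φ j t) m]

/-- The part of `θ₀` in `Θ(k)`. -/
def truncate (θ₀ : ℕ → ℝ) (k : ℕ) : Fin k → ℝ := fun j => θ₀ j

lemma sum_abs_truncate_le {θ₀ : ℕ → ℝ} (hs : Summable fun j => |θ₀ j|) (k : ℕ) :
    ∑ j, |truncate θ₀ k j| ≤ ∑' j, |θ₀ j| := by
  have h := Fin.sum_univ_eq_sum_range (fun j => |θ₀ j|) k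
  simp only [truncate]
  rw [h]
  exact hs.sum_le_tsum _ fun _ _ => abs_nonneg _

/-- In a model of moderate dimension, the coefficient distance is bounded by a multiple of the
Hellinger distance, provided that the latter is small. -/
lemma exists_l2_le_hellinger (A B C₀ : ℝ) (hA : 0 ≤ A) (hB : 0 ≤ B) (hC₀ : 0 < C₀) :
    ∃ C c : ℝ, 1 ≤ C ∧ 0 < c ∧ ∀ (φ : ℕ → unitInterval → ℝ), (∀ j t, |φ j t| ≤ B) →
      ∀ (n : ℕ) (x : Fin n → unitInterval) (K : ℕ), DesignCondition φ x C₀ K →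
      ∀ θ₀ : ℕ → ℝ, (Summable fun j => |θ₀ j|) → ∑' j, |θ₀ j| ≤ A →
      ∀ t : ℝ, B * ∑' j, |θ₀ (j + K)| ≤ t → ∀ k ≤ K, ∀ θ : Fin k → ℝ,
      √k * hellinger x (seriesProb φ θ₀) (sieveProb φ ⟨k, θ⟩) ≤ c →
      l2 (θ - truncate θ₀ k) ≤ C * (hellinger x (seriesProb φ θ₀) (sieveProb φ ⟨k, θ⟩) + t) := by
  obtain ⟨c₁, hc₁, -, hc₁A⟩ := exists_sigmoid_sub_lower (A * B)
  set S := √(2 * C₀) with hS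
  have hSpos : 0 < S := Real.sqrt_pos.mpr (by positivity)
  have hS2 : S ^ 2 = 2 * C₀ := Real.sq_sqrt (by positivity)
  refine ⟨1 + 2 * S + 4 * S * (1 + 2 * (A * B)) / c₁, c₁ / (4 * S * (B + 1)), ?_, by positivity, ?_⟩
  · have : 0 ≤ 4 * S * (1 + 2 * (A * B)) / c₁ := by positivity
    linarith
  intro φ hφ n x K hdes θ₀ hs hsA t ht k hkK θ hsmall
  set h := hellinger x (seriesProb φ θ₀) (sieveProb φ ⟨k, θ⟩) with hh
  have hh0 : 0 ≤ h := hellinger_nonneg _ _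
  set d := l2 (θ - truncate θ₀ k) with hd
  have hd0 : 0 ≤ d := l2_nonneg _
  have ht0 : 0 ≤ t := le_trans (mul_nonneg hB (tsum_nonneg fun _ => abs_nonneg _)) ht
  set f₀ : unitInterval → ℝ := fun s => ∑' j, θ₀ j * φ j s with hf₀
  have hf₀A : ∀ s, |f₀ s| ≤ A * B := by
    intro s
    have := abs_tsum_shift_le hφ hs 0 s
    simp only [add_zero] at this
    refine this.trans ?_
    rw [mul_comm]
    exact mul_le_mul_of_nonneg_right hsA hB
  -- sup-norm bound
  set R := B * (√k * d) + 2 * (A * B) with hR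
  have hR0 : 0 ≤ R := by positivity
  have hF : ∀ s, |sieveFun φ θ s - f₀ s| ≤ R := by
    intro s
    have h1 : sieveFun φ θ s = sieveFun φ (θ - truncate θ₀ k) s + sieveFun φ (truncate θ₀ k) s := by
      rw [sieveFun_sub]; ring
    have h2 := abs_sieveFun_le hφ (θ - truncate θ₀ k) s
    have h3 := abs_sieveFun_le hφ (truncate θ₀ k) s
    have h4 := mul_le_mul_of_nonneg_left (sum_abs_le_l2 (θ - truncate θ₀ k)) hB
    have h5 := mul_le_mul_of_nonneg_left ((sum_abs_truncate_le hs k).trans hsA) hB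
    have h6 := hf₀A s
    rw [h1]
    rw [abs_le] at h2 h3 h6 ⊢
    constructor <;> nlinarith
  -- Hellinger lower bound
  have hF2 : (1 / (n : ℝ)) * ∑ i, (sieveFun φ θ (x i) - f₀ (x i)) ^ 2 ≤
      ((1 + R) * (2 / c₁) * h) ^ 2 := by
    have : ((1 + R) * (2 / c₁) * h) ^ 2 = (1 / (n : ℝ)) * ∑ i, ((1 + R) * (2 / c₁)) ^ 2 *
        ((√(seriesProb φ θ₀ (x i)) - √(sieveProb φ ⟨k, θ⟩ (x i))) ^ 2
        + (√(1 - seriesProb φ θ₀ (x i)) - √(1 - sieveProb φ ⟨k, θ⟩ (x i))) ^ 2) := by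
      rw [mul_pow, hh, hellinger_sq, ← Finset.mul_sum]; ring
    rw [this]
    refine mul_le_mul_of_nonneg_left (Finset.sum_le_sum fun i _ => ?_) (by positivity)
    have h1 := min_sq_le_cell hc₁ hc₁A (sieveFun φ θ (x i)) (f₀ (x i)) (hf₀A _)
    set F := |sieveFun φ θ (x i) - f₀ (x i)| with hFd
    have hF0 : 0 ≤ F := abs_nonneg _
    -- Removing the truncation at 1 costs the factor 1 + R, and R contains the unknown distance d;
    -- the resulting d on the right-hand side is absorbed at the end.
    have h2 : F ≤ (1 + R) * min 1 F := by
      rcases le_total 1 F with h | h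
      · rw [min_eq_left h]; linarith [hF (x i)]
      · rw [min_eq_right h]; nlinarith
    have hm0 : 0 ≤ min 1 F := by positivity
    rw [← sq_abs (sieveFun φ θ (x i) - f₀ (x i)), ← hFd]
    calc F ^ 2 ≤ ((1 + R) * min 1 F) ^ 2 := pow_le_pow_left₀ hF0 h2 2
      _ = ((1 + R) * (2 / c₁)) ^ 2 * (c₁ ^ 2 / 4 * min 1 F ^ 2) := by field_simp; ring
      _ ≤ ((1 + R) * (2 / c₁)) ^ 2 * ((√(Real.sigmoid (sieveFun φ θ (x i))) - √(Real.sigmoid (f₀ (x i)))) ^ 2 +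
        (√(1 - Real.sigmoid (sieveFun φ θ (x i))) - √(1 - Real.sigmoid (f₀ (x i)))) ^ 2) :=
          mul_le_mul_of_nonneg_left h1 (sq_nonneg _)
      _ = _ := by
          rw [sub_sq_comm (√(Real.sigmoid (sieveFun φ θ (x i)))),
            sub_sq_comm (√(1 - Real.sigmoid (sieveFun φ θ (x i))))]
          rfl
  -- design lower bound
  set D : Fin K → ℝ := fun j => pad θ j - θ₀ j with hD
  have hDsum : d ^ 2 ≤ ∑ j, D j ^ 2 := by
    rw [hd, l2_sq, Fin.sum_univ_eq_sum_range (fun j => (pad θ j - θ₀ j) ^ 2) K]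
    have : ∑ j, (θ - truncate θ₀ k) j ^ 2 = ∑ j ∈ Finset.range k, (pad θ j - θ₀ j) ^ 2 := by
      rw [← Fin.sum_univ_eq_sum_range (fun j => (pad θ j - θ₀ j) ^ 2) k]
      simp [truncate]
    rw [this]
    exact Finset.sum_le_sum_of_subset_of_nonneg (Finset.range_subset_range.mpr hkK)
      fun _ _ _ => sq_nonneg _
  -- The design condition is applied in dimension K rather than k, so that only the coefficients of
  -- θ₀ beyond K, whose contribution is at most t, are left as an error.
  have hG : ∀ i, (∑ j : Fin K, D j * φ j (x i)) ^ 2 ≤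
      2 * (sieveFun φ θ (x i) - f₀ (x i)) ^ 2 + 2 * t ^ 2 := by
    intro i
    have h1 : ∑ j : Fin K, D j * φ j (x i) = sieveFun φ θ (x i) - f₀ (x i) +
        ∑' j, θ₀ (j + K) * φ (j + K) (x i) := by
      rw [hf₀, sieveFun_eq_sum_pad hkK]
      simp only
      rw [tsum_eq_sum_add_tail hφ hs K, sieveFun, ← Fin.sum_univ_eq_sum_range
        (fun j => pad θ j * φ j (x i)) K]
      simp only [hD, sub_mul, Finset.sum_sub_distrib]
      ring
    have h2 := (abs_tsum_shift_le hφ hs K (x i)).trans ht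
    have h3 := sq_le_sq' (abs_le.mp h2).1 (abs_le.mp h2).2
    rw [h1]
    nlinarith [sq_nonneg (sieveFun φ θ (x i) - f₀ (x i) - ∑' j, θ₀ (j + K) * φ (j + K) (x i))]
  have hd2 : d ^ 2 ≤ (S * ((1 + R) * (2 / c₁) * h + t)) ^ 2 := by
    have h1 := (hdes K le_rfl D).1
    have h2 : (1 / (n : ℝ)) * ∑ i, (∑ j : Fin K, D j * φ j (x i)) ^ 2 ≤
        2 * ((1 + R) * (2 / c₁) * h) ^ 2 + 2 * t ^ 2 := by
      calc _ ≤ (1 / (n : ℝ)) * ∑ i, (2 * (sieveFun φ θ (x i) - f₀ (x i)) ^ 2 + 2 * t ^ 2) :=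
            mul_le_mul_of_nonneg_left (Finset.sum_le_sum fun i _ => hG i) (by positivity)
        _ = 2 * ((1 / (n : ℝ)) * ∑ i, (sieveFun φ θ (x i) - f₀ (x i)) ^ 2) +
            (1 / (n : ℝ)) * n * (2 * t ^ 2) := by
            rw [Finset.sum_add_distrib, ← Finset.mul_sum]; simp; ring
        _ ≤ _ := by
            have : (1 / (n : ℝ)) * n ≤ 1 := by
              rw [one_div]; exact inv_mul_le_one
            nlinarith [sq_nonneg t]
    have h3 : d ^ 2 ≤ C₀ * (2 * ((1 + R) * (2 / c₁) * h) ^ 2 + 2 * t ^ 2) := by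
      have := h1.trans h2
      rw [inv_mul_le_iff₀ hC₀] at this
      exact hDsum.trans this
    rw [mul_pow, hS2]
    have h4 : 0 ≤ (1 + R) * (2 / c₁) * h * t := by positivity
    nlinarith
  have hd3 : d ≤ S * ((1 + R) * (2 / c₁) * h + t) :=
    (sq_le_sq₀ hd0 (by positivity)).mp hd2
  -- The smallness of √k h enters here: the constant c₁/(4S(B+1)) makes the coefficient of d on the
  -- right-hand side at most 1/2, so d can be moved to the left.
  have hkey : S * (2 / c₁) * B * (√k * h) ≤ 1 / 2 := by
    have : S * (2 / c₁) * B * (√k * h) ≤ S * (2 / c₁) * (B + 1) * (c₁ / (4 * S * (B + 1))) := by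
      have hkh : 0 ≤ √k * h := by positivity
      gcongr
      linarith
    refine this.trans_eq ?_
    field_simp
    norm_num
  have hd4 : d ≤ S * (2 / c₁) * B * (√k * h) * d + S * ((1 + 2 * (A * B)) * (2 / c₁) * h + t) := by
    refine hd3.trans_eq ?_
    rw [hR]; ring
  have hd5 : d ≤ 2 * S * ((1 + 2 * (A * B)) * (2 / c₁) * h + t) := by
    have := mul_le_mul_of_nonneg_right hkey hd0
    linarith
  refine hd5.trans ?_
  have e1 : (1 + 2 * S + 4 * S * (1 + 2 * (A * B)) / c₁) * (h + t) =
    2 * S * ((1 + 2 * (A * B)) * (2 / c₁) * h + t) + ((h + t) + 2 * S * h +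
      4 * S * (1 + 2 * (A * B)) / c₁ * t) := by ring
  rw [e1]
  exact le_add_of_nonneg_right (by positivity)

end


section

/-! ### Sobolev balls -/

variable {n : ℕ} {x : Fin n → unitInterval} {φ : ℕ → unitInterval → ℝ}

/-- The telescoping form of comparing a sum of powers with an integral. It follows from
(a/(a+1))^{1-s} ≥ 1 + (s-1)/(a+1), which is log u ≤ u - 1 combined with 1 + v ≤ e^v. -/
lemma rpow_neg_le_telescope {s : ℝ} (hs : 1 < s) {a : ℝ} (ha : 1 ≤ a) :
    (a + 1) ^ (-s) ≤ (s - 1)⁻¹ * (a ^ (1 - s) - (a + 1) ^ (1 - s)) := by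
  have ha0 : 0 < a := by linarith
  have h1 : a ^ (1 - s) = (a + 1) ^ (1 - s) * (a / (a + 1)) ^ (1 - s) := by
    rw [← Real.mul_rpow (by positivity) (by positivity)]
    congr 1; field_simp
  have h2 : 1 + (s - 1) / (a + 1) ≤ (a / (a + 1)) ^ (1 - s) := by
    rw [Real.rpow_def_of_pos (by positivity)]
    have h3 : Real.log (a / (a + 1)) ≤ a / (a + 1) - 1 := Real.log_le_sub_one_of_pos (by positivity)
    have h4 : a / (a + 1) - 1 = -(1 / (a + 1)) := by field_simp; ring
    have h5 := Real.add_one_le_exp (Real.log (a / (a + 1)) * (1 - s))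
    have h6 : (s - 1) / (a + 1) ≤ Real.log (a / (a + 1)) * (1 - s) := by
      rw [h4] at h3
      have : (s - 1) / (a + 1) = (s - 1) * (1 / (a + 1)) := by ring
      rw [this]
      nlinarith
    linarith
  have h3 : (a + 1) ^ (-s) = (a + 1) ^ (1 - s) * (1 / (a + 1)) := by
    rw [show -s = (1 - s) + (-1) by ring, Real.rpow_add (by positivity), Real.rpow_neg_one, one_div]
  have h4 : 0 < (a + 1) ^ (1 - s) := by positivity
  rw [le_inv_mul_iff₀ (by linarith), h1, h3]
  have : (s - 1) / (a + 1) = (s - 1) * (1 / (a + 1)) := by ring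
  rw [this] at h2
  nlinarith

lemma sum_rpow_neg_le {s : ℝ} (hs : 1 < s) {k : ℕ} (hk : 1 ≤ k) (m : ℕ) :
    ∑ i ∈ Finset.range m, ((i + k : ℕ) + 1 : ℝ) ^ (-s) ≤ (s - 1)⁻¹ * (k : ℝ) ^ (1 - s) := by
  have key : ∑ i ∈ Finset.range m, ((i + k : ℕ) + 1 : ℝ) ^ (-s) ≤
      (s - 1)⁻¹ * ((k : ℝ) ^ (1 - s) - ((m + k : ℕ) : ℝ) ^ (1 - s)) := by
    induction m with
    | zero => simp
    | succ m ih =>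
      rw [Finset.sum_range_succ]
      have h1 : (1 : ℝ) ≤ ((m + k : ℕ) : ℝ) := by exact_mod_cast (by omega : 1 ≤ m + k)
      have h2 := rpow_neg_le_telescope hs h1
      have h3 : ((m + 1 + k : ℕ) : ℝ) = ((m + k : ℕ) : ℝ) + 1 := by push_cast; ring
      rw [h3]
      linarith
  refine key.trans (mul_le_mul_of_nonneg_left ?_ (inv_nonneg.mpr (by linarith)))
  have : 0 ≤ ((m + k : ℕ) : ℝ) ^ (1 - s) := by positivity
  linarith

lemma sobolevBall_subset {β β' L₀ : ℝ} (h : β ≤ β') : sobolevBall β' L₀ ⊆ sobolevBall β L₀ := by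
  intro θ hθ
  have hle : ∀ i : ℕ, θ i ^ 2 * ((i : ℝ) + 1) ^ (2 * β) ≤ θ i ^ 2 * ((i : ℝ) + 1) ^ (2 * β') := by
    intro i
    refine mul_le_mul_of_nonneg_left (Real.rpow_le_rpow_of_exponent_le ?_ (by linarith))
      (sq_nonneg _)
    linarith [(Nat.cast_nonneg i : (0 : ℝ) ≤ i)]
  have hs : Summable (fun i : ℕ => θ i ^ 2 * ((i : ℝ) + 1) ^ (2 * β)) :=
    Summable.of_nonneg_of_le (fun i => by positivity) hle hθ.1
  exact ⟨hs, (hs.tsum_le_tsum hle hθ.1).trans hθ.2⟩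

lemma sobolevBall_sum_le {β L₀ : ℝ} {θ : ℕ → ℝ} (hθ : θ ∈ sobolevBall β L₀) (s : Finset ℕ) :
    ∑ i ∈ s, θ i ^ 2 * ((i : ℝ) + 1) ^ (2 * β) ≤ L₀ :=
  (hθ.1.sum_le_tsum s fun i _ => by positivity).trans hθ.2

lemma rpow_sq_eq {a : ℝ} (ha : 0 ≤ a) (b : ℝ) : (a ^ b) ^ 2 = a ^ (2 * b) := by
  rw [← Real.rpow_natCast, ← Real.rpow_mul ha, mul_comm]
  norm_num

/-- Cauchy–Schwarz with the weights (i+k+1)^{±β}; β > 1/2 makes the sum of the inverse squared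
weights converge, with tail of order k^{1-2β}. -/
lemma sobolevBall_sum_abs_le {β L₀ : ℝ} (hβ : 1 / 2 < β) {θ : ℕ → ℝ}
    (hθ : θ ∈ sobolevBall β L₀) {k : ℕ} (hk : 1 ≤ k) (m : ℕ) :
    ∑ i ∈ Finset.range m, |θ (i + k)| ≤ √(L₀ / (2 * β - 1) * (k : ℝ) ^ (1 - 2 * β)) := by
  refine Real.le_sqrt_of_sq_le ?_
  have hcs := Finset.sum_mul_sq_le_sq_mul_sq (Finset.range m)
    (fun i => |θ (i + k)| * ((i + k : ℕ) + 1 : ℝ) ^ β) (fun i => ((i + k : ℕ) + 1 : ℝ) ^ (-β))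
  have e1 : ∀ i : ℕ, |θ (i + k)| * ((i + k : ℕ) + 1 : ℝ) ^ β * ((i + k : ℕ) + 1 : ℝ) ^ (-β) =
      |θ (i + k)| := by
    intro i
    rw [mul_assoc, ← Real.rpow_add (by positivity)]; simp
  have e2 : ∀ i : ℕ, (|θ (i + k)| * ((i + k : ℕ) + 1 : ℝ) ^ β) ^ 2 =
      θ (i + k) ^ 2 * (((i + k : ℕ) : ℝ) + 1) ^ (2 * β) := by
    intro i
    rw [mul_pow, sq_abs, rpow_sq_eq (by positivity)]
  have e3 : ∀ i : ℕ, (((i + k : ℕ) + 1 : ℝ) ^ (-β)) ^ 2 = ((i + k : ℕ) + 1 : ℝ) ^ (-(2 * β)) := by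
    intro i
    rw [rpow_sq_eq (by positivity), mul_neg]
  simp only [e1, e2, e3] at hcs
  have h1 : ∑ i ∈ Finset.range m, θ (i + k) ^ 2 * (((i + k : ℕ) : ℝ) + 1) ^ (2 * β) ≤ L₀ := by
    have := sobolevBall_sum_le hθ ((Finset.range m).map (addRightEmbedding k))
    simpa using this
  have h2 := sum_rpow_neg_le (s := 2 * β) (by linarith) hk m
  refine hcs.trans ((mul_le_mul h1 h2 (Finset.sum_nonneg fun i _ => by positivity) ?_).trans_eq ?_)
  · exact (Finset.sum_nonneg fun i _ => by positivity).trans h1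
  · ring

lemma sobolevBall_summable {β L₀ : ℝ} (hβ : 1 / 2 < β) {θ : ℕ → ℝ}
    (hθ : θ ∈ sobolevBall β L₀) : Summable fun j => |θ j| := by
  rw [← summable_nat_add_iff 1]
  exact summable_of_sum_range_le (fun _ => abs_nonneg _)
    (sobolevBall_sum_abs_le hβ hθ le_rfl)

lemma sobolevBall_tail_le {β L₀ : ℝ} (hβ : 1 / 2 < β) {θ : ℕ → ℝ}
    (hθ : θ ∈ sobolevBall β L₀) {k : ℕ} (hk : 1 ≤ k) :
    ∑' j, |θ (j + k)| ≤ √(L₀ / (2 * β - 1) * (k : ℝ) ^ (1 - 2 * β)) :=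
  Real.tsum_le_of_sum_range_le (fun _ => abs_nonneg _) (sobolevBall_sum_abs_le hβ hθ hk)

lemma sobolevBall_tsum_abs_le {β L₀ : ℝ} (hβ : 1 / 2 < β) {θ : ℕ → ℝ}
    (hθ : θ ∈ sobolevBall β L₀) : ∑' j, |θ j| ≤ √L₀ + √(L₀ / (2 * β - 1)) := by
  rw [(sobolevBall_summable hβ hθ).tsum_eq_zero_add]
  have h1 := sobolevBall_tail_le hβ hθ le_rfl
  have h2 := sobolevBall_sum_le hθ {0}
  simp only [Nat.cast_one, Real.one_rpow, mul_one, Finset.sum_singleton, Nat.cast_zero,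
    zero_add] at h1 h2
  have h3 : |θ 0| ≤ √L₀ := Real.le_sqrt_of_sq_le (by rwa [sq_abs])
  linarith

/-! ### The bias -/

lemma bias_nonneg (θ₀ : ℕ → ℝ) (k : ℕ) : 0 ≤ bias φ x θ₀ k :=
  Real.iInf_nonneg fun _ => sq_nonneg _

lemma bias_le (θ₀ : ℕ → ℝ) {k : ℕ} (θ : Fin k → ℝ) :
    bias φ x θ₀ k ≤ hellinger x (seriesProb φ θ₀) (sieveProb φ ⟨k, θ⟩) ^ 2 :=
  ciInf_le ⟨0, by rintro _ ⟨_, rfl⟩; exact sq_nonneg _⟩ θ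

lemma bias_le_two (θ₀ : ℕ → ℝ) (k : ℕ) : bias φ x θ₀ k ≤ 2 :=
  (bias_le θ₀ (0 : Fin k → ℝ)).trans
    (hellinger_sq_le_two (seriesProb_mem_Icc _ _) (sieveProb_mem_Icc _ _))

lemma bias_antitone (θ₀ : ℕ → ℝ) : Antitone (bias φ x θ₀) := by
  intro k m hkm
  refine le_ciInf fun θ => ?_
  refine (bias_le θ₀ (fun j : Fin m => pad θ j)).trans_eq ?_
  congr 2
  rw [sieveProb_eq, sieveProb_eq]
  ext t
  rw [sieveFun_eq_sum_pad hkm, sieveFun, Fin.sum_univ_eq_sum_range (fun j => pad θ j * φ j t)]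

lemma exists_lt_bias (θ₀ : ℕ → ℝ) (k : ℕ) {ε : ℝ} (hε : 0 < ε) : ∃ θ : Fin k → ℝ,
    hellinger x (seriesProb φ θ₀) (sieveProb φ ⟨k, θ⟩) ^ 2 < bias φ x θ₀ k + ε :=
  exists_lt_of_ciInf_lt (by simp only [bias] at *; linarith)

/-- The competitor is the truncation of θ₀ to k coefficients. The block between k and K is bounded
in empirical L² by the upper design inequality, the part beyond K in sup-norm by t. -/
lemma bias_le_of_sobolev {B C₀ : ℝ} (hφ : ∀ j t, |φ j t| ≤ B) (hC₀ : 0 < C₀) {K : ℕ}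
    (hdes : DesignCondition φ x C₀ K) {β L₀ : ℝ} (hβ : 1 / 2 < β) {θ₀ : ℕ → ℝ}
    (hθ₀ : θ₀ ∈ sobolevBall β L₀) {t : ℝ} (ht : B * ∑' j, |θ₀ (j + K)| ≤ t) {k : ℕ} (hk : 1 ≤ k)
    (hkK : k ≤ K) :
    bias φ x θ₀ k ≤ 4 * C₀ * L₀ * (k : ℝ) ^ (-(2 * β)) + 4 * t ^ 2 := by
  have hs := sobolevBall_summable hβ hθ₀
  refine (bias_le θ₀ (truncate θ₀ k)).trans ?_
  have h1 := hellinger_sigmoid_sq_le (x := x) (fun t => ∑' j, θ₀ j * φ j t)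
    (sieveFun φ (truncate θ₀ k))
  refine (show _ ≤ _ from h1).trans ?_
  set v : Fin K → ℝ := fun j => if (j : ℕ) < k then 0 else θ₀ j with hv
  have hcell : ∀ i, (∑' j, θ₀ j * φ j (x i) - sieveFun φ (truncate θ₀ k) (x i)) ^ 2 ≤
      2 * (∑ j : Fin K, v j * φ j (x i)) ^ 2 + 2 * t ^ 2 := by
    intro i
    have h2 := (abs_tsum_shift_le hφ hs K (x i)).trans ht
    have h3 := sq_le_sq' (abs_le.mp h2).1 (abs_le.mp h2).2
    have h4 : ∑' j, θ₀ j * φ j (x i) - sieveFun φ (truncate θ₀ k) (x i) =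
        ∑ j : Fin K, v j * φ j (x i) + ∑' j, θ₀ (j + K) * φ (j + K) (x i) := by
      rw [tsum_eq_sum_add_tail hφ hs K, sieveFun_eq_sum_pad hkK]
      rw [sieveFun, ← Fin.sum_univ_eq_sum_range (fun j => pad (truncate θ₀ k) j * φ j (x i)) K]
      rw [add_sub_right_comm, ← Finset.sum_sub_distrib]
      congr 1
      refine Finset.sum_congr rfl fun j _ => ?_
      by_cases hj : (j : ℕ) < k
      · simp [hv, hj, pad, truncate]
      · simp [hv, hj, pad]
    rw [h4]
    nlinarith [sq_nonneg (∑ j : Fin K, v j * φ j (x i) - ∑' j, θ₀ (j + K) * φ (j + K) (x i))]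
  have hvsum : ∑ j, v j ^ 2 ≤ L₀ * (k : ℝ) ^ (-(2 * β)) := by
    have hk' : (1 : ℝ) ≤ k := by exact_mod_cast hk
    have h2 : ∀ j : Fin K, v j ^ 2 ≤
        (θ₀ j ^ 2 * (((j : ℕ) : ℝ) + 1) ^ (2 * β)) * (k : ℝ) ^ (-(2 * β)) := by
      intro j
      by_cases hj : (j : ℕ) < k
      · simp only [hv, hj, if_true]; rw [zero_pow two_ne_zero]; positivity
      · simp only [hv, hj, if_false]
        have h3 : (k : ℝ) ≤ (j : ℕ) + 1 := by
          exact_mod_cast (by omega : k ≤ (j : ℕ) + 1)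
        have h4 : (1 : ℝ) ≤ (((j : ℕ) : ℝ) + 1) ^ (2 * β) * (k : ℝ) ^ (-(2 * β)) := by
          rw [Real.rpow_neg (by positivity), ← div_eq_mul_inv, one_le_div (by positivity)]
          exact Real.rpow_le_rpow (by positivity) h3 (by linarith)
        nlinarith [sq_nonneg (θ₀ j)]
    calc ∑ j, v j ^ 2 ≤ ∑ j : Fin K, (θ₀ j ^ 2 * (((j : ℕ) : ℝ) + 1) ^ (2 * β)) *
          (k : ℝ) ^ (-(2 * β)) := Finset.sum_le_sum fun j _ => h2 j
      _ = (∑ j ∈ Finset.range K, θ₀ j ^ 2 * ((j : ℝ) + 1) ^ (2 * β)) * (k : ℝ) ^ (-(2 * β)) := by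
          rw [← Finset.sum_mul, Fin.sum_univ_eq_sum_range
            (fun j => θ₀ j ^ 2 * ((j : ℝ) + 1) ^ (2 * β)) K]
      _ ≤ _ := mul_le_mul_of_nonneg_right (sobolevBall_sum_le hθ₀ _) (by positivity)
  have hd := (hdes K le_rfl v).2
  have hn : (1 / (n : ℝ)) * n ≤ 1 := by
    rw [one_div]; exact inv_mul_le_one
  have h5 : (1 / (n : ℝ)) * ∑ i, (∑' j, θ₀ j * φ j (x i) -
      sieveFun φ (truncate θ₀ k) (x i)) ^ 2 ≤ 2 * (C₀ * ∑ j, v j ^ 2) + 2 * t ^ 2 := by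
    calc _ ≤ (1 / (n : ℝ)) * ∑ i, (2 * (∑ j : Fin K, v j * φ j (x i)) ^ 2 + 2 * t ^ 2) :=
          mul_le_mul_of_nonneg_left (Finset.sum_le_sum fun i _ => hcell i) (by positivity)
      _ = 2 * ((1 / (n : ℝ)) * ∑ i, (∑ j : Fin K, v j * φ j (x i)) ^ 2) +
            (1 / (n : ℝ)) * n * (2 * t ^ 2) := by
            rw [Finset.sum_add_distrib, ← Finset.mul_sum]; simp; ring
      _ ≤ _ := by nlinarith [sq_nonneg t]
  nlinarith

/-- Since h_n² ≤ 2, every k ≥ 2n / log n is admissible. The set is therefore nonempty and its `sInf`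
is attained, instead of being the default value 0. -/
lemma oracleDim_spec (θ₀ : ℕ → ℝ) (hn : 2 ≤ n) : 1 ≤ oracleDim φ x θ₀ ∧
    bias φ x θ₀ (oracleDim φ x θ₀) ≤ oracleDim φ x θ₀ * Real.log n / n := by
  refine Nat.sInf_mem (s := {k : ℕ | 1 ≤ k ∧ bias φ x θ₀ k ≤ k * Real.log n / n}) ?_
  have hn' : (2 : ℝ) ≤ n := by exact_mod_cast hn
  have hlog : 0 < Real.log n := Real.log_pos (by linarith)
  obtain ⟨k, hk⟩ := exists_nat_ge (2 * n / Real.log n)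
  refine ⟨k + 1, by omega, (bias_le_two _ _).trans ?_⟩
  rw [div_le_iff₀ hlog] at hk
  rw [le_div_iff₀ (by linarith)]
  push_cast
  nlinarith

lemma oracleDim_le {θ₀ : ℕ → ℝ} {k : ℕ} (hk : 1 ≤ k) (h : bias φ x θ₀ k ≤ k * Real.log n / n) :
    oracleDim φ x θ₀ ≤ k := Nat.sInf_le ⟨hk, h⟩

lemma lt_bias_of_lt_oracleDim {θ₀ : ℕ → ℝ} {k : ℕ} (hk : 1 ≤ k) (h : k < oracleDim φ x θ₀) :
    k * Real.log n / n < bias φ x θ₀ k := by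
  by_contra hc
  exact absurd (oracleDim_le hk (not_lt.mp hc)) (not_le.mpr h)

/-- Under polished tails, the bias of models of dimension much smaller than the oracle is large. -/
lemma polishedTail_bias_lower {R₀ k₀ : ℕ} (hR₀ : 1 < R₀) (hk₀ : 1 ≤ k₀) {τ : ℝ} (hτ : 0 < τ)
    {θ₀ : ℕ → ℝ} (hθ₀ : θ₀ ∈ polishedTail φ x R₀ k₀ τ) (m : ℕ) {k : ℕ} (hk : 1 ≤ k)
    (h : k * (k₀ * R₀ ^ m) < oracleDim φ x θ₀) :
    τ⁻¹ ^ m * (oracleDim φ x θ₀ * Real.log n / n) / 2 ≤ bias φ x θ₀ k := by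
  set kn := oracleDim φ x θ₀ with hkn
  have hb : 0 < k₀ * R₀ ^ m := by positivity
  -- The largest q with q k₀ R₀^m < k_n. The chain q k₀ R₀^i, i ≤ m, starts above k₀ and ends in
  -- [k_n/2, k_n), where the bias still exceeds its threshold; each step backwards multiplies the
  -- bias by at least 1/τ.
  set q := (kn - 1) / (k₀ * R₀ ^ m) with hq
  have hkq : k ≤ q := by
    rw [hq, Nat.le_div_iff_mul_le hb]; omega
  have hq1 : 1 ≤ q := hk.trans hkq
  have hqlt : q * (k₀ * R₀ ^ m) < kn := by
    have := Nat.div_mul_le_self (kn - 1) (k₀ * R₀ ^ m)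
    rw [← hq] at this
    omega
  have hq2 : kn ≤ 2 * (q * (k₀ * R₀ ^ m)) := by
    have h1 := Nat.lt_div_mul_add (a := kn - 1) hb
    rw [← hq] at h1
    have h2 : k₀ * R₀ ^ m ≤ q * (k₀ * R₀ ^ m) := Nat.le_mul_of_pos_left _ hq1
    omega
  have hind : ∀ i ≤ m, bias φ x θ₀ (q * (k₀ * R₀ ^ i)) ≤ τ ^ i * bias φ x θ₀ (q * k₀) := by
    intro i
    induction i with
    | zero => intro _; simp
    | succ i ih =>
      intro hi
      have h1 : q * (k₀ * R₀ ^ i) ≤ q * (k₀ * R₀ ^ m) := by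
        gcongr <;> omega
      have h2 : k₀ ≤ q * (k₀ * R₀ ^ i) := by
        calc k₀ = 1 * (k₀ * 1) := by ring
          _ ≤ _ := by gcongr; exact Nat.one_le_pow _ _ (by omega)
      have h3 := hθ₀ (q * (k₀ * R₀ ^ i)) h2 (h1.trans hqlt.le)
      rw [show q * (k₀ * R₀ ^ (i + 1)) = q * (k₀ * R₀ ^ i) * R₀ by ring, pow_succ']
      refine h3.trans ?_
      rw [mul_assoc]
      exact mul_le_mul_of_nonneg_left (ih (by omega)) hτ.le
  have h1 := hind m le_rfl
  have h2 := lt_bias_of_lt_oracleDim (φ := φ) (x := x) (θ₀ := θ₀)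
    (show 1 ≤ q * (k₀ * R₀ ^ m) from Nat.mul_pos hq1 hb) hqlt
  have h3 : bias φ x θ₀ (q * k₀) ≤ bias φ x θ₀ k :=
    bias_antitone θ₀ (hkq.trans (Nat.le_mul_of_pos_right _ (by omega)))
  have h4 : (kn * Real.log n / n) / 2 ≤ ((q * (k₀ * R₀ ^ m) : ℕ) : ℝ) * Real.log n / n := by
    have : (kn : ℝ) ≤ 2 * ((q * (k₀ * R₀ ^ m) : ℕ) : ℝ) := by exact_mod_cast hq2
    have hln : 0 ≤ Real.log n / n := div_nonneg (Real.log_natCast_nonneg n) (Nat.cast_nonneg n)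
    have h5 := mul_le_mul_of_nonneg_right this hln
    rw [mul_div_assoc (kn : ℝ), mul_div_assoc _ (Real.log n) (n : ℝ)]
    linarith
  rw [mul_div_assoc, inv_pow, inv_mul_le_iff₀ (by positivity)]
  have h5 := mul_le_mul_of_nonneg_left h3 (pow_pos hτ m).le
  linarith

end


section

/-! ### Probability bounds for the likelihood -/

variable {n : ℕ} {x : Fin n → unitInterval} {φ : ℕ → unitInterval → ℝ}

lemma abs_sieveFun_sub_le {B : ℝ} (hφ : ∀ j t, |φ j t| ≤ B) {k : ℕ} {θ θ' : Fin k → ℝ} {ε : ℝ}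
    (hB : 0 ≤ B) (h : ∀ j, |θ j - θ' j| ≤ ε) (t : unitInterval) :
    |sieveFun φ θ t - sieveFun φ θ' t| ≤ B * (k * ε) := by
  rw [← sieveFun_sub]
  refine (abs_sieveFun_le hφ _ t).trans (mul_le_mul_of_nonneg_left ?_ hB)
  calc ∑ j, |(θ - θ') j| ≤ ∑ _j : Fin k, ε := Finset.sum_le_sum fun j _ => h j
    _ = _ := by simp

/-- Uniform control of the likelihood ratio over a bounded part of `Θ(k)`. -/
lemma law_exists_likelihood_gt_le {B : ℝ} (hB : 0 ≤ B) (hφ : ∀ j t, |φ j t| ≤ B)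
    {q₀ : unitInterval → ℝ} (h₀ : ∀ t, q₀ t ∈ Set.Icc (0 : ℝ) 1) (hn : 1 ≤ n) {k m : ℕ}
    (hm : 1 ≤ m) (hBm : B * (k * n) ≤ m) {s : ℝ} (hs : 4 / (n : ℝ) ^ 2 ≤ s) :
    law x q₀ {y | ¬ ∀ θ : Fin k → ℝ, (∀ j, |θ j| ≤ n) →
      4 * s ≤ hellinger x q₀ (sieveProb φ ⟨k, θ⟩) ^ 2 →
      likelihood x (sieveProb φ ⟨k, θ⟩) y ≤
        Real.exp (1 - n * hellinger x q₀ (sieveProb φ ⟨k, θ⟩) ^ 2 / 8) * likelihood x q₀ y} ≤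
      (2 * n * m + 1 : ℕ) ^ k * ENNReal.ofReal (Real.exp (-(n * s / 4))) := by
  have hn' : (0 : ℝ) < n := by exact_mod_cast hn
  have hm' : (0 : ℝ) < m := by exact_mod_cast hm
  -- A grid of mesh 1/m: as B k n ≤ m, rounding changes the logit by at most 1/n, hence the
  -- likelihood by a factor at most e and h by at most 2/n.
  set pt : (Fin k → ℤ) → Fin k → ℝ := fun a j => (a j : ℝ) / m with hpt
  set grid : Finset (Fin k → ℤ) :=
    Fintype.piFinset fun _ => Finset.Icc (-((n * m : ℕ) : ℤ)) ((n * m : ℕ) : ℤ) with hgrid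
  classical
  set far := grid.filter fun a => s ≤ hellinger x q₀ (sieveProb φ ⟨k, pt a⟩) ^ 2 with hfar
  have hsub : {y | ¬ ∀ θ : Fin k → ℝ, (∀ j, |θ j| ≤ n) →
      4 * s ≤ hellinger x q₀ (sieveProb φ ⟨k, θ⟩) ^ 2 →
      likelihood x (sieveProb φ ⟨k, θ⟩) y ≤
        Real.exp (1 - n * hellinger x q₀ (sieveProb φ ⟨k, θ⟩) ^ 2 / 8) * likelihood x q₀ y} ⊆
      ⋃ a ∈ far, {y | Real.exp (-(n * hellinger x q₀ (sieveProb φ ⟨k, pt a⟩) ^ 2 / 2)) *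
        likelihood x q₀ y ≤ likelihood x (sieveProb φ ⟨k, pt a⟩) y} := by
    intro y hy
    simp only [Set.mem_ofPred_eq, not_forall, not_le] at hy
    obtain ⟨θ, hθ, hθs, hθy⟩ := hy
    set a : Fin k → ℤ := fun j => ⌊θ j * m⌋ with ha
    have hag : a ∈ grid := by
      rw [hgrid, Fintype.mem_piFinset]
      intro j
      have h1 := abs_le.mp (hθ j)
      rw [Finset.mem_Icc]
      constructor
      · rw [ha, Int.le_floor]; push_cast; nlinarith
      · have : θ j * m ≤ ((n * m : ℕ) : ℤ) := by push_cast; nlinarith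
        exact_mod_cast (Int.floor_le _).trans this
    have hclose : ∀ j, |θ j - pt a j| ≤ 1 / m := by
      intro j
      have h1 := Int.floor_le (θ j * m)
      have h2 := Int.lt_floor_add_one (θ j * m)
      have h3 : θ j - pt a j = (θ j * m - ⌊θ j * m⌋) / m := by
        simp only [hpt, ha]; field_simp
      rw [h3, abs_of_nonneg (div_nonneg (by linarith) hm'.le)]
      exact div_le_div_of_nonneg_right (by linarith) hm'.le
    have hcl : ∀ t, |sieveFun φ θ t - sieveFun φ (pt a) t| ≤ 1 / n := by
      intro t
      refine (abs_sieveFun_sub_le hφ hB hclose t).trans ?_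
      rw [mul_one_div, ← mul_div_assoc, div_le_div_iff₀ hm' hn']
      linarith
    have hhc : hellinger x (sieveProb φ ⟨k, θ⟩) (sieveProb φ ⟨k, pt a⟩) ≤ 2 * (1 / n) :=
      hellinger_sigmoid_le (by positivity) hcl
    set h := hellinger x q₀ (sieveProb φ ⟨k, θ⟩) with hh
    set h' := hellinger x q₀ (sieveProb φ ⟨k, pt a⟩) with hh'
    have htri : h ≤ h' + 2 * (1 / n) := by
      refine (hellinger_triangle q₀ (sieveProb φ ⟨k, pt a⟩) _).trans ?_
      rw [hellinger_comm (sieveProb φ ⟨k, pt a⟩)]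
      linarith
    have hh0 : 0 ≤ h := hellinger_nonneg _ _
    -- The rounding error 2/n is at most h/2, so the grid point keeps h' ≥ h/2. This turns the
    -- exponent n h'²/2 of the grid bound into n h²/8.
    have hbig : 4 * (1 / n) ≤ h := by
      rw [← sq_le_sq₀ (by positivity) hh0]
      refine le_trans (le_of_eq ?_) ((mul_le_mul_of_nonneg_left hs (by norm_num)).trans hθs)
      ring
    have hhalf : h / 2 ≤ h' := by linarith
    have hsq : h ^ 2 / 4 ≤ h' ^ 2 := by
      have := pow_le_pow_left₀ (by positivity) hhalf 2
      linarith
    refine Set.mem_biUnion (x := a) (Finset.mem_coe.mpr (Finset.mem_filter.mpr ⟨hag, ?_⟩)) ?_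
    · change s ≤ h' ^ 2
      linarith
    · have hL : likelihood x (sieveProb φ ⟨k, θ⟩) y ≤
          Real.exp 1 * likelihood x (sieveProb φ ⟨k, pt a⟩) y := by
        have := likelihood_sigmoid_le (x := x) hcl y
        rwa [mul_one_div_cancel hn'.ne'] at this
      have hL0 := likelihood_nonneg (x := x) h₀ y
      change Real.exp (-(n * h' ^ 2 / 2)) * likelihood x q₀ y ≤ _
      have h1 : Real.exp (1 - n * h ^ 2 / 8) = Real.exp 1 * Real.exp (-(n * h ^ 2 / 8)) := by
        rw [← Real.exp_add]; ring_nf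
      rw [h1, mul_assoc] at hθy
      have h2 := le_of_mul_le_mul_left (hθy.le.trans hL) (Real.exp_pos 1)
      refine le_trans (mul_le_mul_of_nonneg_right (Real.exp_le_exp.mpr ?_) hL0) h2
      nlinarith
  refine (measure_mono hsub).trans ((measure_biUnion_finset_le _ _).trans ?_)
  calc _ ≤ ∑ _a ∈ far, ENNReal.ofReal (Real.exp (-(n * s / 4))) := by
        refine Finset.sum_le_sum fun a ha => ?_
        refine (law_likelihood_ratio_le h₀ (sieveProb_mem_Icc φ _)).trans ?_
        refine ENNReal.ofReal_le_ofReal (Real.exp_le_exp.mpr ?_)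
        have := (Finset.mem_filter.mp ha).2
        nlinarith
    _ = (far.card : ℝ≥0∞) * ENNReal.ofReal (Real.exp (-(n * s / 4))) := by simp
    _ ≤ _ := by
        gcongr
        have : far.card ≤ (2 * n * m + 1) ^ k := by
          refine (Finset.card_filter_le _ _).trans (le_of_eq ?_)
          rw [hgrid, Fintype.card_piFinset_const, Int.card_Icc]
          congr 1
          rw [mul_assoc 2 n m]
          omega
        exact_mod_cast this

/-- Prior mass of a small box. -/
lemma coordPrior_box_le {g : ℝ → ℝ} {G : ℝ} (hG : ∀ t, g t ≤ G) {k : ℕ} (v : Fin k → ℝ) {ρ : ℝ}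
    (hρ : 0 ≤ ρ) : coordPrior g k {θ | ∀ j, |θ j - v j| ≤ ρ} ≤ ENNReal.ofReal (G * (2 * ρ)) ^ k := by
  have hset : {θ : Fin k → ℝ | ∀ j, |θ j - v j| ≤ ρ} = Metric.closedBall v ρ := by
    ext θ
    simp [Metric.mem_closedBall, dist_pi_le_iff hρ, Real.dist_eq]
  refine ((coordPrior_le hG k) _).trans ?_
  rw [Measure.smul_apply, hset, Real.volume_pi_closedBall v hρ, smul_eq_mul, Fintype.card_fin,
    ENNReal.ofReal_pow (by positivity), ← mul_pow,
    ENNReal.ofReal_mul' (p := G) (by positivity : 0 ≤ 2 * ρ)]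

lemma le_coordPrior_box {g : ℝ → ℝ} {c R : ℝ} (hc : ∀ t, |t| ≤ R → c ≤ g t) {k : ℕ}
    (v : Fin k → ℝ) {ρ : ℝ} (hρ : 0 ≤ ρ) (hv : ∀ j, |v j| + ρ ≤ R) :
    ENNReal.ofReal (c * (2 * ρ)) ^ k ≤ coordPrior g k {θ | ∀ j, |θ j - v j| ≤ ρ} := by
  have hset : {θ : Fin k → ℝ | ∀ j, |θ j - v j| ≤ ρ} = Metric.closedBall v ρ := by
    ext θ
    simp [Metric.mem_closedBall, dist_pi_le_iff hρ, Real.dist_eq]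
  refine le_trans ?_ ((le_coordPrior hc k) _)
  have hsub : Metric.closedBall v ρ ⊆ Set.univ.pi fun _ => Set.Icc (-R) R := by
    intro θ hθ j _
    rw [← hset] at hθ
    have h1 := hθ j
    have h2 := hv j
    have h3 := abs_sub_abs_le_abs_sub (θ j) (v j)
    exact abs_le.mp (by linarith)
  rw [Measure.smul_apply, hset, Measure.restrict_apply Metric.isClosed_closedBall.measurableSet,
    Set.inter_eq_self_of_subset_left hsub, Real.volume_pi_closedBall v hρ, smul_eq_mul,
    Fintype.card_fin, ENNReal.ofReal_pow (by positivity), ← mul_pow,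
    ENNReal.ofReal_mul' (by positivity)]

/-- Lower bound of the marginal likelihood by the likelihood at a bounded parameter. -/
lemma partialEvidence_lower {B : ℝ} (hB : 0 ≤ B) (hφ : ∀ j t, |φ j t| ≤ B) (hn : 1 ≤ n)
    {k m : ℕ} (hm : 1 ≤ m) (hBm : B * (k * n) ≤ m) {g : ℝ → ℝ} {c R : ℝ}
    (hc : ∀ t, |t| ≤ R → c ≤ g t) (v : Fin k → ℝ) (hv : ∀ j, |v j| + 1 ≤ R) (y : Fin n → Bool) :
    ENNReal.ofReal (Real.exp (-1) * likelihood x (sieveProb φ ⟨k, v⟩) y) *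
      ENNReal.ofReal (c * (2 * (1 / m))) ^ k ≤ partialEvidence φ x g k y Set.univ := by
  have hn' : (0 : ℝ) < n := by exact_mod_cast hn
  have hm' : (1 : ℝ) ≤ m := by exact_mod_cast hm
  have hm1 : 1 / (m : ℝ) ≤ 1 := by rw [div_le_one (by linarith)]; exact hm'
  have hbox := le_coordPrior_box hc v (ρ := 1 / m) (by positivity)
    fun j => by linarith [hv j]
  set S := {θ : Fin k → ℝ | ∀ j, |θ j - v j| ≤ 1 / m} with hS
  have hSm : MeasurableSet S := by
    have : S = ⋂ j, {θ : Fin k → ℝ | |θ j - v j| ≤ 1 / m} := by ext; simp [hS]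
    rw [this]
    refine MeasurableSet.iInter fun j => measurableSet_le ?_ measurable_const
    fun_prop
  have hL : ∀ θ ∈ S, Real.exp (-1) * likelihood x (sieveProb φ ⟨k, v⟩) y ≤
      likelihood x (sieveProb φ ⟨k, θ⟩) y := by
    intro θ hθ
    have hcl : ∀ t, |sieveFun φ v t - sieveFun φ θ t| ≤ 1 / n := by
      intro t
      rw [abs_sub_comm]
      refine (abs_sieveFun_sub_le hφ hB hθ t).trans ?_
      rw [mul_one_div, ← mul_div_assoc, div_le_div_iff₀ (by linarith) hn']
      linarith
    have := likelihood_sigmoid_le (x := x) hcl y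
    rw [mul_one_div_cancel hn'.ne'] at this
    rw [Real.exp_neg, inv_mul_le_iff₀ (Real.exp_pos 1)]
    exact this
  refine le_trans ?_ (partialEvidence_mono g k y (Set.subset_univ S))
  calc _ ≤ ENNReal.ofReal (Real.exp (-1) * likelihood x (sieveProb φ ⟨k, v⟩) y) *
        coordPrior g k S := by gcongr
    _ = ∫⁻ _θ in S, ENNReal.ofReal (Real.exp (-1) * likelihood x (sieveProb φ ⟨k, v⟩) y)
        ∂coordPrior g k := by rw [setLIntegral_const]
    _ ≤ _ := setLIntegral_mono' hSm fun θ hθ => ENNReal.ofReal_le_ofReal (hL θ hθ)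

end


section

/-! ### Data for which the posterior can be controlled -/

variable {n : ℕ} {x : Fin n → unitInterval} {φ : ℕ → unitInterval → ℝ}

/-- The data `y` for which the likelihood behaves as expected under `θ₀` in all models of dimension
at most `N`. -/
structure GoodData (φ : ℕ → unitInterval → ℝ) {n : ℕ} (x : Fin n → unitInterval) (g : ℝ → ℝ)
    (θ₀ : ℕ → ℝ) (N : ℕ) (C₁ T : ℝ) (v : ℕ → ℝ) (y : Fin n → Bool) : Prop where
  ratio : ∀ k ∈ Finset.Icc 1 N, ∀ θ : Fin k → ℝ, (∀ j, |θ j| ≤ n) →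
    4 * (24 * (k * Real.log n / n)) ≤ hellinger x (seriesProb φ θ₀) (sieveProb φ ⟨k, θ⟩) ^ 2 →
    likelihood x (sieveProb φ ⟨k, θ⟩) y ≤
      Real.exp (1 - n * hellinger x (seriesProb φ θ₀) (sieveProb φ ⟨k, θ⟩) ^ 2 / 8) *
        likelihood x (seriesProb φ θ₀) y
  outer : ∀ k ∈ Finset.Icc 1 N, partialEvidence φ x g k y {θ | ¬ ∀ j, |θ j| ≤ n} ≤
    ENNReal.ofReal (Real.exp (-T) * likelihood x (seriesProb φ θ₀) y)
  near : ∀ k ∈ Finset.Icc 1 N, partialEvidence φ x g k y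
    {θ | hellinger x (seriesProb φ θ₀) (sieveProb φ ⟨k, θ⟩) ^ 2 < 4 * (24 * (k * Real.log n / n))} ≤
    ENNReal.ofReal (Real.exp (-(k * Real.log n / 16)) * likelihood x (seriesProb φ θ₀) y)
  oracle : ENNReal.ofReal (Real.exp (-(C₁ * (oracleDim φ x θ₀ * Real.log n))) *
    likelihood x (seriesProb φ θ₀) y) ≤ partialEvidence φ x g (oracleDim φ x θ₀) y Set.univ
  tail : ∑' k, (if N < k then ENNReal.ofReal (v k) else 0) *
    partialEvidence φ x g k y Set.univ ≤
    ENNReal.ofReal (Real.exp (-T) * likelihood x (seriesProb φ θ₀) y)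

lemma measure_not_forall_le {Ω : Type*} [MeasurableSpace Ω] (μ : Measure Ω) (s : Finset ℕ)
    (p : ℕ → Ω → Prop) : μ {y | ¬ ∀ k ∈ s, p k y} ≤ ∑ k ∈ s, μ {y | ¬ p k y} := by
  refine le_trans (measure_mono fun y hy => ?_) (measure_biUnion_finset_le s _)
  simp only [Set.mem_ofPred_eq, not_forall] at hy
  obtain ⟨k, hk, hy⟩ := hy
  exact Set.mem_biUnion (Finset.mem_coe.mpr hk) hy

/-- The radius constant 24 is chosen so that the bound exp(-6 k log n) at a grid point beats the
n^{4k} grid points; what is left is at most n^{-2} for each of at most n dimensions. -/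
lemma law_not_ratio_le {B : ℝ} (hB : 0 ≤ B) (hφ : ∀ j t, |φ j t| ≤ B) (θ₀ : ℕ → ℝ) (hn : 3 ≤ n)
    {m N : ℕ} (hm : 1 ≤ m) (hNn : N ≤ n) (hBm : B * (n * n) ≤ m) (hmn : 2 * n * m + 1 ≤ n ^ 4) :
    law x (seriesProb φ θ₀) {y | ¬ ∀ k ∈ Finset.Icc 1 N, ∀ θ : Fin k → ℝ, (∀ j, |θ j| ≤ n) →
    4 * (24 * (k * Real.log n / n)) ≤ hellinger x (seriesProb φ θ₀) (sieveProb φ ⟨k, θ⟩) ^ 2 →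
    likelihood x (sieveProb φ ⟨k, θ⟩) y ≤
      Real.exp (1 - n * hellinger x (seriesProb φ θ₀) (sieveProb φ ⟨k, θ⟩) ^ 2 / 8) *
        likelihood x (seriesProb φ θ₀) y} ≤ ENNReal.ofReal (1 / n) := by
  have hn' : (3 : ℝ) ≤ n := by exact_mod_cast hn
  have hlog : 1 ≤ Real.log n := by
    rw [Real.le_log_iff_exp_le (by linarith)]
    linarith [Real.exp_one_lt_d9]
  refine (measure_not_forall_le _ _ _).trans ?_
  calc _ ≤ ∑ k ∈ Finset.Icc 1 N, ENNReal.ofReal (1 / n ^ 2) := by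
        refine Finset.sum_le_sum fun k hk => ?_
        rw [Finset.mem_Icc] at hk
        have hk1 : (1 : ℝ) ≤ k := by exact_mod_cast hk.1
        have hkn : (k : ℝ) ≤ n := by exact_mod_cast hk.2.trans hNn
        refine (law_exists_likelihood_gt_le hB hφ (seriesProb_mem_Icc φ θ₀) (by omega) hm
          (hBm.trans' ?_) (s := 24 * (k * Real.log n / n)) ?_).trans ?_
        · gcongr
        · rw [div_le_iff₀ (by positivity)]
          have : 24 * (k * Real.log n / n) * (n : ℝ) ^ 2 = 24 * (k * Real.log n * n) := by
            field_simp
          rw [this]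
          have : 1 * 1 * 3 ≤ k * Real.log n * n := by gcongr
          linarith
        · have h1 : ((2 * n * m + 1 : ℕ) : ℝ≥0∞) ≤ ENNReal.ofReal (n ^ 4) := by
            rw [← ENNReal.ofReal_natCast]
            exact ENNReal.ofReal_le_ofReal (by exact_mod_cast hmn)
          refine (mul_le_mul_left (pow_le_pow_left' h1 k) _).trans ?_
          rw [← ENNReal.ofReal_pow (by positivity), ← ENNReal.ofReal_mul (by positivity)]
          refine ENNReal.ofReal_le_ofReal ?_
          have h2 : (n : ℝ) * (24 * (k * Real.log n / n)) / 4 = 6 * (k * Real.log n) := by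
            field_simp; norm_num
          have h3 : ((n : ℝ) ^ 4) ^ k = Real.exp (4 * (k * Real.log n)) := by
            rw [← pow_mul, ← Real.exp_log (show (0 : ℝ) < n by linarith), ← Real.exp_nat_mul,
              Real.log_exp]
            push_cast; ring_nf
          have h4 : 1 / (n : ℝ) ^ 2 = Real.exp (-(2 * Real.log n)) := by
            rw [Real.exp_neg, one_div, ← Real.exp_log (show (0 : ℝ) < n by linarith),
              ← Real.exp_nat_mul, Real.log_exp]
            push_cast; rfl
          rw [h2, h3, h4, ← Real.exp_add, Real.exp_le_exp]
          nlinarith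
    _ = ENNReal.ofReal (N * (1 / n ^ 2)) := by
        rw [Finset.sum_const, Nat.card_Icc, nsmul_eq_mul, ENNReal.ofReal_mul (by positivity),
          ENNReal.ofReal_natCast]
        simp
    _ ≤ _ := by
        refine ENNReal.ofReal_le_ofReal ?_
        have : (N : ℝ) ≤ n := by exact_mod_cast hNn
        calc (N : ℝ) * (1 / n ^ 2) ≤ n * (1 / n ^ 2) := by gcongr
          _ = _ := by field_simp

lemma law_not_outer_le {g : ℝ → ℝ} (hg : IsSieveDensity g) {C d : ℝ} (hC : 0 < C)
    (htail : densityMeasure g {t | (n : ℝ) < |t|} ≤ ENNReal.ofReal (C * Real.exp (-(d * n))))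
    (θ₀ : ℕ → ℝ) (N : ℕ) (T : ℝ) :
    law x (seriesProb φ θ₀) {y | ¬ ∀ k ∈ Finset.Icc 1 N,
      partialEvidence φ x g k y {θ | ¬ ∀ j, |θ j| ≤ n} ≤
      ENNReal.ofReal (Real.exp (-T) * likelihood x (seriesProb φ θ₀) y)} ≤
      ENNReal.ofReal (N ^ 2 * C * Real.exp (T - d * n)) := by
  refine (measure_not_forall_le _ _ _).trans ?_
  calc _ ≤ ∑ k ∈ Finset.Icc 1 N, ENNReal.ofReal (N * C * Real.exp (T - d * n)) := by
        refine Finset.sum_le_sum fun k hk => ?_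
        rw [Finset.mem_Icc] at hk
        refine (law_partialEvidence_gt_le (seriesProb_mem_Icc φ θ₀) g k _ T).trans ?_
        refine (mul_le_mul_right (coordPrior_tail_le hg htail k) _).trans ?_
        rw [← ENNReal.ofReal_natCast, ← ENNReal.ofReal_mul (by positivity),
          ← ENNReal.ofReal_mul (by positivity)]
        refine ENNReal.ofReal_le_ofReal ?_
        have hkN : (k : ℝ) ≤ N := by exact_mod_cast hk.2
        rw [sub_eq_add_neg, Real.exp_add]
        calc Real.exp T * (k * (C * Real.exp (-(d * n)))) =
            k * C * (Real.exp T * Real.exp (-(d * n))) := by ring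
          _ ≤ _ := by gcongr
    _ = _ := by
        rw [Finset.sum_const, Nat.card_Icc, nsmul_eq_mul, ← ENNReal.ofReal_natCast,
          ← ENNReal.ofReal_mul (by positivity)]
        congr 1
        simp only [add_tsub_cancel_right]
        ring

/-- Markov's inequality needs weights that do not depend on the data; `v` is such a majorant of the
actual weights beyond N. -/
lemma law_not_tail_le {g : ℝ → ℝ} (hg : IsSieveDensity g) (θ₀ : ℕ → ℝ) (N : ℕ) (T : ℝ)
    (v : ℕ → ℝ) {V : ℝ} (hV : ∑' k, (if N < k then ENNReal.ofReal (v k) else 0) ≤ ENNReal.ofReal V) :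
    law x (seriesProb φ θ₀) {y | ¬ ∑' k, (if N < k then ENNReal.ofReal (v k) else 0) *
      partialEvidence φ x g k y Set.univ ≤
      ENNReal.ofReal (Real.exp (-T) * likelihood x (seriesProb φ θ₀) y)} ≤
      ENNReal.ofReal (Real.exp T * V) := by
  have h₀ := seriesProb_mem_Icc φ θ₀
  refine (law_le_mul_sum h₀ (c := ENNReal.ofReal (Real.exp T)) (a := fun y =>
    ∑' k, (if N < k then ENNReal.ofReal (v k) else 0) * partialEvidence φ x g k y Set.univ)
    fun y hy => ?_).trans ?_
  · have hy' := (not_le.mp hy).le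
    calc ENNReal.ofReal (likelihood x (seriesProb φ θ₀) y)
        = ENNReal.ofReal (Real.exp T) *
          ENNReal.ofReal (Real.exp (-T) * likelihood x (seriesProb φ θ₀) y) := by
          rw [← ENNReal.ofReal_mul (Real.exp_pos _).le, ← mul_assoc, ← Real.exp_add]; simp
      _ ≤ _ := by gcongr
  · rw [ENNReal.ofReal_mul (Real.exp_pos _).le]
    gcongr
    rw [← Summable.tsum_finsetSum fun _ _ => ENNReal.summable]
    refine le_trans (ENNReal.tsum_le_tsum fun k => ?_) hV
    rw [← Finset.mul_sum, sum_partialEvidence]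
    have := isProbabilityMeasure_coordPrior hg k
    simp

/-- Small neighborhoods of the truth in a large model carry little prior mass, which penalizes
excessive dimensions. By `hloc` the neighborhood lies in a box around the truncated truth, of prior
mass at most n^{-k/8}. Markov spends n^{k/16} of this, and the remaining n^{-k/16} is summed over k
as a geometric series. -/
lemma law_not_near_le {C c t : ℝ} {θ₀ : ℕ → ℝ} {N : ℕ}
    (hloc : ∀ k ≤ N, ∀ θ : Fin k → ℝ,
      √k * hellinger x (seriesProb φ θ₀) (sieveProb φ ⟨k, θ⟩) ≤ c →
      l2 (θ - truncate θ₀ k) ≤ C * (hellinger x (seriesProb φ θ₀) (sieveProb φ ⟨k, θ⟩) + t))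
    (hn : 1 ≤ n) (hC : 0 ≤ C) (ht : 0 ≤ t)
    (hsmall : √N * √(4 * (24 * (N * Real.log n / n))) ≤ c)
    {g : ℝ → ℝ} {G : ℝ} (hG : ∀ t, g t ≤ G)
    (hρ : G * (2 * (C * (√(4 * (24 * (N * Real.log n / n))) + t))) ≤ Real.exp (-(Real.log n / 8)))
    (hhalf : Real.exp (-(Real.log n / 16)) ≤ 1 / 2) :
    law x (seriesProb φ θ₀) {y | ¬ ∀ k ∈ Finset.Icc 1 N, partialEvidence φ x g k y
      {θ | hellinger x (seriesProb φ θ₀) (sieveProb φ ⟨k, θ⟩) ^ 2 < 4 * (24 * (k * Real.log n / n))} ≤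
      ENNReal.ofReal (Real.exp (-(k * Real.log n / 16)) * likelihood x (seriesProb φ θ₀) y)} ≤
      ENNReal.ofReal (2 * Real.exp (-(Real.log n / 16))) := by
  have hln : 0 ≤ Real.log n := Real.log_natCast_nonneg n
  set r := Real.exp (-(Real.log n / 16)) with hr
  have hr0 : 0 < r := Real.exp_pos _
  refine (measure_not_forall_le _ _ _).trans ?_
  calc _ ≤ ∑ k ∈ Finset.Icc 1 N, ENNReal.ofReal (r ^ k) := by
        refine Finset.sum_le_sum fun k hk => ?_
        rw [Finset.mem_Icc] at hk
        have hkN : (k : ℝ) ≤ N := by exact_mod_cast hk.2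
        refine (law_partialEvidence_gt_le (seriesProb_mem_Icc φ θ₀) g k _ _).trans ?_
        set σ := √(4 * (24 * (N * Real.log n / n))) with hσ
        have hmass : coordPrior g k {θ | hellinger x (seriesProb φ θ₀) (sieveProb φ ⟨k, θ⟩) ^ 2 <
            4 * (24 * (k * Real.log n / n))} ≤
            ENNReal.ofReal (Real.exp (-(Real.log n / 8))) ^ k := by
          refine (measure_mono fun θ hθ => ?_).trans ((coordPrior_box_le hG (truncate θ₀ k)
            (ρ := C * (σ + t)) (by positivity)).trans
            (pow_le_pow_left' (ENNReal.ofReal_le_ofReal hρ) k))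
          have hhσ : hellinger x (seriesProb φ θ₀) (sieveProb φ ⟨k, θ⟩) ≤ σ := by
            refine Real.le_sqrt_of_sq_le ((le_of_lt hθ).trans ?_)
            gcongr
          have hkk : √(k : ℝ) ≤ √N := Real.sqrt_le_sqrt hkN
          have h1 := hloc k hk.2 θ (le_trans (by gcongr; exact hellinger_nonneg _ _) hsmall)
          intro j
          refine (abs_le_l2 (θ - truncate θ₀ k) j).trans (h1.trans ?_)
          gcongr
        refine (mul_le_mul_right hmass _).trans ?_
        rw [← ENNReal.ofReal_pow (Real.exp_pos _).le, ← ENNReal.ofReal_mul (Real.exp_pos _).le]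
        refine ENNReal.ofReal_le_ofReal (le_of_eq ?_)
        rw [hr, ← Real.exp_nat_mul, ← Real.exp_nat_mul, ← Real.exp_add]
        congr 1; ring
    _ = ENNReal.ofReal (∑ k ∈ Finset.Icc 1 N, r ^ k) := by
        rw [ENNReal.ofReal_sum_of_nonneg fun k _ => by positivity]
    _ ≤ _ := by
        refine ENNReal.ofReal_le_ofReal ?_
        have h1 : ∀ M : ℕ, ∑ k ∈ Finset.Icc 1 M, r ^ k ≤ 2 * r - 2 * r * r ^ M := by
          intro M
          induction M with
          | zero => simp
          | succ M ih =>
            rw [Finset.sum_Icc_succ_top (by omega), pow_succ]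
            nlinarith [mul_nonneg (mul_pos hr0 (pow_pos hr0 M)).le (sub_nonneg.2 hhalf)]
        have := h1 N
        have h2 : 0 ≤ 2 * r * r ^ N := by positivity
        linarith

/-- A nearly best approximation in Θ(k_n) has h² ≤ 2 k_n log n / n. By `hloc` its ℓ¹-norm is at most
A + 1, so its probabilities stay away from 0 and 1 and `law_lt_likelihood_ratio_le` applies to it. A
box of half-width 1/m around it has prior mass at least n^{-4k_n}. In the exponent, 8/a² + 1 comes
from the likelihood, 4 from the box and the last 1 from the factor e^{-1} lost inside the box. -/
lemma law_not_oracle_le {A B C c t : ℝ} {θ₀ : ℕ → ℝ} (hB : 0 ≤ B) (hφ : ∀ j t, |φ j t| ≤ B)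
    (hs : Summable fun j => |θ₀ j|) (hsA : ∑' j, |θ₀ j| ≤ A) {N : ℕ}
    (hloc : ∀ k ≤ N, ∀ θ : Fin k → ℝ,
      √k * hellinger x (seriesProb φ θ₀) (sieveProb φ ⟨k, θ⟩) ≤ c →
      l2 (θ - truncate θ₀ k) ≤ C * (hellinger x (seriesProb φ θ₀) (sieveProb φ ⟨k, θ⟩) + t))
    (hn : 3 ≤ n) (hC : 0 ≤ C)
    (hsmall : √N * √(4 * (24 * (N * Real.log n / n))) ≤ c)
    (hone : √N * (C * (√(4 * (24 * (N * Real.log n / n))) + t)) ≤ 1)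
    {m : ℕ} (hm : 1 ≤ m) (hNn : N ≤ n) (hBm : B * (n * n) ≤ m)
    {g : ℝ → ℝ} {c₂ : ℝ} (hc₂ : 0 < c₂) (hg : ∀ t, |t| ≤ A + 2 → c₂ ≤ g t)
    (hmn : m ≤ c₂ * n ^ 4) (hkN : oracleDim φ x θ₀ ≤ N) :
    law x (seriesProb φ θ₀) {y | ¬ ENNReal.ofReal (Real.exp (-((8 / Real.sigmoid (-(B * (A + 1))) ^ 2
      + 6) * (oracleDim φ x θ₀ * Real.log n))) * likelihood x (seriesProb φ θ₀) y) ≤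
      partialEvidence φ x g (oracleDim φ x θ₀) y Set.univ} ≤ ENNReal.ofReal (1 / n) := by
  have hn' : (3 : ℝ) ≤ n := by exact_mod_cast hn
  have hm' : (1 : ℝ) ≤ m := by exact_mod_cast hm
  have hlog : 1 ≤ Real.log n := by
    rw [Real.le_log_iff_exp_le (by linarith)]
    linarith [Real.exp_one_lt_d9]
  obtain ⟨hk1, hkb⟩ := oracleDim_spec (φ := φ) (x := x) θ₀ (by omega)
  set k := oracleDim φ x θ₀ with hk
  have hk1' : (1 : ℝ) ≤ k := by exact_mod_cast hk1
  have hkN' : (k : ℝ) ≤ N := by exact_mod_cast hkN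
  have hkn : (k : ℝ) ≤ n := by exact_mod_cast hkN.trans hNn
  obtain ⟨θ, hθ⟩ := exists_lt_bias (φ := φ) (x := x) θ₀ k
    (ε := k * Real.log n / n) (by positivity)
  set h := hellinger x (seriesProb φ θ₀) (sieveProb φ ⟨k, θ⟩) with hh
  have hh0 : 0 ≤ h := hellinger_nonneg _ _
  have hh2 : h ^ 2 ≤ 2 * (k * Real.log n / n) := by linarith
  set σ := √(4 * (24 * (N * Real.log n / n))) with hσ
  have hhσ : h ≤ σ := by
    refine Real.le_sqrt_of_sq_le (hh2.trans ?_)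
    have : (k : ℝ) * Real.log n / n ≤ N * Real.log n / n := by gcongr
    have : 0 ≤ (N : ℝ) * Real.log n / n := by positivity
    linarith
  have hkk : √(k : ℝ) ≤ √N := Real.sqrt_le_sqrt hkN'
  have h1 := hloc k hkN θ (le_trans (by gcongr) hsmall)
  have hsum : ∑ j, |θ j| ≤ A + 1 := by
    have e1 := sum_abs_le_l2 (θ - truncate θ₀ k)
    have e2 : √(k : ℝ) * l2 (θ - truncate θ₀ k) ≤ 1 := by
      refine le_trans ?_ hone
      refine mul_le_mul hkk (h1.trans ?_) (l2_nonneg _) (Real.sqrt_nonneg _)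
      gcongr
    have e3 := (sum_abs_truncate_le hs k).trans hsA
    have e4 : ∑ j, |θ j| ≤ ∑ j, |(θ - truncate θ₀ k) j| + ∑ j, |truncate θ₀ k j| := by
      rw [← Finset.sum_add_distrib]
      refine Finset.sum_le_sum fun j _ => ?_
      have := abs_add_le ((θ - truncate θ₀ k) j) (truncate θ₀ k j)
      simpa using this
    linarith
  have hθj : ∀ j, |θ j| + 1 ≤ A + 2 := by
    intro j
    have := Finset.single_le_sum (f := fun j => |θ j|) (fun _ _ => abs_nonneg _) (Finset.mem_univ j)
    linarith
  set a := Real.sigmoid (-(B * (A + 1))) with ha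
  have ha0 : 0 < a := Real.sigmoid_pos _
  have hcell : ∀ i, a ^ 2 ≤ sieveProb φ ⟨k, θ⟩ (x i) * (1 - sieveProb φ ⟨k, θ⟩ (x i)) := by
    intro i
    have e1 := (abs_sieveFun_le hφ θ (x i)).trans (mul_le_mul_of_nonneg_left hsum hB)
    rw [abs_le] at e1
    rw [sieveProb_eq, one_sub_sigmoid, sq]
    exact mul_le_mul (Real.sigmoid_le e1.1) (Real.sigmoid_le (by linarith [e1.2])) ha0.le
      (Real.sigmoid_nonneg _)
  have hprob := law_lt_likelihood_ratio_le (x := x) (by positivity : 0 < a ^ 2)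
    (seriesProb_mem_Icc φ θ₀) (q := sieveProb φ ⟨k, θ⟩)
    (fun t => ⟨Real.sigmoid_pos _, Real.sigmoid_lt_one _⟩) hcell
    ((8 / a ^ 2 + 1) * (k * Real.log n))
  refine le_trans (measure_mono fun y hy => ?_) (hprob.trans ?_)
  · by_contra hcon
    refine hy ?_
    have hcon' : Real.exp (-((8 / a ^ 2 + 1) * (k * Real.log n))) * likelihood x (seriesProb φ θ₀) y <
      likelihood x (sieveProb φ ⟨k, θ⟩) y := not_le.mp hcon
    refine le_trans ?_ (partialEvidence_lower hB hφ (by omega) hm (hBm.trans' (by gcongr)) hg θ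
      hθj y)
    have e1 : Real.exp (-(4 * (k * Real.log n))) ≤ (c₂ * (2 * (1 / m))) ^ k := by
      have e2 : Real.exp (-(4 * (k * Real.log n))) = (1 / (n : ℝ) ^ 4) ^ k := by
        rw [one_div, inv_pow, ← pow_mul, Real.exp_neg,
          ← Real.exp_log (show (0 : ℝ) < n by linarith), ← Real.exp_nat_mul, Real.log_exp]
        push_cast; ring_nf
      rw [e2]
      refine pow_le_pow_left₀ (by positivity) ?_ k
      have e3 : c₂ * (2 * (1 / (m : ℝ))) = 2 * c₂ / m := by ring
      rw [e3, div_le_div_iff₀ (by positivity) (by linarith)]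
      have : 0 < c₂ * (n : ℝ) ^ 4 := by positivity
      linarith
    rw [← ENNReal.ofReal_pow (by positivity), ← ENNReal.ofReal_mul
      (mul_nonneg (Real.exp_pos _).le (likelihood_nonneg (sieveProb_mem_Icc φ _) y))]
    refine ENNReal.ofReal_le_ofReal ?_
    have hL0 := likelihood_nonneg (x := x) (seriesProb_mem_Icc φ θ₀) y
    have e5 : Real.exp (-((8 / a ^ 2 + 6) * (k * Real.log n))) ≤ Real.exp (-1) *
        Real.exp (-((8 / a ^ 2 + 1) * (k * Real.log n))) * Real.exp (-(4 * (k * Real.log n))) := by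
      rw [← Real.exp_add, ← Real.exp_add, Real.exp_le_exp]
      have : 1 ≤ k * Real.log n := by nlinarith
      nlinarith
    calc _ ≤ (Real.exp (-1) * Real.exp (-((8 / a ^ 2 + 1) * (k * Real.log n))) *
          Real.exp (-(4 * (k * Real.log n)))) * likelihood x (seriesProb φ θ₀) y := by gcongr
      _ = Real.exp (-1) * (Real.exp (-((8 / a ^ 2 + 1) * (k * Real.log n))) *
          likelihood x (seriesProb φ θ₀) y) * Real.exp (-(4 * (k * Real.log n))) := by ring
      _ ≤ _ := by
          have := likelihood_nonneg (x := x) (sieveProb_mem_Icc φ ⟨k, θ⟩) y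
          have hcn := hcon'.le
          gcongr
  · refine ENNReal.ofReal_le_ofReal ?_
    have e1 : 1 / (n : ℝ) = Real.exp (-Real.log n) := by
      rw [Real.exp_neg, Real.exp_log (by linarith), one_div]
    rw [e1, Real.exp_le_exp]
    have e2 : (n : ℝ) * h ^ 2 ≤ 2 * (k * Real.log n) := by
      calc (n : ℝ) * h ^ 2 ≤ n * (2 * (k * Real.log n / n)) := by gcongr
        _ = _ := by field_simp
    have e3 : 4 / a ^ 2 * (n * h ^ 2) ≤ 4 / a ^ 2 * (2 * (k * Real.log n)) := by gcongr
    have e4 : 4 / a ^ 2 * (2 * (k * Real.log n)) = 8 / a ^ 2 * (k * Real.log n) := by ring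
    have : Real.log n ≤ k * Real.log n := by nlinarith
    linarith

end


section

/-! ### Posterior concentration for good data -/

variable {n : ℕ} {x : Fin n → unitInterval} {φ : ℕ → unitInterval → ℝ}

lemma evidence_hierPrior_le_one {g : ℝ → ℝ} (hg : IsSieveDensity g) {w : ℕ → ℝ}
    (hw : ∑' k, ENNReal.ofReal (w k) ≤ 1) (y : Fin n → Bool) :
    evidence φ x (hierPrior g w) y ≤ 1 := by
  rw [evidence_hierPrior]
  refine le_trans (ENNReal.tsum_le_tsum fun k => ?_) hw
  exact mul_le_of_le_one_right' (partialEvidence_le_one hg k y _)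

lemma isProbabilityMeasure_posterior {g : ℝ → ℝ} (hg : IsSieveDensity g) {w : ℕ → ℝ}
    (hw : ∑' k, ENNReal.ofReal (w k) ≤ 1) {y : Fin n → Bool}
    (hE : evidence φ x (hierPrior g w) y ≠ 0) :
    IsProbabilityMeasure (posterior φ x (hierPrior g w) y) := by
  constructor
  rw [posterior, Measure.smul_apply, withDensity_apply _ MeasurableSet.univ, Measure.restrict_univ,
    smul_eq_mul]
  exact ENNReal.inv_mul_cancel hE
    (ne_top_of_le_ne_top ENNReal.one_ne_top (evidence_hierPrior_le_one hg hw y))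

/-- Posterior mass of a set which is small in all models of dimension at most `N`. -/
lemma posterior_le {g : ℝ → ℝ} {w v : ℕ → ℝ} (hw : ∑' k, ENNReal.ofReal (w k) ≤ 1)
    (hw0 : w 0 = 0) {N : ℕ} (hwv : ∀ k, N < k → w k ≤ v k) {y : Fin n → Bool} {a b : ℝ}
    (hb : 0 < b) (ha : 0 ≤ a) (hE : ENNReal.ofReal b ≤ evidence φ x (hierPrior g w) y)
    {S : Set SieveParam} (hS : MeasurableSet S)
    (hk : ∀ k ∈ Finset.Icc 1 N, partialEvidence φ x g k y ((fun θ => ⟨k, θ⟩) ⁻¹' S) ≤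
      ENNReal.ofReal a)
    (htail : ∑' k, (if N < k then ENNReal.ofReal (v k) else 0) *
      partialEvidence φ x g k y Set.univ ≤ ENNReal.ofReal a) :
    posterior φ x (hierPrior g w) y S ≤ ENNReal.ofReal (2 * a / b) := by
  rw [posterior_hierPrior_apply g w y hS]
  have h1 : ∑' k, ENNReal.ofReal (w k) * partialEvidence φ x g k y ((fun θ => ⟨k, θ⟩) ⁻¹' S) ≤
      ENNReal.ofReal (2 * a) := by
    calc _ ≤ ∑' k, (ENNReal.ofReal (w k) * ENNReal.ofReal a +
          (if N < k then ENNReal.ofReal (v k) else 0) * partialEvidence φ x g k y Set.univ) := by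
          refine ENNReal.tsum_le_tsum fun k => ?_
          by_cases hkN : N < k
          · rw [if_pos hkN]
            refine le_add_left (mul_le_mul' (ENNReal.ofReal_le_ofReal (hwv k hkN)) ?_)
            exact partialEvidence_mono g k y (Set.subset_univ _)
          · rcases Nat.eq_zero_or_pos k with h0 | h0
            · subst h0; simp [hw0]
            · refine le_add_right (mul_le_mul_right (hk k ?_) _)
              rw [Finset.mem_Icc]; omega
      _ = (∑' k, ENNReal.ofReal (w k)) * ENNReal.ofReal a + ∑' k,
          (if N < k then ENNReal.ofReal (v k) else 0) * partialEvidence φ x g k y Set.univ := by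
          rw [ENNReal.tsum_add, ENNReal.tsum_mul_right]
      _ ≤ 1 * ENNReal.ofReal a + ENNReal.ofReal a := by gcongr
      _ = _ := by rw [one_mul, ← ENNReal.ofReal_add ha ha, two_mul]
  calc _ ≤ (ENNReal.ofReal b)⁻¹ * ENNReal.ofReal (2 * a) :=
        mul_le_mul' (ENNReal.inv_le_inv.mpr hE) h1
    _ = _ := by
        rw [← ENNReal.ofReal_inv_of_pos hb, ← ENNReal.ofReal_mul (by positivity)]
        congr 1; field_simp

/-- A bound on the conditional posterior mass that is common to all models survives mixing, whatever
the weights. -/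
lemma posterior_le_of_forall {g : ℝ → ℝ} {w : ℕ → ℝ} {y : Fin n → Bool} {δ : ℝ≥0∞}
    {S : Set SieveParam} (hS : MeasurableSet S)
    (hk : ∀ k, partialEvidence φ x g k y ((fun θ => ⟨k, θ⟩) ⁻¹' S) ≤
      δ * partialEvidence φ x g k y Set.univ) :
    posterior φ x (hierPrior g w) y S ≤ δ := by
  rw [posterior_hierPrior_apply g w y hS]
  have h1 : ∑' k, ENNReal.ofReal (w k) * partialEvidence φ x g k y ((fun θ => ⟨k, θ⟩) ⁻¹' S) ≤
      δ * evidence φ x (hierPrior g w) y := by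
    rw [evidence_hierPrior, ← ENNReal.tsum_mul_left]
    refine ENNReal.tsum_le_tsum fun k => ?_
    rw [mul_left_comm]
    gcongr
    exact hk k
  calc _ ≤ (evidence φ x (hierPrior g w) y)⁻¹ * (δ * evidence φ x (hierPrior g w) y) := by gcongr
    _ = δ * ((evidence φ x (hierPrior g w) y)⁻¹ * evidence φ x (hierPrior g w) y) := by ring
    _ ≤ δ * 1 := by gcongr; exact ENNReal.inv_mul_le_one _
    _ = δ := mul_one _

/-- The parameters in models of too large dimension or too far from the truth. -/
def badSet (φ : ℕ → unitInterval → ℝ) {n : ℕ} (x : Fin n → unitInterval) (θ₀ : ℕ → ℝ) (N : ℕ)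
    (J : ℝ) : Set SieveParam :=
  {s | s.1 = 0 ∨ N < s.1 ∨ J * oracleDim φ x θ₀ < s.1 ∨
    96 * (J * (oracleDim φ x θ₀ * Real.log n)) / n ≤
      hellinger x (seriesProb φ θ₀) (sieveProb φ s) ^ 2}

lemma measurable_sigma_fst : Measurable fun s : SieveParam => s.1 :=
  measurable_sigma fun _ => measurable_const

lemma measurable_hellinger_left (q : unitInterval → ℝ) :
    Measurable fun s => hellinger x q (sieveProb φ s) := by
  simp only [hellinger_comm q]
  exact measurable_hellinger q

lemma measurableSet_badSet (θ₀ : ℕ → ℝ) (N : ℕ) (J : ℝ) : MeasurableSet (badSet φ x θ₀ N J) := by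
  have h1 := measurable_sigma_fst
  have h2 : Measurable fun s : SieveParam => (s.1 : ℝ) := (measurable_from_top).comp h1
  have h3 : Measurable fun s => hellinger x (seriesProb φ θ₀) (sieveProb φ s) ^ 2 :=
    (measurable_hellinger_left _).pow_const 2
  have heq : badSet φ x θ₀ N J = {s | s.1 = 0} ∪ ({s | N < s.1} ∪
      ({s | J * oracleDim φ x θ₀ < s.1} ∪ {s | 96 * (J * (oracleDim φ x θ₀ * Real.log n)) / n ≤
        hellinger x (seriesProb φ θ₀) (sieveProb φ s) ^ 2})) := rfl
  rw [heq]
  exact (measurableSet_eq_fun h1 measurable_const).union ((measurableSet_lt measurable_const h1).union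
    ((measurableSet_lt measurable_const h2).union (measurableSet_le measurable_const h3)))

/-- Within Θ(k) the bad set splits into large coefficients, parameters far from the truth, and
parameters near it. For k ≤ J k_n the near part is absent, because the bad radius already exceeds
the threshold 96 k log n / n. For k > J k_n the near part is at most n^{-k/16}, and J ≥ 16(C₂ + 3)
makes this smaller than exp(-(C₂+3) k_n log n). The surplus 3 over the evidence exponent C₂ yields 6
n^{-3} ≤ 1/n. -/
lemma GoodData.posterior_badSet_le {g : ℝ → ℝ} (hg : IsSieveDensity g) {θ₀ : ℕ → ℝ} {N : ℕ}
    {C₁ T : ℝ} {w v : ℕ → ℝ} {y : Fin n → Bool} (hy : GoodData φ x g θ₀ N C₁ T v y)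
    (hw : ∑' k, ENNReal.ofReal (w k) ≤ 1)
    (hw0 : w 0 = 0) (hwv : ∀ k, N < k → w k ≤ v k) (hn : 3 ≤ n) {C₂ J : ℝ} (hC₂ : 0 ≤ C₂)
    (hE : ENNReal.ofReal (Real.exp (-(C₂ * (oracleDim φ x θ₀ * Real.log n))) *
      likelihood x (seriesProb φ θ₀) y) ≤ evidence φ x (hierPrior g w) y)
    (hT : (C₂ + 3) * (oracleDim φ x θ₀ * Real.log n) ≤ T) (hJ : 16 * (C₂ + 3) ≤ J) :
    posterior φ x (hierPrior g w) y (badSet φ x θ₀ N J) ≤ ENNReal.ofReal (1 / n) := by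
  have hn' : (3 : ℝ) ≤ n := by exact_mod_cast hn
  have hlog : 1 ≤ Real.log n := by
    rw [Real.le_log_iff_exp_le (by linarith)]
    linarith [Real.exp_one_lt_d9]
  have hk1 := (oracleDim_spec (φ := φ) (x := x) θ₀ (by omega)).1
  set κ := oracleDim φ x θ₀ * Real.log n with hκ
  have hk1' : (1 : ℝ) ≤ oracleDim φ x θ₀ := by exact_mod_cast hk1
  have hκlog : Real.log n ≤ κ := by nlinarith
  set L₀ := likelihood x (seriesProb φ θ₀) y with hL₀
  have hL0 : 0 < L₀ := likelihood_sigmoid_pos _ y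
  have hpiece : ∀ k ∈ Finset.Icc 1 N,
      partialEvidence φ x g k y ((fun θ => ⟨k, θ⟩) ⁻¹' badSet φ x θ₀ N J) ≤
      ENNReal.ofReal (3 * (Real.exp (-((C₂ + 3) * κ)) * L₀)) := by
    intro k hk
    have hk' := Finset.mem_Icc.mp hk
    set a := ENNReal.ofReal (Real.exp (-((C₂ + 3) * κ)) * L₀) with ha
    have h1 : partialEvidence φ x g k y {θ | ¬ ∀ j, |θ j| ≤ n} ≤ a := by
      refine (hy.outer k hk).trans (ENNReal.ofReal_le_ofReal ?_)
      gcongr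
    set F := {θ : Fin k → ℝ | (∀ j, |θ j| ≤ n) ∧ 96 * (J * κ) / n ≤
        hellinger x (seriesProb φ θ₀) (sieveProb φ ⟨k, θ⟩) ^ 2 ∧ 4 * (24 * (k * Real.log n / n)) ≤
        hellinger x (seriesProb φ θ₀) (sieveProb φ ⟨k, θ⟩) ^ 2} with hF
    have h2 : partialEvidence φ x g k y F ≤ a := by
      refine partialEvidence_le hg k y fun θ hθ => (hy.ratio k hk θ hθ.1 hθ.2.2).trans ?_
      refine mul_le_mul_of_nonneg_right (Real.exp_le_exp.mpr ?_) hL0.le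
      have e1 := hθ.2.1
      rw [div_le_iff₀ (by linarith)] at e1
      nlinarith
    by_cases hkJ : J * oracleDim φ x θ₀ < k
    · have h3 : partialEvidence φ x g k y {θ | hellinger x (seriesProb φ θ₀) (sieveProb φ ⟨k, θ⟩) ^ 2 <
          4 * (24 * (k * Real.log n / n))} ≤ a := by
        refine (hy.near k hk).trans (ENNReal.ofReal_le_ofReal ?_)
        refine mul_le_mul_of_nonneg_right (Real.exp_le_exp.mpr ?_) hL0.le
        have e1 : J * κ ≤ k * Real.log n := by
          rw [hκ, ← mul_assoc]
          gcongr
        nlinarith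
      have hsub : ((fun θ => ⟨k, θ⟩) ⁻¹' badSet φ x θ₀ N J) ⊆ ({θ : Fin k → ℝ | ¬ ∀ j, |θ j| ≤ n} ∪ F)
          ∪ {θ | hellinger x (seriesProb φ θ₀) (sieveProb φ ⟨k, θ⟩) ^ 2 <
          4 * (24 * (k * Real.log n / n))} := by
        intro θ _
        by_cases e1 : ∀ j, |θ j| ≤ n
        · by_cases e2 : 4 * (24 * (k * Real.log n / n)) ≤
            hellinger x (seriesProb φ θ₀) (sieveProb φ ⟨k, θ⟩) ^ 2
          · refine Or.inl (Or.inr ⟨e1, le_trans ?_ e2, e2⟩)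
            have e3 : J * κ ≤ k * Real.log n := by
              rw [hκ, ← mul_assoc]
              gcongr
            have e4 : 4 * (24 * (k * Real.log n / n)) = 96 * (k * Real.log n) / n := by ring
            rw [e4]
            gcongr
          · exact Or.inr (not_le.mp e2)
        · exact Or.inl (Or.inl e1)
      calc _ ≤ _ := partialEvidence_mono g k y hsub
        _ ≤ (a + a) + a := (partialEvidence_union_le g k y _ _).trans
            (add_le_add ((partialEvidence_union_le g k y _ _).trans (add_le_add h1 h2)) h3)
        _ = _ := by
            rw [ENNReal.ofReal_mul (by norm_num), ← ha, ENNReal.ofReal_ofNat]; ring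
    · have hsub : ((fun θ => ⟨k, θ⟩) ⁻¹' badSet φ x θ₀ N J) ⊆
          {θ : Fin k → ℝ | ¬ ∀ j, |θ j| ≤ n} ∪ F := by
        intro θ hθ
        by_cases e1 : ∀ j, |θ j| ≤ n
        · rcases hθ with h | h | h | h
          · simp only at h; omega
          · simp only at h; omega
          · exact absurd h hkJ
          · refine Or.inr ⟨e1, h, le_trans ?_ h⟩
            have e3 : k * Real.log n ≤ J * κ := by
              rw [hκ, ← mul_assoc]
              have := not_lt.mp hkJ
              gcongr
            have e4 : 4 * (24 * (k * Real.log n / n)) = 96 * (k * Real.log n) / n := by ring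
            rw [e4]
            gcongr
        · exact Or.inl e1
      calc _ ≤ _ := partialEvidence_mono g k y hsub
        _ ≤ a + a := (partialEvidence_union_le g k y _ _).trans (add_le_add h1 h2)
        _ ≤ a + a + a := le_self_add
        _ = _ := by
            rw [ENNReal.ofReal_mul (by norm_num), ← ha, ENNReal.ofReal_ofNat]; ring
  have hmain := posterior_le hw hw0 hwv (a := 3 * (Real.exp (-((C₂ + 3) * κ)) * L₀)) (by positivity)
    (by positivity) hE (measurableSet_badSet θ₀ N J) hpiece
    (hy.tail.trans (ENNReal.ofReal_le_ofReal ?_))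
  · refine hmain.trans (ENNReal.ofReal_le_ofReal ?_)
    have e1 : 2 * (3 * (Real.exp (-((C₂ + 3) * κ)) * L₀)) / (Real.exp (-(C₂ * κ)) * L₀) =
        6 * Real.exp (-(3 * κ)) := by
      have : Real.exp (-((C₂ + 3) * κ)) = Real.exp (-(C₂ * κ)) * Real.exp (-(3 * κ)) := by
        rw [← Real.exp_add]; ring_nf
      rw [this]; field_simp; norm_num
    rw [e1]
    have e2 : Real.exp (-(3 * κ)) ≤ 1 / (n : ℝ) ^ 3 := by
      have : 1 / (n : ℝ) ^ 3 = Real.exp (-(3 * Real.log n)) := by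
        rw [Real.exp_neg, one_div, ← Real.exp_log (show (0 : ℝ) < n by linarith),
          ← Real.exp_nat_mul, Real.log_exp]
        push_cast; rfl
      rw [this, Real.exp_le_exp]
      linarith
    calc 6 * Real.exp (-(3 * κ)) ≤ 6 * (1 / (n : ℝ) ^ 3) := by gcongr
      _ ≤ 1 / n := by
        rw [mul_one_div, div_le_div_iff₀ (by positivity) (by positivity)]
        have : (3 : ℝ) ^ 2 * n ≤ n ^ 2 * n := by gcongr
        nlinarith
  · have : Real.exp (-T) ≤ Real.exp (-((C₂ + 3) * κ)) := Real.exp_le_exp.mpr (by linarith)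
    have h2 : Real.exp (-T) * L₀ ≤ Real.exp (-((C₂ + 3) * κ)) * L₀ := by gcongr
    have h3 : 0 ≤ Real.exp (-((C₂ + 3) * κ)) * L₀ := by positivity
    linarith

end


section

/-! ### The marginal likelihood of small balls -/

variable {n : ℕ} {x : Fin n → unitInterval} {φ : ℕ → unitInterval → ℝ}

/-- The Euclidean ball centered at the origin. -/
def l2Ball (k : ℕ) (ρ : ℝ) : Set (Fin k → ℝ) := {u | l2 u ≤ ρ}

lemma isClosed_l2Ball (k : ℕ) (ρ : ℝ) : IsClosed (l2Ball k ρ) :=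
  isClosed_le continuous_l2 continuous_const

lemma volume_l2Ball_ne_top (k : ℕ) (ρ : ℝ) : volume (l2Ball k ρ) ≠ ∞ := by
  refine ne_top_of_le_ne_top (measure_closedBall_lt_top (x := (0 : Fin k → ℝ)) (r := |ρ|)).ne
    (measure_mono fun u hu => ?_)
  rw [Metric.mem_closedBall, dist_zero_right, pi_norm_le_iff_of_nonneg (abs_nonneg _)]
  exact fun j => (abs_le_l2 u j).trans ((show l2 u ≤ ρ from hu).trans (le_abs_self _))

lemma volume_l2Ball_ne_zero (k : ℕ) {ρ : ℝ} (hρ : 0 < ρ) : volume (l2Ball k ρ) ≠ 0 := by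
  have ho : IsOpen {u : Fin k → ℝ | l2 u < ρ} := isOpen_lt continuous_l2 continuous_const
  have hne : {u : Fin k → ℝ | l2 u < ρ}.Nonempty := ⟨0, by simpa [l2] using hρ⟩
  have h1 := (ho.measure_pos volume hne).ne'
  have hsub : {u : Fin k → ℝ | l2 u < ρ} ⊆ l2Ball k ρ := fun u hu =>
    show l2 u ≤ ρ from (show l2 u < ρ from hu).le
  exact fun h => h1 (measure_mono_null hsub h)

lemma volume_l2Ball_scale (k : ℕ) {ρ₁ ρ₂ : ℝ} (h₁ : 0 < ρ₁) (h₂ : 0 < ρ₂) :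
    volume (l2Ball k ρ₁) = ENNReal.ofReal (ρ₁ / ρ₂) ^ k * volume (l2Ball k ρ₂) := by
  have hr : 0 < ρ₁ / ρ₂ := by positivity
  have h : l2Ball k ρ₁ = (fun u => (ρ₁ / ρ₂)⁻¹ • u) ⁻¹' l2Ball k ρ₂ := by
    ext u
    simp only [l2Ball, Set.mem_preimage, Set.mem_ofPred_eq, l2_smul]
    rw [abs_of_pos (inv_pos.mpr hr), inv_mul_le_iff₀ hr, div_mul_cancel₀ _ h₂.ne']
  rw [h, Measure.addHaar_preimage_smul _ (inv_ne_zero hr.ne'), Module.finrank_fin_fun, inv_pow,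
    inv_inv, abs_of_pos (pow_pos hr k), ENNReal.ofReal_pow hr.le]

/-- For θ in S, the average of the likelihood over the ball U of radius √(k/n) around θ is at least
e^{-C₀k/4} times the likelihood at θ, since the upper design inequality bounds the sum of squared
logit shifts by C₀k. These balls stay in a box where the prior density is at least c₂^k, so the
evidence of the whole model controls the likelihood at every θ in S. The prior mass of S is smaller
than the volume of U by (ρ/√(k/n))^k, up to G^k. -/
lemma partialEvidence_small_ball_le {C₀ : ℝ} (hC₀ : 0 < C₀) {K k : ℕ} (hkK : k ≤ K)
    (hdes : DesignCondition φ x C₀ K) (hn : 1 ≤ n) (hk : 1 ≤ k) (hkn : k ≤ n) {g : ℝ → ℝ} {G c₂ R : ℝ}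
    (hG : ∀ t, g t ≤ G) (hc₂ : 0 < c₂) (hc : ∀ t, |t| ≤ R → c₂ ≤ g t)
    {S : Set (Fin k → ℝ)} (hS : MeasurableSet S) (θ₁ : Fin k → ℝ) {ρ : ℝ} (hρ : 0 < ρ)
    (hSρ : ∀ θ ∈ S, l2 (θ - θ₁) ≤ ρ) (hR : ∀ j, |θ₁ j| + ρ + 1 ≤ R) (y : Fin n → Bool) :
    partialEvidence φ x g k y S ≤
      ENNReal.ofReal ((Real.exp (C₀ / 4) * G / c₂ * (ρ / √(k / n))) ^ k) *
        partialEvidence φ x g k y Set.univ := by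
  have hn' : (0 : ℝ) < n := by exact_mod_cast hn
  have hk' : (0 : ℝ) < k := by exact_mod_cast hk
  set σ := √((k : ℝ) / n) with hσ
  have hσ0 : 0 < σ := Real.sqrt_pos.mpr (by positivity)
  have hσ1 : σ ≤ 1 := Real.sqrt_le_one.mpr (by
    rw [div_le_one hn']; exact_mod_cast hkn)
  have hG0 : 0 < G := lt_of_lt_of_le hc₂ ((hc 0 (by
    rw [abs_zero]
    have := hR ⟨0, hk⟩
    have := abs_nonneg (θ₁ ⟨0, hk⟩)
    linarith)).trans (hG 0))
  set U := l2Ball k σ with hU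
  have hUm : MeasurableSet U := (isClosed_l2Ball k σ).measurableSet
  set ℓ : (Fin k → ℝ) → ℝ≥0∞ := fun θ => ENNReal.ofReal (likelihood x (sieveProb φ ⟨k, θ⟩) y) with hℓ
  have hℓm : Measurable ℓ :=
    ((measurable_likelihood y).comp (measurable_sigma_mk k)).ennreal_ofReal
  set E := ENNReal.ofReal (Real.exp (-(C₀ * k / 4))) with hE
  set p := partialEvidence φ x g k y Set.univ with hp
  -- symmetrisation
  have hsymm : ∀ θ, E * ℓ θ * volume U ≤ ∫⁻ u in U, ℓ (θ + u) := by
    intro θ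
    have h1 : ∀ u ∈ U, 2 * (E * ℓ θ) ≤ ℓ (θ + u) + ℓ (θ - u) := by
      intro u hu
      have hsum : ∑ i, sieveFun φ u (x i) ^ 2 ≤ C₀ * k := by
        have e1 := (hdes k hkK u).2
        have e2 : ∑ j, u j ^ 2 ≤ k / n := by
          rw [← l2_sq, ← Real.sq_sqrt (show (0 : ℝ) ≤ k / n by positivity)]
          exact pow_le_pow_left₀ (l2_nonneg u) hu 2
        rw [one_div, inv_mul_le_iff₀ hn'] at e1
        calc _ ≤ n * (C₀ * ∑ j, u j ^ 2) := e1
          _ ≤ n * (C₀ * (k / n)) := by gcongr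
          _ = _ := by field_simp
      have e3 := likelihood_le_average (x := x) (sieveFun φ θ) (sieveFun φ u) y hsum
      have e4 : (fun t => Real.sigmoid (sieveFun φ θ t + sieveFun φ u t)) =
          sieveProb φ ⟨k, θ + u⟩ := by
        rw [sieveProb_eq]; ext t; rw [sieveFun_add]
      have e5 : (fun t => Real.sigmoid (sieveFun φ θ t - sieveFun φ u t)) =
          sieveProb φ ⟨k, θ - u⟩ := by
        rw [sieveProb_eq]; ext t; rw [sieveFun_sub]
      rw [e4, e5, ← sieveProb_eq] at e3
      rw [hE, hℓ, ← ENNReal.ofReal_mul (Real.exp_pos _).le, ← ENNReal.ofReal_ofNat 2,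
        ← ENNReal.ofReal_mul (by norm_num), ← ENNReal.ofReal_add
        (likelihood_nonneg (sieveProb_mem_Icc φ _) y) (likelihood_nonneg (sieveProb_mem_Icc φ _) y)]
      exact ENNReal.ofReal_le_ofReal e3
    -- The ball U is symmetric, so the two halves of the average have equal integrals.
    have h2 : ∫⁻ u in U, ℓ (θ - u) = ∫⁻ u in U, ℓ (θ + u) := by
      have hneg := (Measure.measurePreserving_neg (volume : Measure (Fin k → ℝ))).setLIntegral_comp_preimage
        hUm (f := fun u => ℓ (θ - u)) (by fun_prop)
      rw [← hneg]
      have : (Neg.neg ⁻¹' U : Set (Fin k → ℝ)) = U := by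
        ext u; simp [hU, l2Ball, l2_neg]
      rw [this]
      simp
    have h3 : 2 * (E * ℓ θ * volume U) ≤ 2 * ∫⁻ u in U, ℓ (θ + u) := by
      calc 2 * (E * ℓ θ * volume U) = ∫⁻ _u in U, 2 * (E * ℓ θ) := by
            rw [setLIntegral_const]; ring
        _ ≤ ∫⁻ u in U, (ℓ (θ + u) + ℓ (θ - u)) := setLIntegral_mono' hUm h1
        _ = _ := by
            rw [lintegral_add_left (by fun_prop), h2, two_mul]
    exact (ENNReal.mul_le_mul_iff_right (by norm_num) (by norm_num)).mp h3
  -- comparison with the prior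
  have hcomp : ∀ θ ∈ S, ENNReal.ofReal c₂ ^ k * ∫⁻ u in U, ℓ (θ + u) ≤ p := by
    intro θ hθ
    set box : Set (Fin k → ℝ) := Set.univ.pi fun _ => Set.Icc (-R) R with hbox
    have hboxm : MeasurableSet box := MeasurableSet.univ_pi fun _ => measurableSet_Icc
    have h1 : ∫⁻ u in U, ℓ (θ + u) ≤ ∫⁻ v in box, ℓ v := by
      rw [← (measurePreserving_add_left volume θ).setLIntegral_comp_preimage hboxm hℓm]
      refine lintegral_mono_set fun u hu j _ => ?_
      have e1 := abs_le_l2 (θ - θ₁) j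
      have e2 := hSρ θ hθ
      have e3 := (abs_le_l2 u j).trans ((show l2 u ≤ σ from hu).trans hσ1)
      have e4 := hR j
      have e5 : (θ + u) j = (θ - θ₁) j + (θ₁ j + u j) := by
        simp only [Pi.add_apply, Pi.sub_apply]; ring
      have e6 := abs_add_le ((θ - θ₁) j) (θ₁ j + u j)
      have e7 := abs_add_le (θ₁ j) (u j)
      rw [← e5] at e6
      exact abs_le.mp (by linarith)
    calc ENNReal.ofReal c₂ ^ k * ∫⁻ u in U, ℓ (θ + u)
        ≤ ENNReal.ofReal c₂ ^ k * ∫⁻ v in box, ℓ v := by gcongr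
      _ = ∫⁻ v, ℓ v ∂(ENNReal.ofReal c₂ ^ k • volume.restrict box) := by
          rw [lintegral_smul_measure, smul_eq_mul]
      _ ≤ ∫⁻ v, ℓ v ∂(coordPrior g k) := lintegral_mono' (le_coordPrior hc k) le_rfl
      _ = p := by rw [hp, partialEvidence, Measure.restrict_univ]
  set V := volume U with hV
  have hV0 : V ≠ 0 := volume_l2Ball_ne_zero k hσ0
  have hVt : V ≠ ∞ := volume_l2Ball_ne_top k σ
  have hprior : coordPrior g k S ≤ ENNReal.ofReal G ^ k * (ENNReal.ofReal (ρ / σ) ^ k * V) := by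
    refine (coordPrior_le hG k S).trans ?_
    rw [Measure.smul_apply, smul_eq_mul, hV, hU, ← volume_l2Ball_scale k hρ hσ0]
    refine mul_le_mul_right ?_ _
    calc volume S ≤ volume ((fun θ => θ - θ₁) ⁻¹' l2Ball k ρ) := measure_mono hSρ
      _ = _ := (measurePreserving_sub_right volume θ₁).measure_preimage
          (isClosed_l2Ball k ρ).measurableSet.nullMeasurableSet
  set c' := ENNReal.ofReal c₂ ^ k * E with hc'
  -- Integrating the pointwise bound over S against the prior. The volume V of U appears on both
  -- sides and cancels, so only the scaling of Euclidean balls is used, not their volume.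
  have hmain : V * (c' * partialEvidence φ x g k y S) ≤
      V * (ENNReal.ofReal G ^ k * ENNReal.ofReal (ρ / σ) ^ k * p) := by
    calc V * (c' * partialEvidence φ x g k y S) = ∫⁻ θ in S, V * c' * ℓ θ ∂coordPrior g k := by
          rw [lintegral_const_mul _ hℓm, partialEvidence, ← mul_assoc]
      _ ≤ ∫⁻ _θ in S, p ∂coordPrior g k := by
          refine setLIntegral_mono' hS fun θ hθ => ?_
          refine le_trans (le_of_eq ?_) ((mul_le_mul_right (hsymm θ) _).trans (hcomp θ hθ))
          rw [hc']; ring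
      _ = p * coordPrior g k S := setLIntegral_const _ _
      _ ≤ p * (ENNReal.ofReal G ^ k * (ENNReal.ofReal (ρ / σ) ^ k * V)) := by gcongr
      _ = _ := by ring
  have hmain' := (ENNReal.mul_le_mul_iff_right hV0 hVt).mp hmain
  have hcr : c' = ENNReal.ofReal (c₂ ^ k * Real.exp (-(C₀ * k / 4))) := by
    rw [hc', hE, ENNReal.ofReal_mul (by positivity), ENNReal.ofReal_pow hc₂.le]
  set z := c₂ ^ k * Real.exp (-(C₀ * k / 4)) with hz
  have hz0 : 0 < z := by positivity
  have hfin : partialEvidence φ x g k y S = ENNReal.ofReal z⁻¹ * (c' * partialEvidence φ x g k y S) := by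
    rw [← mul_assoc, hcr, ← ENNReal.ofReal_mul (by positivity), inv_mul_cancel₀ hz0.ne',
      ENNReal.ofReal_one, one_mul]
  rw [hfin]
  refine (mul_le_mul_right hmain' _).trans (le_of_eq ?_)
  rw [← mul_assoc, ← mul_assoc, ← ENNReal.ofReal_pow hG0.le, ← ENNReal.ofReal_pow (by positivity),
    ← ENNReal.ofReal_mul (by positivity), ← ENNReal.ofReal_mul (by positivity)]
  congr 2
  have e1 : Real.exp (C₀ / 4) ^ k * Real.exp (-(C₀ * k / 4)) = 1 := by
    rw [← Real.exp_nat_mul, ← Real.exp_add, ← Real.exp_zero]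
    congr 1; ring
  rw [hz, mul_pow, div_pow, div_pow, mul_pow]
  have hexp := Real.exp_pos (-(C₀ * k / 4))
  field_simp
  linear_combination (-1 : ℝ) * e1

end


section

/-! ### The oracle rate over Sobolev balls -/

variable {φ : ℕ → unitInterval → ℝ}

lemma tendsto_natCast_rpow {a : ℝ} (ha : 0 < a) :
    Tendsto (fun n : ℕ => (n : ℝ) ^ a) atTop atTop :=
  (tendsto_rpow_atTop ha).comp tendsto_natCast_atTop_atTop

lemma tendsto_log_natCast : Tendsto (fun n : ℕ => Real.log n) atTop atTop :=
  Real.tendsto_log_atTop.comp tendsto_natCast_atTop_atTop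

lemma eventually_mul_log_le_rpow (C : ℝ) {a : ℝ} (ha : 0 < a) :
    ∀ᶠ n : ℕ in atTop, C * Real.log n ≤ (n : ℝ) ^ a := by
  have h := (isLittleO_log_rpow_atTop ha).comp_tendsto tendsto_natCast_atTop_atTop
  have h2 := h.def (show (0 : ℝ) < 1 / (|C| + 1) by positivity)
  filter_upwards [h2, eventually_ge_atTop 1] with n hn hn1
  have hn1' : (1 : ℝ) ≤ n := by exact_mod_cast hn1
  simp only [Function.comp_apply, Real.norm_eq_abs] at hn
  rw [abs_of_nonneg (Real.log_nonneg hn1'), abs_of_nonneg (show 0 ≤ (n : ℝ) ^ a by positivity), one_div,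
    le_inv_mul_iff₀ (by positivity)] at hn
  have := le_abs_self C
  nlinarith [Real.log_nonneg hn1']

/-- The squared ℓ¹-tail beyond K is of order K^{1-2β₀}, and K ≫ n^{1/(2β₀-1)} makes it smaller than
any multiple of 1/n. -/
lemma tail_eventually_le {B β₀ L₀ : ℝ} (hB : 0 ≤ B) (hβ₀ : 1 / 2 < β₀) (hL₀ : 0 < L₀) {K : ℕ → ℕ}
    (hK : Tendsto (fun n : ℕ => (K n : ℝ) / (n : ℝ) ^ (1 / (2 * (β₀ - 1 / 2)))) atTop atTop) :
    ∀ᶠ n : ℕ in atTop, ∀ θ₀ ∈ sobolevBall β₀ L₀, B * ∑' j, |θ₀ (j + K n)| ≤ 1 / √n := by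
  set a := 2 * (β₀ - 1 / 2) with ha
  have ha0 : 0 < a := by linarith
  set Q := B ^ 2 * (L₀ / (2 * β₀ - 1)) with hQ
  have hQ0 : 0 ≤ Q := by
    have : 0 < 2 * β₀ - 1 := by linarith
    positivity
  filter_upwards [hK.eventually_ge_atTop ((Q + 1) ^ (1 / a)), eventually_ge_atTop 1] with n hn hn1
  intro θ₀ hθ₀
  have hn1' : (0 : ℝ) < n := by exact_mod_cast hn1
  have hnp : (0 : ℝ) < (n : ℝ) ^ (1 / a) := by positivity
  rw [le_div_iff₀ hnp, ← Real.mul_rpow (by positivity) hn1'.le] at hn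
  have hKpos : (0 : ℝ) < K n := lt_of_lt_of_le (by positivity) hn
  have hK1 : 1 ≤ K n := by exact_mod_cast hKpos
  have h1 := sobolevBall_tail_le hβ₀ hθ₀ hK1
  have h2 : (Q + 1) * n ≤ (K n : ℝ) ^ a := by
    calc (Q + 1) * n = (((Q + 1) * n) ^ (1 / a)) ^ a := by
          rw [← Real.rpow_mul (by positivity), one_div_mul_cancel ha0.ne', Real.rpow_one]
      _ ≤ _ := Real.rpow_le_rpow (by positivity) hn ha0.le
  refine (mul_le_mul_of_nonneg_left h1 hB).trans ?_
  rw [← Real.sqrt_sq hB, ← Real.sqrt_mul (sq_nonneg B), one_div, ← Real.sqrt_inv]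
  refine Real.sqrt_le_sqrt ?_
  rw [← mul_assoc, ← hQ, show 1 - 2 * β₀ = -a by rw [ha]; ring, Real.rpow_neg hKpos.le,
    ← div_eq_mul_inv, div_le_iff₀ (by positivity), le_inv_mul_iff₀ hn1']
  nlinarith

/-- The oracle dimension and the oracle rate, uniformly over the Sobolev balls. -/
lemma exists_oracle_bounds {x : (n : ℕ) → Fin n → unitInterval} {B : ℝ}
    (hφ : ∀ j t, |φ j t| ≤ B) {C₀ : ℝ} (hC₀ : 0 < C₀) {K : ℕ → ℕ}
    (hdesign : ∀ n : ℕ, 1 ≤ n → DesignCondition φ (x n) C₀ (K n))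
    {β₀ L₀ : ℝ} (hβ₀ : 1 / 2 < β₀) (hL₀ : 0 < L₀)
    (hK : Tendsto (fun n : ℕ => (K n : ℝ) / (n : ℝ) ^ (1 / (2 * (β₀ - 1 / 2)))) atTop atTop)
    (htail : ∀ᶠ n : ℕ in atTop, ∀ θ₀ ∈ sobolevBall β₀ L₀, B * ∑' j, |θ₀ (j + K n)| ≤ 1 / √n) :
    ∃ D : ℝ, 1 ≤ D ∧ ∀ᶠ n : ℕ in atTop, ∀ β ≥ β₀, ∀ θ₀ ∈ sobolevBall β L₀,
      oracleDim φ (x n) θ₀ ≤ D * ((n : ℝ) / Real.log n) ^ (1 / (1 + 2 * β)) ∧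
      oracleRate φ (x n) θ₀ ≤ √(2 * D) * ((n : ℝ) / Real.log n) ^ (-(β / (1 + 2 * β))) := by
  -- With t = 1/√n in `bias_le_of_sobolev`, the Sobolev term accounts for 4C₀L₀ and the term 4t² for
  -- 4. The constant does not depend on β.
  set D := 4 * C₀ * L₀ + 5 with hD
  have hD1 : 1 ≤ D := by
    have : 0 < C₀ * L₀ := by positivity
    rw [hD]; nlinarith
  have hp : 1 / (1 + 2 * β₀) < 1 / (2 * (β₀ - 1 / 2)) := by
    apply one_div_lt_one_div_of_lt <;> linarith
  have hKbig : ∀ᶠ n : ℕ in atTop, (D + 1) * (n : ℝ) ^ (1 / (1 + 2 * β₀)) ≤ K n := by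
    filter_upwards [hK.eventually_ge_atTop (D + 1), eventually_ge_atTop 1] with n hn hn1
    have hn1' : (1 : ℝ) ≤ n := by exact_mod_cast hn1
    rw [le_div_iff₀ (by positivity)] at hn
    refine le_trans ?_ hn
    gcongr
  refine ⟨D + 1, by linarith, ?_⟩
  filter_upwards [hKbig, htail, eventually_ge_atTop 3] with n hnK hnt hn3 β hβ θ₀ hθ₀
  have hn' : (3 : ℝ) ≤ n := by exact_mod_cast hn3
  have hn0 : (0 : ℝ) < n := by linarith
  have hlog : 1 ≤ Real.log n := by
    rw [Real.le_log_iff_exp_le (by linarith)]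
    linarith [Real.exp_one_lt_d9]
  have hβ' : 1 / 2 < β := lt_of_lt_of_le hβ₀ hβ
  set ℓ := (n : ℝ) / Real.log n with hℓ
  have hℓ1 : 1 ≤ ℓ := by
    rw [hℓ, one_le_div (by linarith)]
    linarith [Real.log_le_sub_one_of_pos hn0]
  have hℓn : ℓ ≤ n := div_le_self hn0.le hlog
  have hℓ0 : 0 < ℓ := by linarith
  set m := ℓ ^ (1 / (1 + 2 * β)) with hm
  have hm1 : 1 ≤ m := Real.one_le_rpow hℓ1 (by positivity)
  -- The choice of m balances the squared bias m^{-2β} against the complexity m log n / n.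
  have hm2β : m ^ (-(2 * β)) = m * (Real.log n / n) := by
    have e1 : Real.log n / n = ℓ⁻¹ := by rw [hℓ, inv_div]
    have e2 : ℓ = m ^ (1 + 2 * β) := by
      rw [hm, ← Real.rpow_mul hℓ0.le, one_div_mul_cancel (by linarith), Real.rpow_one]
    rw [e1, e2, ← Real.rpow_neg (by positivity)]
    nth_rewrite 2 [← Real.rpow_one m]
    rw [← Real.rpow_add (by positivity)]
    congr 1; ring
  have hmβ : m ^ (-β) = ℓ ^ (-(β / (1 + 2 * β))) := by
    rw [hm, ← Real.rpow_mul hℓ0.le]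
    congr 1; ring
  set k := ⌈D * m⌉₊ with hk
  have hk1 : D * m ≤ k := Nat.le_ceil _
  have hk2 : (k : ℝ) ≤ (D + 1) * m := by
    have := Nat.ceil_lt_add_one (show 0 ≤ D * m by positivity)
    rw [← hk] at this
    linarith
  have hk1' : 1 ≤ k := by
    have : (1 : ℝ) ≤ k := by nlinarith
    exact_mod_cast this
  have hkK : k ≤ K n := by
    have : (k : ℝ) ≤ K n := by
      refine hk2.trans (le_trans ?_ hnK)
      gcongr
      rw [hm]
      calc ℓ ^ (1 / (1 + 2 * β)) ≤ (n : ℝ) ^ (1 / (1 + 2 * β)) := by gcongr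
        _ ≤ _ := Real.rpow_le_rpow_of_exponent_le (by linarith)
          (one_div_le_one_div_of_le (by linarith) (by linarith))
    exact_mod_cast this
  have hb := bias_le_of_sobolev (x := x n) hφ hC₀ (hdesign n (by omega)) hβ' hθ₀
    (hnt θ₀ (sobolevBall_subset hβ hθ₀)) hk1' hkK
  have hbk : bias φ (x n) θ₀ k ≤ k * Real.log n / n := by
    have e1 : (k : ℝ) ^ (-(2 * β)) ≤ m ^ (-(2 * β)) := by
      refine Real.rpow_le_rpow_of_nonpos (by positivity) ?_ (by linarith)
      nlinarith
    have e2 : (1 / √(n : ℝ)) ^ 2 = 1 / n := by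
      rw [div_pow, Real.sq_sqrt hn0.le, one_pow]
    rw [e2] at hb
    have e3 : 1 / (n : ℝ) ≤ m * (Real.log n / n) := by
      rw [← mul_div_assoc]
      gcongr
      nlinarith
    have e4 : 0 < m * (Real.log n / n) := by positivity
    have e5 : (4 * C₀ * L₀ + 4) * (m * (Real.log n / n)) ≤ k * Real.log n / n := by
      rw [mul_div_assoc]
      calc (4 * C₀ * L₀ + 4) * (m * (Real.log n / n)) ≤ D * m * (Real.log n / n) := by
            rw [hD]; nlinarith
        _ ≤ _ := by gcongr
    have e6 : 4 * C₀ * L₀ * (k : ℝ) ^ (-(2 * β)) ≤ 4 * C₀ * L₀ * (m * (Real.log n / n)) := by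
      rw [← hm2β]; gcongr
    linarith
  have hdim : (oracleDim φ (x n) θ₀ : ℝ) ≤ (D + 1) * m := by
    refine le_trans ?_ hk2
    exact_mod_cast oracleDim_le hk1' hbk
  refine ⟨hdim, ?_⟩
  have hspec := (oracleDim_spec (φ := φ) (x := x n) θ₀ (by omega)).2
  rw [← hmβ, oracleRate]
  refine Real.sqrt_le_iff.mpr ⟨by positivity, ?_⟩
  rw [mul_pow, Real.sq_sqrt (by positivity), rpow_sq_eq (by positivity), mul_neg, hm2β]
  have e1 : (oracleDim φ (x n) θ₀ : ℝ) * Real.log n / n ≤ (D + 1) * m * (Real.log n / n) := by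
    rw [mul_div_assoc]; gcongr
  linarith

end


section

/-! ### Posterior concentration, asymptotically -/

/-- The conditions on the design and on the basis. -/
structure RegressionSetup (φ : ℕ → unitInterval → ℝ) (x : (n : ℕ) → Fin n → unitInterval)
    (B C₀ : ℝ) (K : ℕ → ℕ) (β₀ L₀ : ℝ) : Prop where
  bound : ∀ j t, |φ j t| ≤ B
  C₀_pos : 0 < C₀
  design : ∀ n : ℕ, 1 ≤ n → DesignCondition φ (x n) C₀ (K n)
  half_lt : 1 / 2 < β₀
  L₀_pos : 0 < L₀
  tendsto_dim : Tendsto (fun n : ℕ => (K n : ℝ) / (n : ℝ) ^ (1 / (2 * (β₀ - 1 / 2)))) atTop atTop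

/-- The conditions on data-dependent weights `W n y` on the dimension, essentially supported on
`{1, …, N n}`, under which the posterior for the prior `hierPrior g (W n y)` is controlled. -/
structure SieveWeights (φ : ℕ → unitInterval → ℝ) (x : (n : ℕ) → Fin n → unitInterval) (g : ℝ → ℝ)
    (K : ℕ → ℕ) (β₀ : ℝ) (N : ℕ → ℕ) (W : (n : ℕ) → (Fin n → Bool) → ℕ → ℝ) : Prop where
  exists_exponent : ∃ H : ℝ, 0 ≤ H ∧ H < 1 / 2 ∧ ∀ᶠ n : ℕ in atTop, (N n : ℝ) ≤ (n : ℝ) ^ H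
  le_dim : ∀ᶠ n : ℕ in atTop, N n ≤ K n
  floor_le : ∀ᶠ n : ℕ in atTop, ⌊(n : ℝ) ^ (1 / (1 + 2 * β₀))⌋₊ ≤ N n
  zero : ∀ᶠ n : ℕ in atTop, ∀ y, W n y 0 = 0
  tsum_le : ∀ n y, ∑' k, ENNReal.ofReal (W n y k) ≤ 1
  tail : ∃ (a : ℝ) (v : ℕ → ℕ → ℝ) (V : ℕ → ℝ), 1 / (1 + 2 * β₀) < a ∧ a < 1 ∧
    (∀ᶠ n : ℕ in atTop, ∀ y k, N n < k → W n y k ≤ v n k) ∧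
    (∀ n, ∑' k, (if N n < k then ENNReal.ofReal (v n k) else 0) ≤ ENNReal.ofReal (V n)) ∧
    Tendsto (fun n : ℕ => Real.exp ((n : ℝ) ^ a) * V n) atTop (𝓝 0)
  le_evidence : ∃ C : ℝ, 0 ≤ C ∧ ∀ᶠ n : ℕ in atTop, ∀ y, ∀ k ∈ Finset.Icc 1 (N n),
    ENNReal.ofReal (Real.exp (-(C * (k * Real.log n)))) * partialEvidence φ (x n) g k y Set.univ ≤
      evidence φ (x n) (hierPrior g (W n y)) y

variable {φ : ℕ → unitInterval → ℝ} {x : (n : ℕ) → Fin n → unitInterval} {B C₀ β₀ L₀ : ℝ}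
  {K : ℕ → ℕ} {g : ℝ → ℝ} {N : ℕ → ℕ} {W : (n : ℕ) → (Fin n → Bool) → ℕ → ℝ}

lemma RegressionSetup.bound_nonneg (h : RegressionSetup φ x B C₀ K β₀ L₀) : 0 ≤ B :=
  (abs_nonneg _).trans (h.bound 0 0)

lemma RegressionSetup.tail_eventually_le (h : RegressionSetup φ x B C₀ K β₀ L₀) :
    ∀ᶠ n : ℕ in atTop, ∀ θ₀ ∈ sobolevBall β₀ L₀, B * ∑' j, |θ₀ (j + K n)| ≤ 1 / √n :=
  LogisticSieve.tail_eventually_le h.bound_nonneg h.half_lt h.L₀_pos h.tendsto_dim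

lemma RegressionSetup.exists_oracle_bounds (h : RegressionSetup φ x B C₀ K β₀ L₀) :
    ∃ D : ℝ, 1 ≤ D ∧ ∀ᶠ n : ℕ in atTop, ∀ β ≥ β₀, ∀ θ₀ ∈ sobolevBall β L₀,
      oracleDim φ (x n) θ₀ ≤ D * ((n : ℝ) / Real.log n) ^ (1 / (1 + 2 * β)) ∧
      oracleRate φ (x n) θ₀ ≤ √(2 * D) * ((n : ℝ) / Real.log n) ^ (-(β / (1 + 2 * β))) :=
  LogisticSieve.exists_oracle_bounds h.bound h.C₀_pos h.design h.half_lt h.L₀_pos h.tendsto_dim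
    h.tail_eventually_le

/-- The bound must be free of constants, because N is only assumed to be at least the integer part
of this power. The constant D is absorbed by the power of log n in the denominator. -/
lemma RegressionSetup.oracleDim_le_rpow (h : RegressionSetup φ x B C₀ K β₀ L₀) :
    ∀ᶠ n : ℕ in atTop, ∀ θ₀ ∈ sobolevBall β₀ L₀,
      (oracleDim φ (x n) θ₀ : ℝ) ≤ (n : ℝ) ^ (1 / (1 + 2 * β₀)) := by
  obtain ⟨D, hD, hbd⟩ := h.exists_oracle_bounds
  have hp : 0 < 1 / (1 + 2 * β₀) := by have := h.half_lt; positivity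
  filter_upwards [hbd, ((tendsto_rpow_atTop hp).comp tendsto_log_natCast).eventually_ge_atTop D,
    tendsto_log_natCast.eventually_gt_atTop 0] with n hn hlog hlog0 θ₀ hθ₀
  refine (hn β₀ le_rfl θ₀ hθ₀).1.trans ?_
  rw [Function.comp_apply] at hlog
  rw [Real.div_rpow (by positivity) hlog0.le, ← mul_div_assoc, div_le_iff₀ (by positivity),
    mul_comm]
  gcongr

lemma RegressionSetup.oracleDim_le (h : RegressionSetup φ x B C₀ K β₀ L₀)
    (hN : ∀ᶠ n : ℕ in atTop, ⌊(n : ℝ) ^ (1 / (1 + 2 * β₀))⌋₊ ≤ N n) :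
    ∀ᶠ n : ℕ in atTop, ∀ θ₀ ∈ sobolevBall β₀ L₀, oracleDim φ (x n) θ₀ ≤ N n := by
  filter_upwards [hN, h.oracleDim_le_rpow] with n hn hk θ₀ hθ₀
  exact (Nat.le_floor (hk θ₀ hθ₀)).trans hn

lemma RegressionSetup.mul_oracleDim_le_rpow (h : RegressionSetup φ x B C₀ K β₀ L₀) {a : ℝ}
    (ha : 1 / (1 + 2 * β₀) < a) {C : ℝ} (hC : 0 ≤ C) :
    ∀ᶠ n : ℕ in atTop, ∀ θ₀ ∈ sobolevBall β₀ L₀,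
      C * (oracleDim φ (x n) θ₀ * Real.log n) ≤ (n : ℝ) ^ a := by
  filter_upwards [h.oracleDim_le_rpow, eventually_mul_log_le_rpow C (sub_pos.mpr ha),
    eventually_ge_atTop 1] with n hk hlog hn θ₀ hθ₀
  have hn' : (0 : ℝ) < n := by exact_mod_cast hn
  have hln : 0 ≤ Real.log n := Real.log_natCast_nonneg n
  calc C * (oracleDim φ (x n) θ₀ * Real.log n) = oracleDim φ (x n) θ₀ * (C * Real.log n) := by ring
    _ ≤ (n : ℝ) ^ (1 / (1 + 2 * β₀)) * (n : ℝ) ^ (a - 1 / (1 + 2 * β₀)) := by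
        gcongr
        exact hk θ₀ hθ₀
    _ = (n : ℝ) ^ a := by rw [← Real.rpow_add hn']; congr 1; ring

/-- This is where H < 1/2 is used: the radius u satisfies u² ≲ n^{H-1} log n, and the logarithm and
the constants fit into n^{1/2-H}. So C u ≤ n^{-1/4}, and even √N C u tends to zero. -/
lemma eventually_near_radius_le {H : ℝ} (hH0 : 0 ≤ H) (hH : H < 1 / 2)
    (hN : ∀ᶠ n : ℕ in atTop, (N n : ℝ) ≤ (n : ℝ) ^ H) {C : ℝ} (hC : 0 ≤ C) :
    ∀ᶠ n : ℕ in atTop,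
      C * (√(4 * (24 * (N n * Real.log n / n))) + 1 / √n) ≤ (n : ℝ) ^ (-(1 / 4 : ℝ)) ∧
      √(N n) * (C * (√(4 * (24 * (N n * Real.log n / n))) + 1 / √n)) ≤
        (n : ℝ) ^ (-((1 / 2 - H) / 2)) := by
  have ha : 0 < 1 / 2 - H := by linarith
  filter_upwards [hN, eventually_mul_log_le_rpow (400 * C ^ 2) ha, eventually_ge_atTop 3]
    with n hNn hlog hn3
  have hn' : (3 : ℝ) ≤ n := by exact_mod_cast hn3
  have hn0 : (0 : ℝ) < n := by linarith
  have hlog1 : 1 ≤ Real.log n := by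
    rw [Real.le_log_iff_exp_le (by linarith)]
    linarith [Real.exp_one_lt_d9]
  have hpow1 : 1 ≤ (n : ℝ) ^ H := Real.one_le_rpow (by linarith) hH0
  set u := √(4 * (24 * (N n * Real.log n / n))) + 1 / √n with hu
  have hu0 : 0 ≤ u := by positivity
  have hu2 : u ^ 2 ≤ 400 * ((n : ℝ) ^ H * Real.log n / n) := by
    have e1 : √(4 * (24 * (N n * Real.log n / n))) ^ 2 = 4 * (24 * (N n * Real.log n / n)) :=
      Real.sq_sqrt (by positivity)
    have e2 : (1 / √(n : ℝ)) ^ 2 = 1 / n := by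
      rw [div_pow, Real.sq_sqrt hn0.le, one_pow]
    have e3 : u ^ 2 ≤ 2 * (4 * (24 * (N n * Real.log n / n))) + 2 * (1 / n) := by
      rw [← e1, ← e2, hu]
      nlinarith [sq_nonneg (√(4 * (24 * (N n * Real.log n / n))) - 1 / √(n : ℝ))]
    have e4 : N n * Real.log n / n ≤ (n : ℝ) ^ H * Real.log n / n := by gcongr
    have e5 : 1 / (n : ℝ) ≤ (n : ℝ) ^ H * Real.log n / n := by
      gcongr
      nlinarith
    have e6 : 0 < 1 / (n : ℝ) := by positivity
    linarith
  have hCu : (C * u) ^ 2 ≤ (n : ℝ) ^ (-(1 / 2 : ℝ)) := by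
    calc (C * u) ^ 2 = C ^ 2 * u ^ 2 := by ring
      _ ≤ C ^ 2 * (400 * ((n : ℝ) ^ H * Real.log n / n)) := by gcongr
      _ = 400 * C ^ 2 * Real.log n * ((n : ℝ) ^ H / n) := by ring
      _ ≤ (n : ℝ) ^ (1 / 2 - H) * ((n : ℝ) ^ H / n) := by gcongr
      _ = _ := by
        rw [← mul_div_assoc, ← Real.rpow_add hn0, ← Real.rpow_sub_one hn0.ne']
        congr 1; ring
  have h1 : C * u ≤ (n : ℝ) ^ (-(1 / 4 : ℝ)) := by
    refine abs_le_of_sq_le_sq' (hCu.trans_eq ?_) (by positivity) |>.2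
    rw [← Real.rpow_mul_natCast hn0.le]
    congr 1; norm_num
  refine ⟨h1, ?_⟩
  calc √(N n) * (C * u) ≤ √((n : ℝ) ^ H) * (n : ℝ) ^ (-(1 / 4 : ℝ)) := by gcongr
    _ = _ := by
      rw [Real.sqrt_eq_rpow, ← Real.rpow_mul hn0.le, ← Real.rpow_add hn0]
      congr 1; ring

lemma tendsto_natCast_rpow_neg {a : ℝ} (ha : 0 < a) :
    Tendsto (fun n : ℕ => (n : ℝ) ^ (-a)) atTop (𝓝 0) :=
  (tendsto_rpow_neg_atTop ha).comp tendsto_natCast_atTop_atTop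

lemma tendsto_sq_mul_exp_rpow_sub {a d : ℝ} (ha : a < 1) (hd : 0 < d) (C : ℝ) :
    Tendsto (fun n : ℕ => (n : ℝ) ^ 2 * C * Real.exp ((n : ℝ) ^ a - d * n)) atTop (𝓝 0) := by
  have h0 : Tendsto (fun n : ℕ => (|C| : ℝ) * ((n : ℝ) ^ (2 : ℝ) * Real.exp (-(d / 2) * n))) atTop
      (𝓝 0) := by
    rw [← mul_zero |C|]
    exact ((tendsto_rpow_mul_exp_neg_mul_atTop_nhds_zero 2 (d / 2) (by positivity)).comp
      tendsto_natCast_atTop_atTop).const_mul _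
  have h1 : ∀ᶠ n : ℕ in atTop, (n : ℝ) ^ a ≤ d / 2 * n := by
    have := (tendsto_natCast_rpow (show 0 < 1 - a by linarith)).eventually_ge_atTop (2 / d)
    filter_upwards [this, eventually_ge_atTop 1] with n hn hn1
    have hn0 : (0 : ℝ) < n := by exact_mod_cast hn1
    have e1 : (n : ℝ) = (n : ℝ) ^ a * (n : ℝ) ^ (1 - a) := by
      rw [← Real.rpow_add hn0]; simp
    have e2 : (n : ℝ) ^ a * (2 / d) ≤ n := by
      conv_rhs => rw [e1]
      gcongr
    rw [← mul_div_assoc, div_le_iff₀ hd] at e2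
    linarith
  refine squeeze_zero_norm' ?_ h0
  filter_upwards [h1] with n hn
  rw [norm_mul, norm_mul, Real.norm_eq_abs C, Real.norm_of_nonneg (by positivity),
    Real.norm_of_nonneg (Real.exp_pos _).le, Real.rpow_ofNat, mul_comm _ |C|, mul_assoc]
  gcongr
  linarith

/-- The local comparison of the Hellinger and the Euclidean distances around the points of the
Sobolev ball. -/
lemma RegressionSetup.exists_l2_le_hellinger (h : RegressionSetup φ x B C₀ K β₀ L₀)
    (hNK : ∀ᶠ n : ℕ in atTop, N n ≤ K n) : ∃ C c : ℝ, 1 ≤ C ∧ 0 < c ∧ ∀ᶠ n : ℕ in atTop,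
    ∀ θ₀ ∈ sobolevBall β₀ L₀, ∀ k ≤ N n, ∀ θ : Fin k → ℝ,
      √k * hellinger (x n) (seriesProb φ θ₀) (sieveProb φ ⟨k, θ⟩) ≤ c →
      l2 (θ - truncate θ₀ k) ≤
        C * (hellinger (x n) (seriesProb φ θ₀) (sieveProb φ ⟨k, θ⟩) + 1 / √n) := by
  obtain ⟨C, c, hC, hc, hloc⟩ := LogisticSieve.exists_l2_le_hellinger
    (√L₀ + √(L₀ / (2 * β₀ - 1))) B C₀ (by positivity) h.bound_nonneg h.C₀_pos
  refine ⟨C, c, hC, hc, ?_⟩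
  filter_upwards [hNK, h.tail_eventually_le, eventually_ge_atTop 1] with n hN ht hn θ₀ hθ₀ k hk θ
  exact hloc φ h.bound n (x n) (K n) (h.design n hn) θ₀ (sobolevBall_summable h.half_lt hθ₀)
    (sobolevBall_tsum_abs_le h.half_lt hθ₀) _ (ht θ₀ hθ₀) k (hk.trans hN) θ

/-- Each of the five requirements fails with probability at most η/5. The constant C₁ depends only
on the sigmoid at the sup-norm bound, hence not on η. -/
lemma RegressionSetup.exists_law_not_goodData_le (h : RegressionSetup φ x B C₀ K β₀ L₀)
    (hg : IsSieveDensity g) {H : ℝ} (hH0 : 0 ≤ H) (hH : H < 1 / 2)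
    (hN : ∀ᶠ n : ℕ in atTop, (N n : ℝ) ≤ (n : ℝ) ^ H) (hNK : ∀ᶠ n : ℕ in atTop, N n ≤ K n)
    (hkN : ∀ᶠ n : ℕ in atTop, ∀ θ₀ ∈ sobolevBall β₀ L₀, oracleDim φ (x n) θ₀ ≤ N n)
    {a : ℝ} (ha : a < 1) {v : ℕ → ℕ → ℝ} {V : ℕ → ℝ}
    (hV : ∀ n, ∑' k, (if N n < k then ENNReal.ofReal (v n k) else 0) ≤ ENNReal.ofReal (V n))
    (hV0 : Tendsto (fun n : ℕ => Real.exp ((n : ℝ) ^ a) * V n) atTop (𝓝 0)) :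
    ∃ C₁ : ℝ, 0 ≤ C₁ ∧ ∀ η : ℝ, 0 < η → ∀ᶠ n : ℕ in atTop, ∀ θ₀ ∈ sobolevBall β₀ L₀,
      law (x n) (seriesProb φ θ₀)
        {y | ¬ GoodData φ (x n) g θ₀ (N n) C₁ ((n : ℝ) ^ a) (v n) y} ≤ ENNReal.ofReal η := by
  set A := √L₀ + √(L₀ / (2 * β₀ - 1)) with hA
  have hA0 : 0 ≤ A := by positivity
  have hB := h.bound_nonneg
  obtain ⟨C, c, hC, hc, hloc⟩ := h.exists_l2_le_hellinger hNK
  obtain ⟨G, hG1, hG⟩ := hg.exists_upper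
  obtain ⟨c₂, hc₂, hc₂1, hgc⟩ := hg.exists_lower (A + 2)
  obtain ⟨Ct, d, hCt, hd, htail⟩ := hg.exists_tail
  refine ⟨8 / Real.sigmoid (-(B * (A + 1))) ^ 2 + 6, by positivity, fun η hη => ?_⟩
  have hHt := tendsto_natCast_rpow_neg (show 0 < (1 / 2 - H) / 2 by linarith)
  have h16 : Tendsto (fun n : ℕ => Real.exp (-(Real.log n / 16))) atTop (𝓝 0) :=
    Real.tendsto_exp_neg_atTop_nhds_zero.comp
      (tendsto_log_natCast.atTop_div_const (by norm_num))
  have hinv : Tendsto (fun n : ℕ => 1 / (n : ℝ)) atTop (𝓝 0) := tendsto_one_div_atTop_nhds_zero_nat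
  have hbig : ∀ᶠ n : ℕ in atTop, ((2 * (⌈B⌉₊ + 1) + 1 : ℕ) : ℝ) ≤ c₂ * n := by
    filter_upwards [(tendsto_natCast_atTop_atTop (R := ℝ)).eventually_ge_atTop
      (((2 * (⌈B⌉₊ + 1) + 1 : ℕ) : ℝ) / c₂)] with n hn
    rwa [div_le_iff₀' hc₂] at hn
  have hη5 : 0 < η / 5 := by positivity
  filter_upwards [hloc, hN, hkN, hbig, eventually_ge_atTop 3,
    eventually_near_radius_le hH0 hH hN zero_le_one,
    eventually_near_radius_le hH0 hH hN (show 0 ≤ C by linarith),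
    eventually_near_radius_le hH0 hH hN (show 0 ≤ G * (2 * C) by nlinarith),
    hHt.eventually_le_const hc, hHt.eventually_le_const one_pos,
    h16.eventually_le_const (show (0 : ℝ) < 1 / 2 by norm_num),
    h16.eventually_le_const (show 0 < η / 5 / 2 by positivity),
    hinv.eventually_le_const hη5,
    (tendsto_sq_mul_exp_rpow_sub ha hd Ct).eventually_le_const hη5,
    hV0.eventually_le_const hη5] with n hlocn hNn hkNn hbign hn3 hr1 hrC hrG hHc hH1 hhalf h16η hinvη
    hout hVn θ₀ hθ₀
  have hn' : (3 : ℝ) ≤ n := by exact_mod_cast hn3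
  have hn0 : (0 : ℝ) < n := by linarith
  have hNle : N n ≤ n := by
    have : (N n : ℝ) ≤ n := hNn.trans (by
      calc (n : ℝ) ^ H ≤ (n : ℝ) ^ (1 : ℝ) :=
            Real.rpow_le_rpow_of_exponent_le (by linarith) (by linarith)
        _ = n := Real.rpow_one _)
    exact_mod_cast this
  have hNle' : (N n : ℝ) ≤ n := by exact_mod_cast hNle
  have hs0 : 0 ≤ 1 / √(n : ℝ) := by positivity
  have hC0 : 0 ≤ C := by linarith
  have hsmall : √(N n) * √(4 * (24 * (N n * Real.log n / n))) ≤ c := by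
    refine le_trans ?_ (hr1.2.trans hHc)
    rw [one_mul]
    gcongr
    linarith
  -- A mesh of order n^{-2} is fine enough for all k ≤ n, and the grid still has at most n⁴ points
  -- per coordinate.
  set m := (⌈B⌉₊ + 1) * (n * n) with hm
  have hm1 : 1 ≤ m := by
    have : 1 ≤ n * n := by nlinarith
    rw [hm]; nlinarith
  have hBm : B * (n * n) ≤ m := by
    rw [hm]; push_cast
    have := Nat.le_ceil B
    gcongr
    linarith
  have hmn4 : 2 * n * m + 1 ≤ n ^ 4 := by
    have e1 : 2 * (⌈B⌉₊ + 1) + 1 ≤ n := by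
      have : ((2 * (⌈B⌉₊ + 1) + 1 : ℕ) : ℝ) ≤ n := hbign.trans (by nlinarith)
      exact_mod_cast this
    have e2 : 1 ≤ n * n * n := Nat.one_le_iff_ne_zero.mpr (by positivity)
    calc 2 * n * m + 1 = 2 * (⌈B⌉₊ + 1) * (n * n * n) + 1 := by rw [hm]; ring
      _ ≤ 2 * (⌈B⌉₊ + 1) * (n * n * n) + n * n * n := by omega
      _ = (2 * (⌈B⌉₊ + 1) + 1) * (n * n * n) := by ring
      _ ≤ n * (n * n * n) := by gcongr
      _ = n ^ 4 := by ring
  have hmc : (m : ℝ) ≤ c₂ * n ^ 4 := by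
    have e1 : ((⌈B⌉₊ + 1 : ℕ) : ℝ) ≤ c₂ * n := by
      refine le_trans ?_ hbign
      norm_cast
      omega
    calc (m : ℝ) = ((⌈B⌉₊ + 1 : ℕ) : ℝ) * (n * n) := by rw [hm]; push_cast; ring
      _ ≤ c₂ * n * (n * n) := by gcongr
      _ = c₂ * n ^ 3 := by ring
      _ ≤ c₂ * n ^ 4 := by gcongr <;> linarith
  have hρ : G * (2 * (C * (√(4 * (24 * (N n * Real.log n / n))) + 1 / √n))) ≤
      Real.exp (-(Real.log n / 8)) := by
    refine le_trans (le_of_eq (by ring)) (hrG.1.trans ?_)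
    rw [Real.rpow_def_of_pos hn0, Real.exp_le_exp]
    have := Real.log_natCast_nonneg n
    linarith
  have b1 := law_not_ratio_le (x := x n) hB h.bound θ₀ hn3 hm1 hNle hBm hmn4
  have b2 := law_not_outer_le (x := x n) (φ := φ) hg hCt (htail n (by omega)) θ₀ (N n) ((n : ℝ) ^ a)
  have b3 := law_not_near_le (x := x n) (hlocn θ₀ hθ₀) (by omega) hC0 hs0 hsmall hG hρ hhalf
  have b4 := law_not_oracle_le hB h.bound (sobolevBall_summable h.half_lt hθ₀)
    (sobolevBall_tsum_abs_le h.half_lt hθ₀) (hlocn θ₀ hθ₀) hn3 hC0 hsmall (hrC.2.trans hH1) hm1 hNle hBm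
    hc₂ hgc hmc (hkNn θ₀ hθ₀)
  have b5 := law_not_tail_le (x := x n) (φ := φ) hg θ₀ (N n) ((n : ℝ) ^ a) (v n) (hV n)
  have b2' : (N n : ℝ) ^ 2 * Ct * Real.exp ((n : ℝ) ^ a - d * n) ≤ η / 5 := by
    refine le_trans ?_ hout
    gcongr
  refine le_trans (le_trans (measure_mono fun y hy => ?_) ((measure_union_le _ _).trans
    (add_le_add b1 ((measure_union_le _ _).trans (add_le_add b2 ((measure_union_le _ _).trans
      (add_le_add b3 ((measure_union_le _ _).trans (add_le_add b4 b5))))))))) ?_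
  · by_contra hcon
    simp only [Set.mem_union, not_or] at hcon
    obtain ⟨h1, h2, h3, h4, h5⟩ := hcon
    exact hy ⟨not_not.mp h1, not_not.mp h2, not_not.mp h3, not_not.mp h4, not_not.mp h5⟩
  calc _ ≤ ENNReal.ofReal (η / 5) + (ENNReal.ofReal (η / 5) + (ENNReal.ofReal (η / 5) +
        (ENNReal.ofReal (η / 5) + ENNReal.ofReal (η / 5)))) := by
        gcongr
        linarith
    _ = ENNReal.ofReal η := by
        rw [← ENNReal.ofReal_add hη5.le hη5.le, ← ENNReal.ofReal_add hη5.le (by positivity),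
          ← ENNReal.ofReal_add hη5.le (by positivity), ← ENNReal.ofReal_add hη5.le (by positivity)]
        congr 1; ring

/-- With probability tending to one, the posterior concentrates on models of dimension at most a
multiple of the oracle dimension, at the oracle rate. -/
theorem SieveWeights.exists_posterior_badSet_le (hW : SieveWeights φ x g K β₀ N W)
    (h : RegressionSetup φ x B C₀ K β₀ L₀) (hg : IsSieveDensity g) :
    ∃ J : ℝ, 1 ≤ J ∧ ∀ η : ℝ, 0 < η → ∀ᶠ n : ℕ in atTop, ∀ θ₀ ∈ sobolevBall β₀ L₀,
      law (x n) (seriesProb φ θ₀) {y | ¬ (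
        IsProbabilityMeasure (posterior φ (x n) (hierPrior g (W n y)) y) ∧
        posterior φ (x n) (hierPrior g (W n y)) y (badSet φ (x n) θ₀ (N n) J) ≤
          ENNReal.ofReal (1 / n))} ≤ ENNReal.ofReal η := by
  obtain ⟨H, hH0, hH, hN⟩ := hW.exists_exponent
  obtain ⟨a, v, V, hpa, ha, hWv, hV, hV0⟩ := hW.tail
  obtain ⟨Cw, hCw, hE⟩ := hW.le_evidence
  have hkN := h.oracleDim_le hW.floor_le
  obtain ⟨C₁, hC₁, hgood⟩ := h.exists_law_not_goodData_le hg hH0 hH hN hW.le_dim hkN ha hV hV0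
  set C₂ := C₁ + Cw with hC₂
  have hC₂0 : 0 ≤ C₂ := by positivity
  refine ⟨16 * (C₂ + 3), by linarith, fun η hη => ?_⟩
  -- The level T = n^a has a > 1/(1+2β₀), so it eventually dominates (C₂+3) k_n log n uniformly over
  -- the ball.
  filter_upwards [hgood η hη, hkN, hE, hWv, hW.zero,
    h.mul_oracleDim_le_rpow hpa (show 0 ≤ C₂ + 3 by positivity), eventually_ge_atTop 3]
    with n hgn hkn hEn hWvn hW0 hTn hn3 θ₀ hθ₀
  refine (measure_mono fun y hy => ?_).trans (hgn θ₀ hθ₀)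
  intro hG
  refine hy ?_
  have hk1 := (oracleDim_spec (φ := φ) (x := x n) θ₀ (by omega)).1
  have hev : ENNReal.ofReal (Real.exp (-(C₂ * (oracleDim φ (x n) θ₀ * Real.log n))) *
      likelihood (x n) (seriesProb φ θ₀) y) ≤ evidence φ (x n) (hierPrior g (W n y)) y := by
    refine le_trans ?_ (hEn y _ (Finset.mem_Icc.mpr ⟨hk1, hkn θ₀ hθ₀⟩))
    refine le_trans (le_of_eq ?_) (mul_le_mul_right hG.oracle _)
    rw [← ENNReal.ofReal_mul (Real.exp_pos _).le, ← mul_assoc (Real.exp _) (Real.exp _),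
      ← Real.exp_add]
    congr 3; ring
  refine ⟨isProbabilityMeasure_posterior hg (hW.tsum_le n y) (ne_of_gt (lt_of_lt_of_le ?_ hev)),
    hG.posterior_badSet_le hg (hW.tsum_le n y) (hW0 y) (hWvn y) hn3 hC₂0 hev (hTn θ₀ hθ₀) le_rfl⟩
  rw [ENNReal.ofReal_pos]
  exact mul_pos (Real.exp_pos _) (likelihood_sigmoid_pos _ y)

end


section

/-! ### The radius of the credible balls -/

variable {φ : ℕ → unitInterval → ℝ} {x : (n : ℕ) → Fin n → unitInterval} {B C₀ β₀ L₀ : ℝ}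
  {K : ℕ → ℕ} {g : ℝ → ℝ} {N : ℕ → ℕ} {W : (n : ℕ) → (Fin n → Bool) → ℕ → ℝ}

lemma truncate_pad {k : ℕ} (θ : Fin k → ℝ) : truncate (pad θ) k = θ := by
  ext j
  simp [truncate, pad]

lemma sum_abs_le_of_l2_sub_le {θ₀ : ℕ → ℝ} (hs : Summable fun j => |θ₀ j|) {k : ℕ} {θ : Fin k → ℝ}
    {b : ℝ} (hb : √k * l2 (θ - truncate θ₀ k) ≤ b) : ∑ j, |θ j| ≤ ∑' j, |θ₀ j| + b := by
  calc ∑ j, |θ j| ≤ ∑ j, (|truncate θ₀ k j| + |(θ - truncate θ₀ k) j|) := by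
        refine Finset.sum_le_sum fun j _ => ?_
        have := abs_add_le (truncate θ₀ k j) ((θ - truncate θ₀ k) j)
        simpa using this
    _ ≤ ∑' j, |θ₀ j| + b := by
        rw [Finset.sum_add_distrib]
        exact add_le_add (sum_abs_truncate_le hs k) ((sum_abs_le_l2 _).trans hb)

set_option maxHeartbeats 1000000 in
/-- Under polished tails, balls of radius a small multiple of `√(k_n / n)` have small posterior
mass. -/
theorem RegressionSetup.exists_posterior_ball_lt (h : RegressionSetup φ x B C₀ K β₀ L₀)
    (hg : IsSieveDensity g) {H : ℝ} (hH0 : 0 ≤ H) (hH : H < 1 / 2)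
    (hN : ∀ᶠ n : ℕ in atTop, (N n : ℝ) ≤ (n : ℝ) ^ H) (hNK : ∀ᶠ n : ℕ in atTop, N n ≤ K n)
    (hkN : ∀ᶠ n : ℕ in atTop, ∀ θ₀ ∈ sobolevBall β₀ L₀, oracleDim φ (x n) θ₀ ≤ N n)
    {R₀ k₀ : ℕ} (hR₀ : 1 < R₀) (hk₀ : 1 ≤ k₀) {τ : ℝ} (hτ₀ : 0 < τ) (hτ₁ : τ < 1)
    {J : ℝ} (hJ : 1 ≤ J) {α : ℝ} (hα₀ : 0 < α) (hα₁ : α < 1) :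
    ∃ δ : ℝ, 0 < δ ∧ ∀ᶠ n : ℕ in atTop, ∀ θ₀ ∈ polishedTail φ (x n) R₀ k₀ τ ∩ sobolevBall β₀ L₀,
      ∀ (w : ℕ → ℝ) (y : Fin n → Bool) (q : unitInterval → ℝ),
      posterior φ (x n) (hierPrior g w) y (badSet φ (x n) θ₀ (N n) J) ≤ ENNReal.ofReal (1 / n) →
      posterior φ (x n) (hierPrior g w) y
        {s | hellinger (x n) (sieveProb φ s) q ≤ δ * √(oracleDim φ (x n) θ₀ / n)} <
        ENNReal.ofReal (1 - α) := by
  set A := √L₀ + √(L₀ / (2 * β₀ - 1)) with hA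
  have hA0 : 0 ≤ A := by positivity
  have hB := h.bound_nonneg
  -- After m polished-tail steps the bias is at least 96 J k_n log n / n, which is impossible
  -- outside the bad set. Hence k ≥ k_n / (k₀ R₀^m) there.
  obtain ⟨m, hm⟩ : ∃ m : ℕ, 192 * J ≤ τ⁻¹ ^ m := by
    obtain ⟨m, hm⟩ := pow_unbounded_of_one_lt (192 * J) (one_lt_inv₀ hτ₀ |>.mpr hτ₁)
    exact ⟨m, hm.le⟩
  set a := k₀ * R₀ ^ m with ha
  have ha1 : 1 ≤ a := Nat.one_le_iff_ne_zero.mpr (by positivity)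
  have ha1' : (1 : ℝ) ≤ a := by exact_mod_cast ha1
  obtain ⟨C, c, hC, hc, hloc⟩ := h.exists_l2_le_hellinger hNK
  obtain ⟨C', c', hC', hc', hloc'⟩ := LogisticSieve.exists_l2_le_hellinger (A + 1) B C₀
    (by positivity) hB h.C₀_pos
  obtain ⟨G, hG1, hG⟩ := hg.exists_upper
  obtain ⟨c₂, hc₂, hc₂1, hgc⟩ := hg.exists_lower (A + 3)
  set F := Real.exp (C₀ / 4) * G / c₂ with hF
  have hF1 : 1 ≤ F := by
    rw [hF, one_le_div hc₂]
    have := Real.one_le_exp (show 0 ≤ C₀ / 4 by linarith [h.C₀_pos])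
    nlinarith
  set D := 2 * C' * √a with hD
  have hsa : 1 ≤ √(a : ℝ) := Real.one_le_sqrt.mpr ha1'
  have hD2 : 2 ≤ D := by rw [hD]; nlinarith
  -- Chosen so that the base of the kth power in `partialEvidence_small_ball_le` is (1-α)/2; being
  -- at most 1, it also bounds its powers with k ≥ 1.
  set δ := (1 - α) / (2 * (F * D)) with hδ
  have hFD : 2 ≤ F * D := by nlinarith
  have hα : 0 < 1 - α := by linarith
  have hδ0 : 0 < δ := by positivity
  have hFDδ : F * (D * δ) = (1 - α) / 2 := by rw [hδ]; field_simp
  have hDδ0 : 0 < D * δ := by positivity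
  have hDδ : D * δ ≤ 1 := by nlinarith
  have hδ2 : 2 * δ ≤ 1 := by nlinarith
  refine ⟨δ, hδ0, ?_⟩
  have hHt := tendsto_natCast_rpow_neg (show 0 < (1 / 2 - H) / 2 by linarith)
  have hinv : Tendsto (fun n : ℕ => 1 / (n : ℝ)) atTop (𝓝 0) := tendsto_one_div_atTop_nhds_zero_nat
  have hJs : 1 ≤ √J := Real.one_le_sqrt.mpr hJ
  filter_upwards [hloc, hN, hNK, hkN, eventually_ge_atTop 3,
    eventually_near_radius_le hH0 hH hN (show 0 ≤ √J by positivity),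
    eventually_near_radius_le hH0 hH hN (show 0 ≤ C * √J by positivity),
    hHt.eventually_le_const hc, hHt.eventually_le_const hc', hHt.eventually_le_const one_pos,
    hinv.eventually_lt_const (show 0 < (1 - α) / 2 by linarith)]
    with n hlocn hNn hNKn hkNn hn3 hr1 hrC hHc hHc' hH1 hinvn θ₀ hθ₀ w y q hbad
  have hn' : (3 : ℝ) ≤ n := by exact_mod_cast hn3
  have hn0 : (0 : ℝ) < n := by linarith
  have hlog1 : 1 ≤ Real.log n := by
    rw [Real.le_log_iff_exp_le (by linarith)]
    linarith [Real.exp_one_lt_d9]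
  have hNle : N n ≤ n := by
    have : (N n : ℝ) ≤ n := hNn.trans (by
      calc (n : ℝ) ^ H ≤ (n : ℝ) ^ (1 : ℝ) :=
            Real.rpow_le_rpow_of_exponent_le (by linarith) (by linarith)
        _ = n := Real.rpow_one _)
    exact_mod_cast this
  have hs := sobolevBall_summable h.half_lt hθ₀.2
  have hsA := sobolevBall_tsum_abs_le h.half_lt hθ₀.2
  have hk1 := (oracleDim_spec (φ := φ) (x := x n) θ₀ (by omega)).1
  have hkN' := hkNn θ₀ hθ₀.2
  set kn := oracleDim φ (x n) θ₀ with hkn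
  have hknN : (kn : ℝ) ≤ N n := by exact_mod_cast hkN'
  have hkn1 : (1 : ℝ) ≤ kn := by exact_mod_cast hk1
  set σ := √(4 * (24 * (N n * Real.log n / n))) with hσ
  have hσ0 : 0 ≤ σ := Real.sqrt_nonneg _
  have hsn : 0 ≤ 1 / √(n : ℝ) := by positivity
  set r := δ * √((kn : ℝ) / n) with hr
  have hr0 : 0 ≤ r := by positivity
  have hrσ : 2 * r ≤ σ := by
    have e1 : √((kn : ℝ) / n) ≤ σ := by
      refine Real.sqrt_le_sqrt ?_
      have e2 : (kn : ℝ) / n ≤ N n * Real.log n / n := by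
        gcongr
        calc (kn : ℝ) ≤ N n := hknN
          _ ≤ N n * Real.log n := le_mul_of_one_le_right (by positivity) hlog1
      have e3 : 0 ≤ (kn : ℝ) / n := by positivity
      linarith
    calc 2 * r = 2 * δ * √((kn : ℝ) / n) := by rw [hr]; ring
      _ ≤ 1 * σ := by gcongr
      _ = σ := one_mul σ
  -- the parameters outside the bad set
  have hout : ∀ (k : ℕ) (θ : Fin k → ℝ), (⟨k, θ⟩ : SieveParam) ∉ badSet φ (x n) θ₀ (N n) J →
      1 ≤ k ∧ k ≤ N n ∧ kn ≤ a * k ∧ ∑ j, |θ j| ≤ A + 1 := by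
    intro k θ hθ
    simp only [badSet, Set.mem_ofPred_eq, not_or, not_lt, not_le] at hθ
    obtain ⟨h0, h1, h2, h3⟩ := hθ
    have hk1 : 1 ≤ k := by omega
    have hkN : (k : ℝ) ≤ N n := by exact_mod_cast h1
    refine ⟨hk1, h1, ?_, ?_⟩
    · by_contra hcon
      have e1 := polishedTail_bias_lower hR₀ hk₀ hτ₀ hθ₀.1 m hk1
        (by rw [← ha, mul_comm]; exact not_le.mp hcon)
      have e2 := (e1.trans (bias_le θ₀ θ)).trans_lt h3
      have e3 : 0 < (kn : ℝ) * Real.log n / n := by positivity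
      have e4 : 96 * (J * (kn * Real.log n)) / n = 192 * J * (kn * Real.log n / n) / 2 := by ring
      have e5 := mul_le_mul_of_nonneg_right hm e3.le
      linarith
    · have hh : hellinger (x n) (seriesProb φ θ₀) (sieveProb φ ⟨k, θ⟩) ≤ √J * σ := by
        rw [hσ, ← Real.sqrt_mul (by linarith)]
        refine Real.le_sqrt_of_sq_le (h3.le.trans ?_)
        have : 96 * (J * (kn * Real.log n)) / n = J * (4 * (24 * (kn * Real.log n / n))) := by ring
        rw [this]
        gcongr
      have hsm : √k * hellinger (x n) (seriesProb φ θ₀) (sieveProb φ ⟨k, θ⟩) ≤ c := by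
        refine le_trans ?_ (hr1.2.trans hHc)
        gcongr
        · exact hellinger_nonneg _ _
        · refine hh.trans ?_
          gcongr
          linarith
      have e1 := hlocn θ₀ hθ₀.2 k h1 θ hsm
      refine (sum_abs_le_of_l2_sub_le hs (b := 1) ?_).trans (by linarith)
      refine le_trans ?_ (hrC.2.trans hH1)
      refine mul_le_mul (Real.sqrt_le_sqrt hkN) (e1.trans ?_) (l2_nonneg _) (Real.sqrt_nonneg _)
      calc C * (hellinger (x n) (seriesProb φ θ₀) (sieveProb φ ⟨k, θ⟩) + 1 / √n)
          ≤ C * (√J * σ + √J * (1 / √n)) := by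
            gcongr
            exact le_mul_of_one_le_left hsn hJs
        _ = _ := by ring
  set S : Set SieveParam := (badSet φ (x n) θ₀ (N n) J)ᶜ ∩ {s | hellinger (x n) (sieveProb φ s) q ≤ r}
    with hS
  have hSm : MeasurableSet S :=
    (measurableSet_badSet θ₀ (N n) J).compl.inter
      (measurableSet_le (measurable_hellinger q) measurable_const)
  have hmass : ∀ k, partialEvidence φ (x n) g k y ((fun θ => ⟨k, θ⟩) ⁻¹' S) ≤
      ENNReal.ofReal ((1 - α) / 2) * partialEvidence φ (x n) g k y Set.univ := by
    intro k
    -- The center q need not belong to the model. If the slice is nonempty, any of its points θ₁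
    -- serves as center, at the price of doubling the radius.
    rcases Set.eq_empty_or_nonempty ((fun θ : Fin k → ℝ => (⟨k, θ⟩ : SieveParam)) ⁻¹' S) with
      hemp | ⟨θ₁, hθ₁⟩
    · rw [hemp]; simp [partialEvidence]
    obtain ⟨hk1, hkN, hka, hθ₁A⟩ := hout k θ₁ hθ₁.1
    have hk1' : (1 : ℝ) ≤ k := by exact_mod_cast hk1
    have hkN' : (k : ℝ) ≤ N n := by exact_mod_cast hkN
    set σk := √((k : ℝ) / n) with hσk
    have hσk0 : 0 < σk := Real.sqrt_pos.mpr (by positivity)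
    have hσk1 : σk ≤ 1 := Real.sqrt_le_one.mpr (by
      rw [div_le_one hn0]; exact_mod_cast hkN.trans hNle)
    have hσa : √((kn : ℝ) / n) ≤ √a * σk := by
      rw [hσk, ← Real.sqrt_mul (by positivity)]
      refine Real.sqrt_le_sqrt ?_
      rw [← mul_div_assoc]
      gcongr
      exact_mod_cast hka
    have hρ : ∀ θ ∈ (fun θ : Fin k → ℝ => (⟨k, θ⟩ : SieveParam)) ⁻¹' S, l2 (θ - θ₁) ≤ D * δ * σk := by
      intro θ hθ
      have e1 : hellinger (x n) (seriesProb φ (pad θ₁)) (sieveProb φ ⟨k, θ⟩) ≤ 2 * r := by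
        rw [seriesProb_pad]
        have t1 := hellinger_triangle (x := x n) (sieveProb φ ⟨k, θ₁⟩) q (sieveProb φ ⟨k, θ⟩)
        have t2 : hellinger (x n) (sieveProb φ ⟨k, θ₁⟩) q ≤ r := hθ₁.2
        have t3 : hellinger (x n) (sieveProb φ ⟨k, θ⟩) q ≤ r := hθ.2
        rw [hellinger_comm q] at t1
        linarith
      -- The local comparison is used around θ₁ in place of θ₀, with tail t = 0 because the padded
      -- sequence vanishes beyond K. An error 1/√n would not shrink with δ.
      have e2 := hloc' φ h.bound n (x n) (K n) (h.design n (by omega)) (pad θ₁) (summable_abs_pad θ₁)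
        (by rw [tsum_abs_pad]; exact hθ₁A) 0 (by
          have : ∀ j, |pad θ₁ (j + K n)| = 0 := fun j => by
            rw [pad_of_le θ₁ (by omega), abs_zero]
          simp [this]) k (hkN.trans hNKn) θ (by
          refine le_trans ?_ (hr1.2.trans hHc')
          gcongr
          · exact hellinger_nonneg _ _
          · calc _ ≤ 1 * (σ + 0) := by linarith
              _ ≤ √J * (σ + 1 / √n) := by gcongr)
      rw [truncate_pad, add_zero] at e2
      calc l2 (θ - θ₁) ≤ C' * (2 * r) := e2.trans (by gcongr)
        _ = 2 * C' * δ * √((kn : ℝ) / n) := by rw [hr]; ring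
        _ ≤ 2 * C' * δ * (√a * σk) := by gcongr
        _ = D * δ * σk := by rw [hD]; ring
    have hball := partialEvidence_small_ball_le h.C₀_pos (hkN.trans hNKn) (h.design n (by omega))
      (by omega) hk1 (hkN.trans hNle) hG hc₂ hgc (measurable_sigma_mk k hSm) θ₁
      (show 0 < D * δ * σk by positivity) hρ (fun j => by
        have e1 : |θ₁ j| ≤ A + 1 := (Finset.single_le_sum (f := fun j => |θ₁ j|)
          (fun j _ => abs_nonneg _) (Finset.mem_univ j)).trans hθ₁A
        have e2 : D * δ * σk ≤ 1 := mul_le_one₀ hDδ hσk0.le hσk1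
        linarith) y
    refine hball.trans (mul_le_mul_left (ENNReal.ofReal_le_ofReal ?_) _)
    rw [← hF, ← hσk, mul_div_assoc, div_self hσk0.ne', mul_one, hFDδ]
    exact pow_le_of_le_one (by linarith) (by linarith) (by omega)
  have hSle := posterior_le_of_forall (w := w) hSm hmass
  calc _ ≤ posterior φ (x n) (hierPrior g w) y (badSet φ (x n) θ₀ (N n) J ∪ S) := by
        refine measure_mono fun s hs => ?_
        by_cases hsb : s ∈ badSet φ (x n) θ₀ (N n) J
        · exact Or.inl hsb
        · exact Or.inr ⟨hsb, hs⟩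
    _ ≤ ENNReal.ofReal (1 / n) + ENNReal.ofReal ((1 - α) / 2) :=
        (measure_union_le _ _).trans (add_le_add hbad hSle)
    _ = ENNReal.ofReal (1 / n + (1 - α) / 2) :=
        (ENNReal.ofReal_add (by positivity) (by linarith)).symm
    _ < ENNReal.ofReal (1 - α) := (ENNReal.ofReal_lt_ofReal_iff hα).mpr (by linarith)

section Radius

variable {n : ℕ} {x : Fin n → unitInterval} {α : ℝ} {P : Measure SieveParam} {q : unitInterval → ℝ}

/-- As h_n ≤ √2, the radius √2 is admissible; the infimum is thus over a nonempty set and is not the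
default 0. -/
lemma le_radius [IsProbabilityMeasure P] (hα₀ : 0 < α) (hq : ∀ t, q t ∈ Set.Icc (0 : ℝ) 1) {r : ℝ}
    (hr : P {s | hellinger x (sieveProb φ s) q ≤ r} < ENNReal.ofReal (1 - α)) :
    r ≤ radius φ x α P q := by
  refine le_csInf ⟨√2, ?_⟩ fun r' hr' => ?_
  · have : {s | hellinger x (sieveProb φ s) q ≤ √2} = Set.univ := by
      refine Set.eq_univ_of_forall fun s => ?_
      exact Real.le_sqrt_of_sq_le (hellinger_sq_le_two (sieveProb_mem_Icc φ s) hq)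
    rw [Set.mem_ofPred_eq, this, measure_univ]
    exact ENNReal.ofReal_le_one.mpr (by linarith)
  · by_contra hlt
    refine absurd (lt_of_le_of_lt ?_ hr) (lt_irrefl _)
    refine le_trans hr' (measure_mono fun s hs => ?_)
    exact le_trans hs (not_le.mp hlt).le

/-- Negative radii give empty balls, which are not admissible as α < 1; so the infimum is over a set
bounded below. -/
lemma radius_le (hα₁ : α < 1) {r : ℝ}
    (hr : ENNReal.ofReal (1 - α) ≤ P {s | hellinger x (sieveProb φ s) q ≤ r}) :
    radius φ x α P q ≤ r := by
  refine csInf_le ⟨0, fun r' hr' => ?_⟩ hr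
  by_contra hlt
  have : {s | hellinger x (sieveProb φ s) q ≤ r'} = ∅ := by
    refine Set.eq_empty_of_forall_notMem fun s hs => ?_
    have h1 := hellinger_nonneg (x := x) (sieveProb φ s) q
    have h2 : hellinger x (sieveProb φ s) q ≤ r' := hs
    linarith [not_le.mp hlt]
  rw [Set.mem_ofPred_eq, this, measure_empty] at hr'
  have := ENNReal.ofReal_eq_zero.mp (le_antisymm hr' bot_le)
  linarith

lemma hellingerDiam_credibleBall_le :
    hellingerDiam x (credibleBall φ x α P q 1) ≤ ENNReal.ofReal (2 * radius φ x α P q) := by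
  refine iSup₂_le fun q₁ h₁ => iSup₂_le fun q₂ h₂ => ENNReal.ofReal_le_ofReal ?_
  obtain ⟨-, -, -, h₁⟩ := h₁
  obtain ⟨-, -, -, h₂⟩ := h₂
  have := hellinger_triangle (x := x) q₁ q q₂
  rw [hellinger_comm q] at this
  linarith

end Radius

lemma ofReal_le_measure_inter {Ω : Type*} [MeasurableSpace Ω] {μ : Measure Ω} {S T : Set Ω} {ε : ℝ}
    (hε : 0 < ε) (hS : ENNReal.ofReal (1 - ε / 2) ≤ μ S) (hT : μ Tᶜ ≤ ENNReal.ofReal (ε / 2)) :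
    ENNReal.ofReal (1 - ε) ≤ μ (S ∩ T) := by
  have h1 : μ S ≤ μ (S ∩ T) + ENNReal.ofReal (ε / 2) := by
    refine le_trans (measure_mono fun y hy => ?_) ((measure_union_le _ _).trans
      (add_le_add_right hT (μ (S ∩ T))))
    by_cases hyT : y ∈ T
    · exact Or.inl ⟨hy, hyT⟩
    · exact Or.inr hyT
  rw [show 1 - ε = 1 - ε / 2 - ε / 2 by ring, ENNReal.ofReal_sub _ (by positivity)]
  exact tsub_le_iff_right.mpr (hS.trans h1)

variable {α : ℝ} {P : (n : ℕ) → (Fin n → Bool) → Measure SieveParam}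
  {qhat : (n : ℕ) → (Fin n → Bool) → unitInterval → ℝ}

/-- Coverage of inflated credible balls around a centering point that attains the oracle rate. -/
theorem SieveWeights.hasCoverage (hW : SieveWeights φ x g K β₀ N W)
    (h : RegressionSetup φ x B C₀ K β₀ L₀) (hg : IsSieveDensity g)
    (hP : ∀ n y, P n y = posterior φ (x n) (hierPrior g (W n y)) y)
    {R₀ k₀ : ℕ} (hR₀ : 1 < R₀) (hk₀ : 1 ≤ k₀) {τ : ℝ} (hτ₀ : 0 < τ) (hτ₁ : τ < 1)
    (hα₀ : 0 < α) (hα₁ : α < 1)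
    (hq : ∀ n y, IsProbabilityMeasure (P n y) → ∀ t, qhat n y t ∈ Set.Icc (0 : ℝ) 1)
    (hc : IsRateCentering φ x (fun n => polishedTail φ (x n) R₀ k₀ τ ∩ sobolevBall β₀ L₀) qhat) :
    HasCoverage φ x α (fun n => polishedTail φ (x n) R₀ k₀ τ ∩ sobolevBall β₀ L₀) P qhat := by
  obtain ⟨H, hH0, hH, hN⟩ := hW.exists_exponent
  obtain ⟨J, hJ, hbad⟩ := hW.exists_posterior_badSet_le h hg
  obtain ⟨δ, hδ, hball⟩ := h.exists_posterior_ball_lt hg hH0 hH hN hW.le_dim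
    (h.oracleDim_le hW.floor_le) hR₀ hk₀ hτ₀ hτ₁ hJ hα₀ hα₁
  intro ε hε
  obtain ⟨M, hM, hcM⟩ := hc (ε / 2) (by positivity)
  refine ⟨M * √2 / δ, by positivity, le_liminf_of_le (by isBoundedDefault) ?_⟩
  filter_upwards [hbad (ε / 2) (by positivity), hball, hcM, eventually_ge_atTop 3]
    with n hbadn hballn hcn hn3
  refine le_iInf₂ fun θ₀ hθ₀ => ?_
  refine (ofReal_le_measure_inter hε (hcn θ₀ hθ₀) (T := {y |
    IsProbabilityMeasure (posterior φ (x n) (hierPrior g (W n y)) y) ∧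
    posterior φ (x n) (hierPrior g (W n y)) y (badSet φ (x n) θ₀ (N n) J) ≤
      ENNReal.ofReal (1 / n)}) (hbadn θ₀ hθ₀.2)).trans (measure_mono fun y hy => ?_)
  obtain ⟨hy1, hy2, hy3⟩ := hy
  rw [← hP] at hy2 hy3
  have hb := hballn θ₀ hθ₀ (W n y) y (qhat n y) (by rwa [← hP])
  rw [← hP] at hb
  have hrad := le_radius hα₀ (hq n y hy2) hb
  refine ⟨θ₀, sobolevBall_summable h.half_lt hθ₀.2, rfl, le_trans hy1 ?_⟩
  have hspec := (oracleDim_spec (φ := φ) (x := x n) θ₀ (by omega)).2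
  -- The centering error exceeds the lower bound of the radius by the factor √(log n) only, which is
  -- the inflation of the ball; the remaining constant is M√2/δ.
  have hrate : oracleRate φ (x n) θ₀ ≤ √2 * √(Real.log n) * √(oracleDim φ (x n) θ₀ / n) := by
    rw [← Real.sqrt_mul (by norm_num), ← Real.sqrt_mul
      (mul_nonneg (by norm_num) (Real.log_natCast_nonneg n))]
    refine Real.sqrt_le_sqrt ?_
    calc _ ≤ oracleDim φ (x n) θ₀ * Real.log n / n + oracleDim φ (x n) θ₀ * Real.log n / n := by
          gcongr
      _ = _ := by ring
  calc M * oracleRate φ (x n) θ₀ ≤ M * (√2 * √(Real.log n) * √(oracleDim φ (x n) θ₀ / n)) := by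
        gcongr
    _ = M * √2 / δ * √(Real.log n) * (δ * √(oracleDim φ (x n) θ₀ / n)) := by field_simp
    _ ≤ _ := by gcongr

/-- The size of credible balls around a centering point that attains the oracle rate. -/
theorem SieveWeights.hasAdaptiveSize (hW : SieveWeights φ x g K β₀ N W)
    (h : RegressionSetup φ x B C₀ K β₀ L₀) (hg : IsSieveDensity g)
    (hP : ∀ n y, P n y = posterior φ (x n) (hierPrior g (W n y)) y)
    (hα₀ : 0 < α) (hα₁ : α < 1)
    (hc : IsRateCentering φ x (fun _ => sobolevBall β₀ L₀) qhat) :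
    HasAdaptiveSize φ x α β₀ L₀ P qhat := by
  obtain ⟨J, hJ, hbad⟩ := hW.exists_posterior_badSet_le h hg
  obtain ⟨D, hD, hrate⟩ := h.exists_oracle_bounds
  intro ε hε
  obtain ⟨M, hM, hcM⟩ := hc (ε / 2) (by positivity)
  refine ⟨2 * (√(96 * J) + M) * √(2 * D), by positivity, le_liminf_of_le (by isBoundedDefault) ?_⟩
  have hinv : Tendsto (fun n : ℕ => 1 / (n : ℝ)) atTop (𝓝 0) := tendsto_one_div_atTop_nhds_zero_nat
  filter_upwards [hbad (ε / 2) (by positivity), hrate, hcM, hinv.eventually_le_const hα₀]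
    with n hbadn hraten hcn hinvn
  refine le_iInf₂ fun β hβ => le_iInf₂ fun θ₀ hθ₀ => ?_
  have hθ₀' := sobolevBall_subset hβ hθ₀
  refine (ofReal_le_measure_inter hε (hcn θ₀ hθ₀') (T := {y |
    IsProbabilityMeasure (posterior φ (x n) (hierPrior g (W n y)) y) ∧
    posterior φ (x n) (hierPrior g (W n y)) y (badSet φ (x n) θ₀ (N n) J) ≤
      ENNReal.ofReal (1 / n)}) (hbadn θ₀ hθ₀')).trans (measure_mono fun y hy => ?_)
  obtain ⟨hy1, hy2, hy3⟩ := hy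
  rw [← hP] at hy2 hy3
  have hy1' : hellinger (x n) (seriesProb φ θ₀) (qhat n y) ≤ M * oracleRate φ (x n) θ₀ := hy1
  -- As soon as 1/n ≤ α, the complement of the bad set has posterior mass at least 1 - α, and it
  -- lies in a ball around q̂ by the triangle inequality through the truth.
  have hrad : radius φ (x n) α (P n y) (qhat n y) ≤ (√(96 * J) + M) * oracleRate φ (x n) θ₀ := by
    refine radius_le hα₁ ?_
    have hc1 : 1 - ENNReal.ofReal (1 / n) ≤ P n y (badSet φ (x n) θ₀ (N n) J)ᶜ := by
      rw [prob_compl_eq_one_sub (measurableSet_badSet θ₀ (N n) J)]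
      exact tsub_le_tsub_left hy3 1
    refine le_trans ?_ (hc1.trans (measure_mono fun s hs => ?_))
    · rw [← ENNReal.ofReal_one, ← ENNReal.ofReal_sub _ (by positivity)]
      exact ENNReal.ofReal_le_ofReal (by linarith)
    · simp only [badSet, Set.mem_compl_iff, Set.mem_ofPred_eq, not_or, not_le] at hs
      have e1 : hellinger (x n) (seriesProb φ θ₀) (sieveProb φ s) ≤
          √(96 * J) * oracleRate φ (x n) θ₀ := by
        rw [oracleRate, ← Real.sqrt_mul (by positivity)]
        refine Real.le_sqrt_of_sq_le (hs.2.2.2.le.trans ?_)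
        have := bias_nonneg (φ := φ) (x := x n) θ₀ (oracleDim φ (x n) θ₀)
        have e2 : 96 * (J * (oracleDim φ (x n) θ₀ * Real.log n)) / n =
          96 * J * (oracleDim φ (x n) θ₀ * Real.log n / n) := by ring
        rw [e2]
        gcongr
        linarith
      have e2 := hellinger_triangle (x := x n) (sieveProb φ s) (seriesProb φ θ₀) (qhat n y)
      rw [hellinger_comm (sieveProb φ s) (seriesProb φ θ₀)] at e2
      rw [Set.mem_ofPred_eq]
      linarith
  refine hellingerDiam_credibleBall_le.trans (ENNReal.ofReal_le_ofReal ?_)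
  calc 2 * radius φ (x n) α (P n y) (qhat n y)
      ≤ 2 * ((√(96 * J) + M) * oracleRate φ (x n) θ₀) := by gcongr
    _ ≤ 2 * ((√(96 * J) + M) * (√(2 * D) * ((n : ℝ) / Real.log n) ^ (-(β / (1 + 2 * β))))) := by
        gcongr
        exact (hraten β hβ θ₀ hθ₀).2
    _ = _ := by ring

end


section

/-! ### The posterior mean -/

section Mean

variable {φ : ℕ → unitInterval → ℝ} {n : ℕ} {x : Fin n → unitInterval} {P : Measure SieveParam}

lemma integrable_of_mem_Icc {Ω : Type*} [MeasurableSpace Ω] {μ : Measure Ω} [IsFiniteMeasure μ]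
    {f : Ω → ℝ} (hf : Measurable f) {b : ℝ} (h : ∀ s, f s ∈ Set.Icc 0 b) : Integrable f μ :=
  Integrable.of_bound hf.aestronglyMeasurable b (Eventually.of_forall fun s => by
    rw [Real.norm_of_nonneg (h s).1]
    exact (h s).2)

lemma integral_sqrt_le {Ω : Type*} [MeasurableSpace Ω] {μ : Measure Ω} [IsProbabilityMeasure μ]
    {f : Ω → ℝ} (hf : Measurable f) (h : ∀ s, f s ∈ Set.Icc (0 : ℝ) 1) :
    ∫ s, √(f s) ∂μ ≤ √(∫ s, f s ∂μ) :=
  Real.strictConcaveOn_sqrt.concaveOn.le_map_integral Real.continuous_sqrt.continuousOn isClosed_Ici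
    (Eventually.of_forall fun s => (h s).1) (integrable_of_mem_Icc hf h)
    (integrable_of_mem_Icc (b := 1) hf.sqrt fun s => ⟨Real.sqrt_nonneg _, Real.sqrt_le_one.mpr (h s).2⟩)

lemma meanProb_mem_Icc [IsProbabilityMeasure P] (t : unitInterval) :
    meanProb φ P t ∈ Set.Icc (0 : ℝ) 1 := by
  have hm := measurable_sieveProb (φ := φ) t
  have h := fun s => sieveProb_mem_Icc φ s t
  refine ⟨integral_nonneg fun s => (h s).1, ?_⟩
  calc meanProb φ P t ≤ ∫ _s, (1 : ℝ) ∂P :=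
        integral_mono (integrable_of_mem_Icc hm h) (integrable_const _) fun s => (h s).2
    _ = 1 := by simp

/-- For fixed a the affinity is a nonnegative combination of √p and √(1-p), hence concave in p, and
Jensen's inequality applies. -/
lemma integral_affinity_le [IsProbabilityMeasure P] {a : ℝ} (ha : a ∈ Set.Icc (0 : ℝ) 1)
    (t : unitInterval) :
    Integrable (fun s => affinity a (sieveProb φ s t)) P ∧
      ∫ s, affinity a (sieveProb φ s t) ∂P ≤ affinity a (meanProb φ P t) := by
  have hm := measurable_sieveProb (φ := φ) t
  have h := fun s => sieveProb_mem_Icc φ s t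
  have h' : ∀ s, 1 - sieveProb φ s t ∈ Set.Icc (0 : ℝ) 1 := fun s =>
    ⟨by linarith [(h s).2], by linarith [(h s).1]⟩
  have hi : Integrable (fun s => √(sieveProb φ s t)) P := integrable_of_mem_Icc (b := 1) hm.sqrt
    fun s => ⟨Real.sqrt_nonneg _, Real.sqrt_le_one.mpr (h s).2⟩
  have hi' : Integrable (fun s => √(1 - sieveProb φ s t)) P :=
    integrable_of_mem_Icc (b := 1) (hm.const_sub 1).sqrt
      fun s => ⟨Real.sqrt_nonneg _, Real.sqrt_le_one.mpr (h' s).2⟩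
  have ha' : 0 ≤ 1 - a := by linarith [ha.2]
  have hint := integral_sqrt_le (μ := P) hm h
  have hint' := integral_sqrt_le (μ := P) (hm.const_sub 1) h'
  rw [integral_sub (integrable_const _) (integrable_of_mem_Icc hm h)] at hint'
  simp only [integral_const, probReal_univ, one_smul] at hint'
  simp only [affinity, Real.sqrt_mul ha.1, Real.sqrt_mul ha']
  refine ⟨(hi.const_mul _).add (hi'.const_mul _), ?_⟩
  rw [integral_add (hi.const_mul _) (hi'.const_mul _), integral_const_mul, integral_const_mul]
  exact add_le_add (mul_le_mul_of_nonneg_left hint (Real.sqrt_nonneg _))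
    (mul_le_mul_of_nonneg_left hint' (Real.sqrt_nonneg _))

/-- The squared Hellinger distance is convex. -/
lemma hellinger_meanProb_sq_le [IsProbabilityMeasure P] {q : unitInterval → ℝ}
    (hq : ∀ t, q t ∈ Set.Icc (0 : ℝ) 1) :
    hellinger x q (meanProb φ P) ^ 2 ≤ ∫ s, hellinger x q (sieveProb φ s) ^ 2 ∂P := by
  rw [hellinger_sq_eq_affinity hq meanProb_mem_Icc]
  simp only [hellinger_sq_eq_affinity hq (sieveProb_mem_Icc φ _)]
  have hi := fun i => integral_affinity_le (φ := φ) (P := P) (hq (x i)) (x i)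
  have hi2 : ∀ i, Integrable (fun s => 2 - 2 * affinity (q (x i)) (sieveProb φ s (x i))) P := fun i =>
    (integrable_const _).sub ((hi i).1.const_mul 2)
  rw [integral_const_mul, integral_finsetSum _ fun i _ => hi2 i]
  gcongr with i
  rw [integral_sub (integrable_const _) ((hi i).1.const_mul 2), integral_const_mul]
  simp only [integral_const, probReal_univ, one_smul]
  linarith [(hi i).2]

end Mean

variable {φ : ℕ → unitInterval → ℝ} {x : (n : ℕ) → Fin n → unitInterval} {B C₀ β₀ L₀ : ℝ}
  {K : ℕ → ℕ} {g : ℝ → ℝ} {N : ℕ → ℕ} {W : (n : ℕ) → (Fin n → Bool) → ℕ → ℝ}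
  {P : (n : ℕ) → (Fin n → Bool) → Measure SieveParam}

/-- The posterior mean attains the oracle rate. -/
theorem SieveWeights.isRateCentering_meanProb (hW : SieveWeights φ x g K β₀ N W)
    (h : RegressionSetup φ x B C₀ K β₀ L₀) (hg : IsSieveDensity g)
    (hP : ∀ n y, P n y = posterior φ (x n) (hierPrior g (W n y)) y) :
    IsRateCentering φ x (fun _ => sobolevBall β₀ L₀) (fun n y => meanProb φ (P n y)) := by
  obtain ⟨J, hJ, hbad⟩ := hW.exists_posterior_badSet_le h hg
  intro η hη
  refine ⟨√(96 * J + 2), by positivity, ?_⟩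
  filter_upwards [hbad η hη, eventually_ge_atTop 3] with n hbadn hn3 θ₀ hθ₀
  have hn' : (3 : ℝ) ≤ n := by exact_mod_cast hn3
  have hlog1 : 1 ≤ Real.log n := by
    rw [Real.le_log_iff_exp_le (by linarith)]
    linarith [Real.exp_one_lt_d9]
  have hq₀ := seriesProb_mem_Icc φ θ₀
  have := isProbabilityMeasure_law (x := x n) hq₀
  set T := {y | IsProbabilityMeasure (posterior φ (x n) (hierPrior g (W n y)) y) ∧
    posterior φ (x n) (hierPrior g (W n y)) y (badSet φ (x n) θ₀ (N n) J) ≤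
      ENNReal.ofReal (1 / n)} with hT
  have hT1 : ENNReal.ofReal (1 - η) ≤ law (x n) (seriesProb φ θ₀) T := by
    rw [ENNReal.ofReal_sub _ hη.le, ENNReal.ofReal_one, tsub_le_iff_right,
      ← prob_add_prob_compl (μ := law (x n) (seriesProb φ θ₀)) (Set.toFinite T).measurableSet]
    gcongr
    exact hbadn θ₀ hθ₀
  refine hT1.trans (measure_mono fun y hy => ?_)
  obtain ⟨hy2, hy3⟩ := hy
  rw [← hP] at hy2 hy3
  set b := badSet φ (x n) θ₀ (N n) J with hb
  have hbm : MeasurableSet b := measurableSet_badSet θ₀ (N n) J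
  set κ := oracleDim φ (x n) θ₀ * Real.log n with hκ
  have hk1 := (oracleDim_spec (φ := φ) (x := x n) θ₀ (by omega)).1
  have hk1' : (1 : ℝ) ≤ oracleDim φ (x n) θ₀ := by exact_mod_cast hk1
  have hκ1 : 1 ≤ κ := by rw [hκ]; nlinarith
  -- On the bad set h² is only known to be at most 2, but its mass 1/n contributes at most 2/n,
  -- below the rate since k_n log n ≥ 1.
  have hpt : ∀ s, hellinger (x n) (seriesProb φ θ₀) (sieveProb φ s) ^ 2 ≤
      96 * (J * κ) / n + b.indicator (fun _ => (2 : ℝ)) s := by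
    intro s
    by_cases hs : s ∈ b
    · rw [Set.indicator_of_mem hs]
      have := hellinger_sq_le_two (x := x n) hq₀ (sieveProb_mem_Icc φ s)
      have : 0 ≤ 96 * (J * κ) / n := by positivity
      linarith
    · rw [Set.indicator_of_notMem hs, add_zero]
      simp only [hb, badSet, Set.mem_ofPred_eq, not_or, not_le] at hs
      exact hs.2.2.2.le
  have hi : Integrable (fun s => hellinger (x n) (seriesProb φ θ₀) (sieveProb φ s) ^ 2) (P n y) :=
    integrable_of_mem_Icc ((measurable_hellinger_left _).pow_const 2) fun s =>
      ⟨sq_nonneg _, hellinger_sq_le_two hq₀ (sieveProb_mem_Icc φ s)⟩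
  have hi2 : Integrable (b.indicator fun _ => (2 : ℝ)) (P n y) := (integrable_const _).indicator hbm
  have hreal : (P n y).real b ≤ 1 / n := ENNReal.toReal_le_of_le_ofReal (by positivity) hy3
  have hmean : hellinger (x n) (seriesProb φ θ₀) (meanProb φ (P n y)) ^ 2 ≤
      96 * (J * κ) / n + 2 * (1 / n) := by
    refine (hellinger_meanProb_sq_le hq₀).trans ((integral_mono hi
      ((integrable_const _).add hi2) hpt).trans ?_)
    simp only [Pi.add_apply]
    rw [integral_add (integrable_const _) hi2, integral_indicator_const _ hbm]
    simp only [integral_const, probReal_univ, smul_eq_mul]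
    linarith
  rw [Set.mem_ofPred_eq, oracleRate, ← Real.sqrt_mul (by positivity)]
  refine Real.le_sqrt_of_sq_le (hmean.trans ?_)
  have hbias := bias_nonneg (φ := φ) (x := x n) θ₀ (oracleDim φ (x n) θ₀)
  calc 96 * (J * κ) / n + 2 * (1 / n) ≤ 96 * (J * κ) / n + 2 * (κ / n) := by gcongr
    _ = (96 * J + 2) * (κ / n) := by ring
    _ ≤ _ := by
        rw [hκ] at *
        gcongr
        linarith

end


section

/-! ### Hierarchical and empirical Bayes weights -/

lemma tsum_ofReal_le_of_hasSum {w : ℕ → ℝ} {s : ℝ} (h0 : ∀ k, 0 ≤ w k) (h : HasSum w s) :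
    ∑' k, ENNReal.ofReal (w k) ≤ ENNReal.ofReal s := by
  rw [← ENNReal.ofReal_tsum_of_nonneg h0 h.summable, h.tsum_eq]

lemma hasSum_geometric_weights {p : ℝ} (h0 : 0 < p) (h1 : p < 1) :
    HasSum (fun k : ℕ => if k = 0 then 0 else p * (1 - p) ^ (k - 1)) 1 := by
  have h := (hasSum_geometric_of_lt_one (show 0 ≤ 1 - p by linarith) (by linarith)).mul_left p
  rw [sub_sub_cancel, mul_inv_cancel₀ h0.ne'] at h
  rw [← hasSum_nat_add_iff' 1]
  simpa using h

lemma hasSum_poisson_weights {lam : ℝ} (h0 : 0 < lam) :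
    HasSum (fun k : ℕ => if k = 0 then 0 else
      (Real.exp (-lam) * lam ^ k / (k.factorial : ℝ)) / (1 - Real.exp (-lam))) 1 := by
  have hz : 0 < 1 - Real.exp (-lam) := by
    rw [sub_pos, Real.exp_lt_one_iff]; linarith
  have h := NormedSpace.expSeries_div_hasSum_exp lam
  rw [← Real.exp_eq_exp_ℝ] at h
  have h2 := ((hasSum_nat_add_iff' 1).mpr h).mul_left (Real.exp (-lam) / (1 - Real.exp (-lam)))
  have e : Real.exp (-lam) / (1 - Real.exp (-lam)) *
      (Real.exp lam - ∑ i ∈ Finset.range 1, lam ^ i / (i.factorial : ℝ)) = 1 := by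
    have : Real.exp (-lam) * Real.exp lam = 1 := by rw [← Real.exp_add]; simp
    simp only [Finset.range_one, Finset.sum_singleton, pow_zero, Nat.factorial_zero, Nat.cast_one,
      div_one]
    rw [div_mul_eq_mul_div, mul_sub, this, mul_one, div_self hz.ne']
  rw [e] at h2
  rw [← hasSum_nat_add_iff' 1]
  simp only [Finset.range_one, Finset.sum_singleton, if_true, sub_zero, Nat.add_eq_zero_iff,
    one_ne_zero, and_false, if_false]
  refine h2.congr_fun ?_ |> id
  intro k
  ring

lemma IsGeometricOrPoisson.zero {w : ℕ → ℝ} (hw : IsGeometricOrPoisson w) : w 0 = 0 := by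
  rcases hw with ⟨p, -, -, hw⟩ | ⟨lam, -, hw⟩ <;> simp [hw]

lemma IsGeometricOrPoisson.tsum_le {w : ℕ → ℝ} (hw : IsGeometricOrPoisson w) :
    ∑' k, ENNReal.ofReal (w k) ≤ 1 := by
  rw [← ENNReal.ofReal_one]
  rcases hw with ⟨p, h0, h1, hw⟩ | ⟨lam, h0, hw⟩
  · obtain rfl := funext hw
    refine tsum_ofReal_le_of_hasSum (fun k => ?_) (hasSum_geometric_weights h0 h1)
    have : 0 < 1 - p := by linarith
    split_ifs <;> positivity
  · obtain rfl := funext hw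
    refine tsum_ofReal_le_of_hasSum (fun k => ?_) (hasSum_poisson_weights h0)
    have : 0 < 1 - Real.exp (-lam) := by
      rw [sub_pos, Real.exp_lt_one_iff]; linarith
    split_ifs <;> positivity

/-- In the Poisson case the geometric rate 1/2 comes from (2λ)^k / k! ≤ e^{2λ}. -/
lemma IsGeometricOrPoisson.exists_le {w : ℕ → ℝ} (hw : IsGeometricOrPoisson w) :
    ∃ C ρ : ℝ, 0 < C ∧ 0 < ρ ∧ ρ < 1 ∧ ∀ k, w k ≤ C * ρ ^ k := by
  rcases hw with ⟨p, h0, h1, hw⟩ | ⟨lam, h0, hw⟩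
  · have hp : 0 < 1 - p := by linarith
    refine ⟨p / (1 - p), 1 - p, by positivity, hp, by linarith, fun k => ?_⟩
    rw [hw]
    rcases k with - | k
    · simp only [if_true]; positivity
    · simp only [Nat.add_eq_zero_iff, one_ne_zero, and_false, if_false, Nat.add_sub_cancel]
      rw [pow_succ]
      exact le_of_eq (by field_simp)
  · have hz : 0 < 1 - Real.exp (-lam) := by
      rw [sub_pos, Real.exp_lt_one_iff]; linarith
    refine ⟨Real.exp (-lam) * Real.exp (2 * lam) / (1 - Real.exp (-lam)), 1 / 2, by positivity,
      by norm_num, by norm_num, fun k => ?_⟩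
    rw [hw]
    split_ifs
    · positivity
    · have h1 := Real.pow_div_factorial_le_exp (2 * lam) (by positivity) k
      have h2 : lam ^ k / (k.factorial : ℝ) = (2 * lam) ^ k / (k.factorial : ℝ) * (1 / 2) ^ k := by
        rw [mul_pow, div_pow, one_pow]; field_simp
      calc _ = Real.exp (-lam) * ((2 * lam) ^ k / (k.factorial : ℝ)) / (1 - Real.exp (-lam)) *
            (1 / 2) ^ k := by rw [mul_div_assoc, h2]; ring
        _ ≤ _ := by gcongr

/-- The prior price of choosing a model is of the same order as its price in marginal likelihood, so
the oracle evidence bound survives mixing. In the Poisson case k! ≤ k^k ≤ n^k. -/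
lemma IsGeometricOrPoisson.exists_exp_le {w : ℕ → ℝ} (hw : IsGeometricOrPoisson w) :
    ∃ C : ℝ, 0 ≤ C ∧ ∀ n k : ℕ, 1 ≤ Real.log n → 1 ≤ k → k ≤ n →
      Real.exp (-(C * (k * Real.log n))) ≤ w k := by
  rcases hw with ⟨p, h0, h1, hw⟩ | ⟨lam, h0, hw⟩
  · have hp : 0 < 1 - p := by linarith
    set z := p * (1 - p) with hz
    have hz0 : 0 < z := by positivity
    have hz1 : z ≤ 1 := by nlinarith
    have hlz : 0 ≤ -Real.log z := by linarith [Real.log_nonpos hz0.le hz1]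
    refine ⟨-Real.log z, hlz, fun n k hn hk _ => ?_⟩
    rw [hw, if_neg (by omega)]
    have e1 : z ^ k ≤ p * (1 - p) ^ (k - 1) := by
      obtain ⟨j, rfl⟩ : ∃ j, k = j + 1 := ⟨k - 1, by omega⟩
      rw [Nat.add_sub_cancel, hz, mul_pow, pow_succ, pow_succ]
      have a1 : p ^ j ≤ 1 := pow_le_one₀ h0.le h1.le
      have a2 : 0 < (1 - p) ^ j := by positivity
      calc p ^ j * p * ((1 - p) ^ j * (1 - p)) ≤ 1 * p * ((1 - p) ^ j * 1) := by
            gcongr; linarith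
        _ = _ := by ring
    refine le_trans ?_ e1
    rw [← Real.exp_log (pow_pos hz0 k), Real.log_pow, Real.exp_le_exp]
    have hk0 : (0 : ℝ) ≤ k := by positivity
    nlinarith [mul_nonneg hlz hk0]
  · have hz : 0 < 1 - Real.exp (-lam) := by
      rw [sub_pos, Real.exp_lt_one_iff]; linarith
    have hz1 : 1 - Real.exp (-lam) ≤ 1 := by linarith [Real.exp_pos (-lam)]
    set C := lam + |Real.log lam| + 1 with hC
    have hC0 : 0 ≤ C := by positivity
    refine ⟨C, hC0, fun n k hn hk hkn => ?_⟩
    rw [hw, if_neg (by omega)]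
    have hk1 : (1 : ℝ) ≤ k := by exact_mod_cast hk
    have hn0 : (0 : ℝ) < n := by
      have : (k : ℝ) ≤ n := by exact_mod_cast hkn
      linarith
    have hfac : (k.factorial : ℝ) ≤ (n : ℝ) ^ k := by
      calc (k.factorial : ℝ) ≤ (k : ℝ) ^ k := by exact_mod_cast Nat.factorial_le_pow k
        _ ≤ _ := by gcongr
    calc Real.exp (-(C * (k * Real.log n)))
        ≤ Real.exp (-lam + k * Real.log lam - k * Real.log n) := by
          rw [Real.exp_le_exp, hC]
          have a1 := neg_abs_le (Real.log lam)
          have a2 : (k : ℝ) ≤ k * Real.log n := by nlinarith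
          have a3 := abs_nonneg (Real.log lam)
          nlinarith
      _ = Real.exp (-lam) * lam ^ k / (n : ℝ) ^ k := by
          rw [Real.exp_sub, Real.exp_add, ← Real.log_pow, ← Real.log_pow, Real.exp_log (by positivity),
            Real.exp_log (by positivity)]
      _ ≤ Real.exp (-lam) * lam ^ k / (k.factorial : ℝ) := by gcongr
      _ ≤ _ := le_div_self (by positivity) hz hz1

/-- For k > N one has r^{2k} ≤ r^N r^k: half of the decay gives the factor r^N, the other half sums
the series. -/
lemma tsum_tail_le {w : ℕ → ℝ} {C r : ℝ} (hC : 0 < C) (hr0 : 0 < r) (hr1 : r < 1)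
    (hw : ∀ k, w k ≤ C * (r ^ 2) ^ k) (N : ℕ) :
    ∑' k, (if N < k then ENNReal.ofReal (w k) else 0) ≤ ENNReal.ofReal (C * r ^ N * (1 - r)⁻¹) := by
  refine le_trans (ENNReal.tsum_le_tsum fun k => ?_) (tsum_ofReal_le_of_hasSum
    (fun k => by positivity) ((hasSum_geometric_of_lt_one hr0.le hr1).mul_left (C * r ^ N)))
  split_ifs with h
  · refine ENNReal.ofReal_le_ofReal ((hw k).trans ?_)
    rw [pow_right_comm, sq, ← mul_assoc]
    have := pow_le_pow_of_le_one hr0.le hr1.le h.le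
    gcongr
  · exact bot_le

lemma tendsto_exp_rpow_mul_pow_floor {a H r C : ℝ} (ha : 0 < a) (haH : a < H) (hr0 : 0 < r) (hr1 : r < 1)
    (hC : 0 ≤ C) :
    Tendsto (fun n : ℕ => Real.exp ((n : ℝ) ^ a) * (C * r ^ ⌊(n : ℝ) ^ H⌋₊)) atTop (𝓝 0) := by
  set c := -Real.log r with hc
  have hc0 : 0 < c := by rw [hc]; linarith [Real.log_neg hr0 hr1]
  have h1 : ∀ᶠ n : ℕ in atTop, 2 * (n : ℝ) ^ a ≤ c * (n : ℝ) ^ H := by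
    filter_upwards [(tendsto_natCast_rpow (sub_pos.mpr haH)).eventually_ge_atTop (2 / c),
      eventually_ge_atTop 1] with n hn hn1
    have hn0 : (0 : ℝ) < n := by exact_mod_cast hn1
    rw [div_le_iff₀' hc0] at hn
    calc 2 * (n : ℝ) ^ a ≤ c * (n : ℝ) ^ (H - a) * (n : ℝ) ^ a := by gcongr
      _ = c * (n : ℝ) ^ H := by rw [mul_assoc, ← Real.rpow_add hn0]; congr 2; ring
  have h2 : Tendsto (fun n : ℕ => C * Real.exp c * Real.exp (-(n : ℝ) ^ a)) atTop (𝓝 0) := by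
    rw [← mul_zero (C * Real.exp c)]
    exact (Real.tendsto_exp_neg_atTop_nhds_zero.comp (tendsto_natCast_rpow ha)).const_mul _
  refine squeeze_zero' (Eventually.of_forall fun n => by positivity) ?_ h2
  filter_upwards [h1] with n hn
  have h3 := Nat.lt_floor_add_one ((n : ℝ) ^ H)
  have h4 : r ^ ⌊(n : ℝ) ^ H⌋₊ = Real.exp (-(c * ⌊(n : ℝ) ^ H⌋₊)) := by
    rw [← Real.exp_log (pow_pos hr0 _), Real.log_pow, hc]
    congr 1; ring
  rw [h4]
  calc Real.exp ((n : ℝ) ^ a) * (C * Real.exp (-(c * ⌊(n : ℝ) ^ H⌋₊)))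
      = C * Real.exp ((n : ℝ) ^ a - c * ⌊(n : ℝ) ^ H⌋₊) := by
        rw [sub_eq_add_neg, Real.exp_add]; ring
    _ ≤ C * Real.exp (c + -(n : ℝ) ^ a) := by
        gcongr
        nlinarith
    _ = _ := by rw [Real.exp_add]; ring

variable {φ : ℕ → unitInterval → ℝ} {x : (n : ℕ) → Fin n → unitInterval} {β₀ : ℝ}
  {K : ℕ → ℕ} {g : ℝ → ℝ}

/-- Here N = ⌊n^H⌋ with 1/(1+2β₀) < a < H < min(1/2, 1/(2(β₀-1/2))). The lower bound on H keeps k_n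
≤ N, the upper ones give the local comparison and N ≤ K. The prior mass beyond N is of order
e^{-cn^H}, negligible against e^{-n^a}, while n^a still dominates k_n log n. -/
lemma IsGeometricOrPoisson.exists_sieveWeights {w : ℕ → ℝ} (hw : IsGeometricOrPoisson w)
    (hβ₀ : 1 / 2 < β₀)
    (hK : Tendsto (fun n : ℕ => (K n : ℝ) / (n : ℝ) ^ (1 / (2 * (β₀ - 1 / 2)))) atTop atTop) :
    ∃ N : ℕ → ℕ, SieveWeights φ x g K β₀ N fun _ _ => w := by
  have hp0 : 0 < 1 / (1 + 2 * β₀) := by positivity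
  have hp1 : 1 / (1 + 2 * β₀) < 1 / 2 := one_div_lt_one_div_of_lt (by norm_num) (by linarith)
  have hp2 : 1 / (1 + 2 * β₀) < 1 / (2 * (β₀ - 1 / 2)) :=
    one_div_lt_one_div_of_lt (by linarith) (by linarith)
  obtain ⟨H, hpH, hH⟩ := exists_between (lt_min hp1 hp2)
  obtain ⟨a, hpa, haH⟩ := exists_between hpH
  have hH1 := hH.trans_le (min_le_left _ _)
  have hH2 := hH.trans_le (min_le_right _ _)
  obtain ⟨C, ρ, hC, hρ0, hρ1, hle⟩ := hw.exists_le
  obtain ⟨Cw, hCw, hge⟩ := hw.exists_exp_le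
  have hr0 : 0 < √ρ := Real.sqrt_pos.mpr hρ0
  have hr1 : √ρ < 1 := by rw [Real.sqrt_lt' one_pos]; simpa using hρ1
  refine ⟨fun n => ⌊(n : ℝ) ^ H⌋₊, ⟨⟨H, by linarith, hH1, ?_⟩, ?_, ?_, ?_, fun _ _ => hw.tsum_le,
    ⟨a, fun _ => w, fun n => C * √ρ ^ ⌊(n : ℝ) ^ H⌋₊ * (1 - √ρ)⁻¹, hpa, by linarith, ?_, fun n => ?_, ?_⟩,
    ⟨Cw, hCw, ?_⟩⟩⟩
  · exact Eventually.of_forall fun n => Nat.floor_le (by positivity)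
  · filter_upwards [hK.eventually_ge_atTop 1, eventually_ge_atTop 1] with n hn hn1
    have hn1' : (1 : ℝ) ≤ n := by exact_mod_cast hn1
    rw [le_div_iff₀ (by positivity), one_mul] at hn
    refine Nat.floor_le_of_le (le_trans ?_ hn)
    exact Real.rpow_le_rpow_of_exponent_le hn1' hH2.le
  · filter_upwards [eventually_ge_atTop 1] with n hn1
    have hn1' : (1 : ℝ) ≤ n := by exact_mod_cast hn1
    exact Nat.floor_mono (Real.rpow_le_rpow_of_exponent_le hn1' hpH.le)
  · exact Eventually.of_forall fun _ _ => hw.zero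
  · exact Eventually.of_forall fun _ _ _ _ => le_rfl
  · exact tsum_tail_le hC hr0 hr1 (by simpa [Real.sq_sqrt hρ0.le] using hle) _
  · have := tendsto_exp_rpow_mul_pow_floor (hp0.trans hpa) haH hr0 hr1
      (show 0 ≤ C * (1 - √ρ)⁻¹ from mul_nonneg hC.le (inv_nonneg.mpr (by linarith)))
    refine this.congr fun n => ?_
    ring
  · filter_upwards [tendsto_log_natCast.eventually_ge_atTop 1, eventually_ge_atTop 1]
      with n hlog hn1 y k hk
    rw [Finset.mem_Icc] at hk
    have hn1' : (1 : ℝ) ≤ n := by exact_mod_cast hn1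
    have hkn : k ≤ n := by
      refine hk.2.trans (Nat.floor_le_of_le ?_)
      calc (n : ℝ) ^ H ≤ (n : ℝ) ^ (1 : ℝ) := Real.rpow_le_rpow_of_exponent_le hn1' (by linarith)
        _ = n := Real.rpow_one _
    rw [evidence_hierPrior]
    refine le_trans ?_ (ENNReal.le_tsum k)
    gcongr
    exact hge n k hlog hk.1 hkn

/-- There is no mass beyond Kbar, so any a in (1/(1+2β₀), 1) would do. The evidence inequality, with
constant 0, is the maximality of the marginal likelihood at `khat`. The exponent becomes `max H 0`
since H may be negative. -/
lemma sieveWeights_empiricalBayes {Kbar : ℕ → ℕ} {khat : (n : ℕ) → (Fin n → Bool) → ℕ} {H : ℝ}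
    (hβ₀ : 1 / 2 < β₀) (hH : H < 1 / 2)
    (hKbar : ∀ᶠ n : ℕ in atTop, ⌊(n : ℝ) ^ (1 / (1 + 2 * β₀))⌋₊ ≤ Kbar n ∧
      (Kbar n : ℝ) ≤ (n : ℝ) ^ H ∧ Kbar n ≤ K n)
    (hkhat : ∀ᶠ n : ℕ in atTop, IsMMLE φ (x n) g (Kbar n) (khat n)) :
    SieveWeights φ x g K β₀ Kbar fun n y j => if j = khat n y then 1 else 0 := by
  have hp1 : 1 / (1 + 2 * β₀) < 1 / 2 := one_div_lt_one_div_of_lt (by norm_num) (by linarith)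
  refine ⟨⟨max H 0, le_max_right _ _, max_lt hH (by norm_num), ?_⟩, ?_, ?_, ?_, fun n y => ?_,
    ⟨1 / 2, fun _ _ => 0, fun _ => 0, hp1, by norm_num, ?_, fun n => ?_, ?_⟩, ⟨0, le_rfl, ?_⟩⟩
  · filter_upwards [hKbar, eventually_ge_atTop 1] with n hn hn1
    exact hn.2.1.trans (Real.rpow_le_rpow_of_exponent_le (by exact_mod_cast hn1) (le_max_left _ _))
  · filter_upwards [hKbar] with n hn using hn.2.2
  · filter_upwards [hKbar] with n hn using hn.1
  · filter_upwards [hkhat] with n hn y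
    have := (hn y).1.1
    rw [if_neg (by omega)]
  · rw [tsum_eq_single (khat n y) fun j hj => by simp [hj]]
    simp
  · filter_upwards [hkhat] with n hn y k hk
    have := (hn y).1.2
    rw [if_neg (by omega)]
  · simp
  · simp
  · filter_upwards [hkhat] with n hn y k hk
    rw [Finset.mem_Icc] at hk
    rw [← condPrior_eq_hierPrior, ← evidence_condPrior]
    simpa using (hn y).2 k hk

end

end LogisticSieve

theorem mainTheorem10
    (φ : ℕ → unitInterval → ℝ) (x : (n : ℕ) → Fin n → unitInterval)
    (B : ℝ) (hφ : ∀ j t, |φ j t| ≤ B)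
    (C₀ : ℝ) (hC₀ : 0 < C₀) (K : ℕ → ℕ)
    (hdesign : ∀ n : ℕ, 1 ≤ n → DesignCondition φ (x n) C₀ (K n))
    (β₀ L₀ : ℝ) (hβ₀ : 1 / 2 < β₀) (hL₀ : 0 < L₀)
    (hK : Tendsto (fun n : ℕ => (K n : ℝ) / (n : ℝ) ^ (1 / (2 * (β₀ - 1 / 2)))) atTop atTop)
    (g : ℝ → ℝ) (hg : IsSieveDensity g)
    (α : ℝ) (hα₀ : 0 < α) (hα₁ : α < 1)
    (R₀ k₀ : ℕ) (hR₀ : 1 < R₀) (hk₀ : 1 ≤ k₀) (τ : ℝ) (hτ₀ : 0 < τ) (hτ₁ : τ < 1)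
    (P : (n : ℕ) → (Fin n → Bool) → Measure SieveParam)
    -- `P` is the hierarchical posterior or the empirical Bayes posterior
    (hP : (∃ w : ℕ → ℝ, IsGeometricOrPoisson w ∧
          ∀ n y, P n y = posterior φ (x n) (hierPrior g w) y) ∨
      (∃ (Kbar : ℕ → ℕ) (khat : (n : ℕ) → (Fin n → Bool) → ℕ) (H : ℝ), H < 1 / 2 ∧
          (∀ᶠ n : ℕ in atTop, ⌊(n : ℝ) ^ (1 / (1 + 2 * β₀))⌋₊ ≤ Kbar n ∧
            (Kbar n : ℝ) ≤ (n : ℝ) ^ H ∧ Kbar n ≤ K n) ∧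
          (∀ᶠ n : ℕ in atTop, IsMMLE φ (x n) g (Kbar n) (khat n)) ∧
          ∀ n y, P n y = posterior φ (x n) (condPrior g (khat n y)) y)) :
    -- credible balls centered at the posterior mean
    (HasCoverage φ x α (fun n => polishedTail φ (x n) R₀ k₀ τ ∩ sobolevBall β₀ L₀) P
        (fun n y => meanProb φ (P n y)) ∧
      HasAdaptiveSize φ x α β₀ L₀ P (fun n y => meanProb φ (P n y))) ∧
    -- credible balls centered at any estimator that attains the rate
    (∀ qhat : (n : ℕ) → (Fin n → Bool) → unitInterval → ℝ,
      (∀ n y t, qhat n y t ∈ Set.Icc (0 : ℝ) 1) →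
      (IsRateCentering φ x (fun n => polishedTail φ (x n) R₀ k₀ τ ∩ sobolevBall β₀ L₀) qhat →
        HasCoverage φ x α (fun n => polishedTail φ (x n) R₀ k₀ τ ∩ sobolevBall β₀ L₀) P qhat) ∧
      (IsRateCentering φ x (fun _ => sobolevBall β₀ L₀) qhat →
        HasAdaptiveSize φ x α β₀ L₀ P qhat)) := by
  have h : RegressionSetup φ x B C₀ K β₀ L₀ := ⟨hφ, hC₀, hdesign, hβ₀, hL₀, hK⟩
  obtain ⟨N, W, hW, hPW⟩ : ∃ (N : ℕ → ℕ) (W : (n : ℕ) → (Fin n → Bool) → ℕ → ℝ),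
      SieveWeights φ x g K β₀ N W ∧
      ∀ n y, P n y = posterior φ (x n) (hierPrior g (W n y)) y := by
    rcases hP with ⟨w, hw, hP⟩ | ⟨Kbar, khat, H, hH, hKbar, hkhat, hP⟩
    · obtain ⟨N, hN⟩ := hw.exists_sieveWeights (φ := φ) (x := x) (g := g) hβ₀ hK
      exact ⟨N, _, hN, hP⟩
    · refine ⟨Kbar, _, sieveWeights_empiricalBayes hβ₀ hH hKbar hkhat, fun n y => ?_⟩
      rw [hP, condPrior_eq_hierPrior]
  have hmean := hW.isRateCentering_meanProb h hg hPW
  refine ⟨⟨?_, hW.hasAdaptiveSize h hg hPW hα₀ hα₁ hmean⟩, fun qhat hq => ⟨fun hc => ?_, fun hc =>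
    hW.hasAdaptiveSize h hg hPW hα₀ hα₁ hc⟩⟩
  · refine hW.hasCoverage h hg hPW hR₀ hk₀ hτ₀ hτ₁ hα₀ hα₁ (fun n y _ => meanProb_mem_Icc)
      fun η hη => ?_
    obtain ⟨M, hM, hcM⟩ := hmean η hη
    exact ⟨M, hM, hcM.mono fun n hn θ₀ hθ₀ => hn θ₀ hθ₀.2⟩
  · exact hW.hasCoverage h hg hPW hR₀ hk₀ hτ₀ hτ₁ hα₀ hα₁ (fun n y _ => hq n y) hc
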